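/- Let $k$ be a field of characteristic zero and $V=V_0\oplus V_1$ a $\mathbb Z/2$-graded vector space over $k$ (of arbitrary dimension), with parity reversion $\Pi V$. A cochain is a sequence $c=(c_n)_{n\ge 0}$ of multilinear maps $c_n:(\Pi V)^{\otimes n}\to\Pi V$; $c_0\in\Pi V$ is its constant term. For cochains put $(f\circ g)(x_1,\dots,x_n)=\sum_S\pm f(g(x_S),x_{S^c})$ in the graded symmetric ($L_\infty$) case, the sum being over all subsets $S\subset\{1,\dots,n\}$, and $(f\circ g)(x_1,\dots,x_n)=\sum_{i\le j}\pm f(x_1,\dots,x_i,g(x_{i+1},\dots,x_j),x_{j+1},\dots,x_n)$ in the $A_\infty$ case, with Koszul signs. An $L_\infty$- (resp. $A_\infty$-) structure on $V$ is an odd cochain $m$ that is graded symmetric (resp. arbitrary) with $m_0=0$ and $m\circ m=0$. $\mathrm{CE}(V,V)$ (resp. $\mathrm{Hoch}(V,V)$) is the dgla of all graded symmetric (resp. all) cochains with the graded commutator bracket $[f,g]=f\circ g-(-1)^{|f||g|}g\circ f$ and differential $[m,-]$; $\overline{\mathrm{CE}}(V,V)$, $\overline{\mathrm{Hoch}}(V,V)$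 are the sub-dglas of cochains with $c_0=0$. If $V$ carries a homogeneous (even or odd) graded symmetric non-degenerate inner product $\langle\,,\rangle$, put $\omega(\Pi a,\Pi b)=(-1)^{|a|}\langle a,b\rangle$; a cochain $c$ is cyclic if $\omega(c_n(x_1,\dots,x_n),x_{n+1})$ is invariant under cyclic permutations of $x_1,\dots,x_{n+1}\in \Pi V$ up to the Koszul sign, $m$ is called cyclic if it is a cyclic cochain, and $\mathrm{CE}(V)$, $\mathrm{CHoch}(V,V)$, $\overline{\mathrm{CE}}(V)$, $\overline{\mathrm{CHoch}}(V,V)$ are the sub-dglas of cyclic cochains. A dgla $L$ is an $L_\infty$-algebra with structure maps $\Pi x\mapsto-\Pi dx$, $\Pi x\otimes\Pi y\mapsto(-1)^{|x|}\Pi[x,y]$. For a dgla map $g:G\to H$ let $H_g=\{(x,h)\in G\oplus H[z,dz]: h|_{z=0}=0,\ h|_{z=1}=g(x)\}$, $H[z,dz]=H\otimes k[z,dz]$. A sequence $(V,m)\xrightarrow{\mathbf f}G\xrightarrow{g}H$ with $\mathbf f$ an $L_\infty$-map and $g$ a map of dglas is a homotopy fiber sequence of $L_\infty$-algebras if there is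 an $L_\infty$-quasi-isomorphism $V\to H_g$ whose composite with the projection $H_g\to G$ is $\mathbf f$. A homotopy between $L_\infty$-maps $V\to H$ is an $L_\infty$-map $V\to H[z,dz]$ restricting to them at $z=0$ and $z=1$. **Theorem.** Let $g$ denote the inclusion of the truncated complex into the full one. (1a) Let $(V,m)$ be an $L_\infty$-algebra, and let $\mathbf f=(f_r)_{r\ge1}$, $$f_r(w_1,\dots,w_r)(x_1,\dots,x_n)=m_{r+n}(w_1,\dots,w_r,x_1,\dots,x_n)\qquad(n\ge 1).$$ Then $V\xrightarrow{\mathbf f}\overline{\mathrm{CE}}(V,V)\xrightarrow{g}\mathrm{CE}(V,V)$ is a homotopy fiber sequence of $L_\infty$-algebras. (1b) If $(V,m)$ is a cyclic $L_\infty$-algebra, the same holds for $V\xrightarrow{\mathbf f}\overline{\mathrm{CE}}(V)\xrightarrow{g}\mathrm{CE}(V)$. (2a) Let $(V,m)$ be an $A_\infty$-algebra, regarded as an $L_\infty$-algebra $(V,\bar m)$ through $\bar m_n(x_1,\dots,x_n)=\sum_{\sigma\in S_n}\pm m_n(x_{\sigma(1)},\dots,x_{\sigma(n)})$, and let $$f_r(w_1,\dots,w_r)(x_1,\dots,x_n)=\sum_{\sigma\in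 S_r}m_{r+n}\bigl(\sigma(w_1\otimes\dots\otimes w_r)\,|\,x_1,\dots,x_n\bigr)\qquad(n\ge 1),$$ where $m(u\,|\,x)$ is the sum of $\pm m(y)$ over all shuffles $y$ of $u$ and $x$, with Koszul signs. Then $V\xrightarrow{\mathbf f}\overline{\mathrm{Hoch}}(V,V)\xrightarrow{g}\mathrm{Hoch}(V,V)$ is a homotopy fiber sequence of $L_\infty$-algebras. (2b) If $(V,m)$ is a cyclic $A_\infty$-algebra, the same holds for $V\xrightarrow{\mathbf f}\overline{\mathrm{CHoch}}(V,V)\xrightarrow{g}\mathrm{CHoch}(V,V)$. Concretely, in each case (writing $m$ for $\bar m$ in case (2)), let $\hat w$ be the constant cochain of $w\in\Pi V$ and $$s_1(w)=z f_1(w)+(-1)^{|w|}\hat w\,dz,\qquad s_r(w_1,\dots,w_r)=z^r f_r(w_1,\dots,w_r)+(z^r-z)\,\widehat{m_r(w_1,\dots,w_r)}\quad(r\ge 2),$$ where $|w|$ is the parity of $w$ in $\Pi V$. Then $s=(s_r)$ is a homotopy between $0$ and $g\circ\mathbf f$, and $(\mathbf f,s):V\to H_g$ is an $L_\infty$-quasi-isomorphism.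 -/

import Mathlib

open scoped TensorProduct Polynomial

namespace InftyAlg

/-! ### `ℤ/2`-graded vector spaces

Over a field of characteristic zero a `ℤ/2`-grading on `E` is the same thing as a linear involution
`P : E → E`, the parity operator: the elements of parity `i` are those with `P x = (-1)^i x`. -/

section Parity

variable (k : Type*) [Field k]

/-- The sign `(-1)^i`. -/
def sgn (i : ZMod 2) : k := if i = 0 then 1 else -1

variable {k} {E : Type*} [AddCommGroup E] [Module k E]

/-- The projection of `E` onto its part of parity `i`, for the parity operator `P`. -/
noncomputable def homPart (P : E →ₗ[k] E) (i : ZMod 2) : E →ₗ[k] E :=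
  (2 : k)⁻¹ • (LinearMap.id + sgn k i • P)

/-- The graded commutator `c x y - (-1)^{|x||y|} c y x` of a bilinear operation `c`. -/
noncomputable def gradedCommutator (P : E →ₗ[k] E) (c : E →ₗ[k] E →ₗ[k] E) :
    E →ₗ[k] E →ₗ[k] E :=
  c - ∑ i : ZMod 2, ∑ j : ZMod 2,
    sgn k (i * j) • c.flip.compl₁₂ (homPart P i) (homPart P j)

/-- The parity operator of `V = V₀ ⊕ V₁`. -/
def parV (k V₀ V₁ : Type*) [Field k] [AddCommGroup V₀] [Module k V₀] [AddCommGroup V₁]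
    [Module k V₁] : (V₀ × V₁) →ₗ[k] (V₀ × V₁) :=
  LinearMap.prodMap LinearMap.id (-LinearMap.id)

/-- The parity operator of the parity reversion `ΠV` of `V = V₀ ⊕ V₁`; the underlying vector space
of `ΠV` is that of `V`, with `V₀` odd and `V₁` even. -/
def parPi (k V₀ V₁ : Type*) [Field k] [AddCommGroup V₀] [Module k V₀] [AddCommGroup V₁]
    [Module k V₁] : (V₀ × V₁) →ₗ[k] (V₀ × V₁) :=
  LinearMap.prodMap (-LinearMap.id) LinearMap.id

end Parity

/-! ### Differential graded Lie algebras -/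

section DGLA

/-- The data of a (super) dg Lie algebra, presented as a subspace `carrier` of an ambient vector
space `E` on which the parity operator, the differential and the bracket are defined. -/
structure DGLieData (k : Type*) [Field k] (E : Type*) [AddCommGroup E] [Module k E] where
  carrier : Submodule k E
  par : E →ₗ[k] E
  d : E →ₗ[k] E
  br : E →ₗ[k] E →ₗ[k] E

variable {k : Type*} [Field k] {E : Type*} [AddCommGroup E] [Module k E]

/-- `x` is a homogeneous element of parity `i` of `L`. -/
def DGLieData.IsHom (L : DGLieData k E) (i : ZMod 2) (x : E) : Prop :=
  x ∈ L.carrier ∧ L.par x = sgn k i • x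

/-- The axioms of a dgla: closure of the carrier under the operations, an odd differential of square
zero, an even graded skew-symmetric bracket, the graded Jacobi identity and the graded Leibniz
rule. -/
structure IsDGLA (L : DGLieData k E) : Prop where
  par_mem : ∀ x ∈ L.carrier, L.par x ∈ L.carrier
  d_mem : ∀ x ∈ L.carrier, L.d x ∈ L.carrier
  br_mem : ∀ x ∈ L.carrier, ∀ y ∈ L.carrier, L.br x y ∈ L.carrier
  par_par : ∀ x ∈ L.carrier, L.par (L.par x) = x
  par_d : ∀ x ∈ L.carrier, L.par (L.d x) = -L.d (L.par x)
  par_br : ∀ x ∈ L.carrier, ∀ y ∈ L.carrier, L.par (L.br x y) = L.br (L.par x) (L.par y)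
  d_d : ∀ x ∈ L.carrier, L.d (L.d x) = 0
  skew : ∀ i j x y, L.IsHom i x → L.IsHom j y → L.br x y = -(sgn k (i * j) • L.br y x)
  jacobi : ∀ i j l x y z, L.IsHom i x → L.IsHom j y → L.IsHom l z →
    L.br x (L.br y z) = L.br (L.br x y) z + sgn k (i * j) • L.br y (L.br x z)
  leibniz : ∀ i x y, L.IsHom i x → y ∈ L.carrier →
    L.d (L.br x y) = L.br (L.d x) y + sgn k i • L.br x (L.d y)

/-- Morphisms of dglas. -/
structure IsDGLAHom {E' : Type*} [AddCommGroup E'] [Module k E'] (L : DGLieData k E)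
    (L' : DGLieData k E') (g : E →ₗ[k] E') : Prop where
  mem : ∀ x ∈ L.carrier, g x ∈ L'.carrier
  par : ∀ x ∈ L.carrier, g (L.par x) = L'.par (g x)
  d : ∀ x ∈ L.carrier, g (L.d x) = L'.d (g x)
  br : ∀ x ∈ L.carrier, ∀ y ∈ L.carrier, g (L.br x y) = L'.br (g x) (g y)

/-- The dgla `L[z,dz] = L ⊗ k[z,dz]`. A pair `(p, q)` of elements of `L ⊗ k[z]` stands for
`p + q dz`, so that `d (x zⁿ) = d x zⁿ + (-1)^{|x|} n x zⁿ⁻¹ dz` and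
`[x dz, y] = (-1)^{|y|} [x, y] dz`. -/
noncomputable def DGLieData.poly (L : DGLieData k E) :
    DGLieData k ((E ⊗[k] k[X]) × (E ⊗[k] k[X])) where
  carrier :=
    (LinearMap.range (TensorProduct.map L.carrier.subtype (LinearMap.id : k[X] →ₗ[k] k[X]))).prod
      (LinearMap.range (TensorProduct.map L.carrier.subtype (LinearMap.id : k[X] →ₗ[k] k[X])))
  par := LinearMap.prodMap (TensorProduct.map L.par LinearMap.id)
    (-TensorProduct.map L.par LinearMap.id)
  d := LinearMap.prod
    (TensorProduct.map L.d LinearMap.id ∘ₗ LinearMap.fst k _ _)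
    (TensorProduct.map L.par Polynomial.derivative ∘ₗ LinearMap.fst k _ _ +
      TensorProduct.map L.d LinearMap.id ∘ₗ LinearMap.snd k _ _)
  br :=
    let B : E ⊗[k] k[X] →ₗ[k] E ⊗[k] k[X] →ₗ[k] E ⊗[k] k[X] :=
      TensorProduct.map₂ L.br (LinearMap.mul k k[X])
    (B.compl₁₂ (LinearMap.fst k _ _) (LinearMap.fst k _ _)).compr₂ (LinearMap.inl k _ _) +
    (B.compl₁₂ (LinearMap.fst k _ _) (LinearMap.snd k _ _)).compr₂ (LinearMap.inr k _ _) +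
    (B.compl₁₂ (LinearMap.snd k _ _)
      (TensorProduct.map L.par LinearMap.id ∘ₗ LinearMap.fst k _ _)).compr₂ (LinearMap.inr k _ _)

/-- The evaluation `h ↦ h|_{z=a}` from `E[z,dz]` to `E`. -/
noncomputable def evalZ (E : Type*) [AddCommGroup E] [Module k E] (a : k) :
    ((E ⊗[k] k[X]) × (E ⊗[k] k[X])) →ₗ[k] E :=
  (TensorProduct.rid k E).toLinearMap ∘ₗ
    TensorProduct.map LinearMap.id (Polynomial.leval a) ∘ₗ LinearMap.fst k _ _

/-- The homotopy fiber
`H_g = {(x, h) ∈ G ⊕ H[z,dz] : h|_{z=0} = 0, h|_{z=1} = g x}` of a map `g : G → H` of dglas. -/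
noncomputable def hofiber {E' : Type*} [AddCommGroup E'] [Module k E'] (G : DGLieData k E)
    (H : DGLieData k E') (g : E →ₗ[k] E') :
    DGLieData k (E × ((E' ⊗[k] k[X]) × (E' ⊗[k] k[X]))) where
  carrier := G.carrier.prod H.poly.carrier ⊓
    LinearMap.ker (evalZ E' (0 : k) ∘ₗ LinearMap.snd k E _) ⊓
    LinearMap.ker (evalZ E' (1 : k) ∘ₗ LinearMap.snd k E _ - g ∘ₗ LinearMap.fst k E _)
  par := LinearMap.prodMap G.par H.poly.par
  d := LinearMap.prodMap G.d H.poly.d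
  br :=
    (G.br.compl₁₂ (LinearMap.fst k _ _) (LinearMap.fst k _ _)).compr₂ (LinearMap.inl k _ _) +
    (H.poly.br.compl₁₂ (LinearMap.snd k _ _) (LinearMap.snd k _ _)).compr₂ (LinearMap.inr k _ _)

end DGLA

/-! ### Cochains

Let `U` be a graded vector space with parity operator `P` (in the applications `U = ΠV`). A
continuous derivation of the completed tensor algebra `T̂ U^*` is the same thing as a linear map
`c : T U → U`, i.e. a sequence of multilinear maps `c_n : U^{⊗ n} → U`, `n ≥ 0`; a continuous
derivation of the completed symmetric algebra `Ŝ U^*` is the same thing as such a sequence of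
graded symmetric maps. The term `c_0`, i.e. the element `c 1`, is the constant term. -/

section Cochains

variable {k : Type*} [Field k] {U : Type*} [AddCommGroup U] [Module k U]

/-- The parity operator on `T U` induced by the parity operator of `U`. -/
noncomputable def parT (P : U →ₗ[k] U) : TensorAlgebra k U →ₗ[k] TensorAlgebra k U :=
  (TensorAlgebra.lift k (TensorAlgebra.ι k ∘ₗ P)).toLinearMap

/-- The parity operator on linear maps `T U → U`. -/
noncomputable def parC (P : U →ₗ[k] U) :
    (TensorAlgebra k U →ₗ[k] U) →ₗ[k] (TensorAlgebra k U →ₗ[k] U) where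
  toFun c := P ∘ₗ c ∘ₗ parT P
  map_add' a b := by ext; simp
  map_smul' r a := by ext; simp

/-- Graded symmetry of a linear map on `T U`, i.e. of the corresponding multilinear maps:
exchanging two neighbouring homogeneous arguments `x`, `y` produces the sign `(-1)^{|x||y|}`. -/
def gradedSymm (P : U →ₗ[k] U) (E : Type*) [AddCommGroup E] [Module k E] :
    Submodule k (TensorAlgebra k U →ₗ[k] E) where
  carrier := {c | ∀ (i j : ZMod 2) (x y : U) (a b : TensorAlgebra k U),
    P x = sgn k i • x → P y = sgn k j • y →
    c (a * TensorAlgebra.ι k x * TensorAlgebra.ι k y * b) =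
      sgn k (i * j) • c (a * TensorAlgebra.ι k y * TensorAlgebra.ι k x * b)}
  add_mem' ha hb i j x y a b hx hy := by
    simp only [LinearMap.add_apply, smul_add]
    rw [ha i j x y a b hx hy, hb i j x y a b hx hy]
  zero_mem' i j x y a b _ _ := by simp
  smul_mem' r c hc i j x y a b hx hy := by
    simp only [LinearMap.smul_apply]
    rw [hc i j x y a b hx hy, smul_comm]

/-- The linear maps on `T U` without constant term. -/
def noConst (k U : Type*) [Field k] [AddCommGroup U] [Module k U] :
    Submodule k (TensorAlgebra k U →ₗ[k] U) where
  carrier := {c | c 1 = 0}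
  add_mem' ha hb := by
    simp only [Set.mem_ofPred_eq] at ha hb ⊢
    simp [ha, hb]
  zero_mem' := by simp
  smul_mem' r c hc := by
    simp only [Set.mem_ofPred_eq] at hc ⊢
    simp [hc]

/-- The constant cochain `û` (constant derivation) associated with `u ∈ U`: its only nonzero
component is `û_0 = u`. -/
noncomputable def const (k U : Type*) [Field k] [AddCommGroup U] [Module k U] :
    U →ₗ[k] (TensorAlgebra k U →ₗ[k] U) :=
  LinearMap.smulRightₗ (TensorAlgebra.algebraMapInv (R := k) (M := U)).toLinearMap

/-- The reduced part of a tensor: its component in `T^{≥ 1} U`. -/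
noncomputable def redPart (k U : Type*) [Field k] [AddCommGroup U] [Module k U] :
    TensorAlgebra k U →ₗ[k] TensorAlgebra k U :=
  LinearMap.id - Algebra.linearMap k (TensorAlgebra k U) ∘ₗ
    (TensorAlgebra.algebraMapInv (R := k) (M := U)).toLinearMap

/-- Left multiplication by `u ∈ U` on `T U`. -/
noncomputable def mulι (k U : Type*) [Field k] [AddCommGroup U] [Module k U] :
    U →ₗ[k] (TensorAlgebra k U →ₗ[k] TensorAlgebra k U) :=
  LinearMap.mul k (TensorAlgebra k U) ∘ₗ TensorAlgebra.ι k

/-- The operator `a ⊗ b ↦ x a ⊗ b + (-1)^{|x||a|} a ⊗ x b` on `T U ⊗ T U`. -/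
noncomputable def unshuffleStep (P : U →ₗ[k] U) :
    U →ₗ[k] Module.End k (TensorAlgebra k U ⊗[k] TensorAlgebra k U) where
  toFun x := TensorProduct.map (mulι k U x) LinearMap.id +
    ∑ i : ZMod 2, TensorProduct.map (parT P ^ i.val) (mulι k U (homPart P i x))
  map_add' x y := by
    simp only [map_add, TensorProduct.map_add_left, TensorProduct.map_add_right,
      Finset.sum_add_distrib]
    abel
  map_smul' r x := by
    simp only [map_smul, TensorProduct.map_smul_left, TensorProduct.map_smul_right,
      Finset.smul_sum, smul_add, RingHom.id_apply]

/-- The unshuffle coproduct `Δ : T U → T U ⊗ T U`: on a word `x₁ ⋯ xₙ` with homogeneous letters it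
is the sum over all subsets `S` of `{1, …, n}` of `± x_S ⊗ x_{S^c}`, where the letters keep their
order and `±` is the Koszul sign. -/
noncomputable def unshuffle (P : U →ₗ[k] U) :
    TensorAlgebra k U →ₗ[k] TensorAlgebra k U ⊗[k] TensorAlgebra k U :=
  LinearMap.applyₗ (1 ⊗ₜ[k] 1) ∘ₗ (TensorAlgebra.lift k (unshuffleStep P)).toLinearMap

/-- The deconcatenation coproduct `x₁ ⋯ xₙ ↦ ∑_{0 ≤ i ≤ n} x₁ ⋯ x_i ⊗ x_{i+1} ⋯ xₙ`, obtained as the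
second component of `w ↦ (w, Δ w)`, which is computed letter by letter from
`Δ (x w) = 1 ⊗ x w + (x ⊗ 1) Δ w`. -/
noncomputable def deconcat (k U : Type*) [Field k] [AddCommGroup U] [Module k U] :
    TensorAlgebra k U →ₗ[k] TensorAlgebra k U ⊗[k] TensorAlgebra k U :=
  let step : U →ₗ[k]
      Module.End k (TensorAlgebra k U × (TensorAlgebra k U ⊗[k] TensorAlgebra k U)) :=
    { toFun := fun x => LinearMap.prod (mulι k U x ∘ₗ LinearMap.fst k _ _)
        (TensorProduct.mk k _ _ 1 ∘ₗ mulι k U x ∘ₗ LinearMap.fst k _ _ +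
          TensorProduct.map (mulι k U x) LinearMap.id ∘ₗ LinearMap.snd k _ _)
      map_add' := fun x y => by
        refine LinearMap.ext fun ⟨a, b⟩ => Prod.ext ?_ ?_
        · simp
        · simp [TensorProduct.map_add_left, TensorProduct.tmul_add]
          abel
      map_smul' := fun r x => by
        refine LinearMap.ext fun ⟨a, b⟩ => Prod.ext ?_ ?_
        · simp
        · simp [TensorProduct.map_smul_left] }
  LinearMap.snd k _ _ ∘ₗ LinearMap.applyₗ (1, 1 ⊗ₜ[k] 1) ∘ₗ (TensorAlgebra.lift k step).toLinearMap

/-- `(extS P g) w = ∑ g(w') w''`, the sum over the terms `w' ⊗ w''` of the unshuffle coproduct. -/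
noncomputable def extS (P : U →ₗ[k] U) :
    (TensorAlgebra k U →ₗ[k] U) →ₗ[k] (TensorAlgebra k U →ₗ[k] TensorAlgebra k U) where
  toFun g := LinearMap.mul' k (TensorAlgebra k U) ∘ₗ
    TensorProduct.map (TensorAlgebra.ι k ∘ₗ g) LinearMap.id ∘ₗ unshuffle P
  map_add' f g := by
    simp only [LinearMap.comp_add, TensorProduct.map_add_left, LinearMap.add_comp]
  map_smul' r f := by
    simp only [LinearMap.comp_smul, TensorProduct.map_smul_left, LinearMap.smul_comp,
      RingHom.id_apply]

/-- `(extT P g) (x₁ ⋯ xₙ) = ∑ (-1)^{|g|(|x₁| + ⋯ + |x_i|)} x₁ ⋯ x_i g(x_{i+1} ⋯ x_j) x_{j+1} ⋯ xₙ`,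
the sum over all `0 ≤ i ≤ j ≤ n`. -/
noncomputable def extT (P : U →ₗ[k] U) :
    (TensorAlgebra k U →ₗ[k] U) →ₗ[k] (TensorAlgebra k U →ₗ[k] TensorAlgebra k U) where
  toFun g := ∑ i : ZMod 2, LinearMap.mul' k (TensorAlgebra k U) ∘ₗ
    TensorProduct.map (parT P ^ i.val)
      (LinearMap.mul' k (TensorAlgebra k U) ∘ₗ
        TensorProduct.map (TensorAlgebra.ι k ∘ₗ homPart (parC P) i g) LinearMap.id ∘ₗ
        deconcat k U) ∘ₗ
    deconcat k U
  map_add' f g := by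
    simp only [map_add, LinearMap.comp_add, TensorProduct.map_add_left,
      TensorProduct.map_add_right, LinearMap.add_comp, Finset.sum_add_distrib]
  map_smul' r f := by
    simp only [map_smul, LinearMap.comp_smul, TensorProduct.map_smul_left,
      TensorProduct.map_smul_right, LinearMap.smul_comp, RingHom.id_apply, Finset.smul_sum]

/-- Composition of graded symmetric cochains,
`(f ∘ g)(x₁, …, xₙ) = ∑_S ± f(g(x_S), x_{S^c})`. -/
noncomputable def compS (P : U →ₗ[k] U) :
    (TensorAlgebra k U →ₗ[k] U) →ₗ[k] (TensorAlgebra k U →ₗ[k] U) →ₗ[k]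
      (TensorAlgebra k U →ₗ[k] U) :=
  (LinearMap.llcomp k (TensorAlgebra k U) (TensorAlgebra k U) U).compl₂ (extS P)

/-- Composition of cochains on the tensor algebra,
`(f ∘ g)(x₁, …, xₙ) = ∑ ± f(x₁, …, x_i, g(x_{i+1}, …, x_j), x_{j+1}, …, xₙ)`. -/
noncomputable def compT (P : U →ₗ[k] U) :
    (TensorAlgebra k U →ₗ[k] U) →ₗ[k] (TensorAlgebra k U →ₗ[k] U) →ₗ[k]
      (TensorAlgebra k U →ₗ[k] U) :=
  (LinearMap.llcomp k (TensorAlgebra k U) (TensorAlgebra k U) U).compl₂ (extT P)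

/-! ### `L_∞`- and `A_∞`-algebras and their complexes -/

/-- `m = (m_n)` is an `L_∞`-structure on `V`, where `U = ΠV`: odd graded symmetric maps
`m_n : U^{⊗ n} → U` with `m_0 = 0` and `∑_S ± m(m(x_S), x_{S^c}) = 0`. -/
structure IsLInfty (P : U →ₗ[k] U) (m : TensorAlgebra k U →ₗ[k] U) : Prop where
  odd : parC P m = -m
  symm : m ∈ gradedSymm P U
  const_eq_zero : m 1 = 0
  sq_zero : compS P m m = 0

/-- `m = (m_n)` is an `A_∞`-structure on `V`, where `U = ΠV`: odd maps `m_n : U^{⊗ n} → U` with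
`m_0 = 0` and `∑ ± m(x₁, …, m(x_{i+1}, …, x_j), …, xₙ) = 0`. -/
structure IsAInfty (P : U →ₗ[k] U) (m : TensorAlgebra k U →ₗ[k] U) : Prop where
  odd : parC P m = -m
  const_eq_zero : m 1 = 0
  sq_zero : compT P m m = 0

/-- The Chevalley–Eilenberg complex `CE(V,V)`: all graded symmetric cochains, with the graded
commutator bracket and the differential `[m, -]`. -/
noncomputable def CE (P : U →ₗ[k] U) (m : TensorAlgebra k U →ₗ[k] U) :
    DGLieData k (TensorAlgebra k U →ₗ[k] U) where
  carrier := gradedSymm P U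
  par := parC P
  d := gradedCommutator (parC P) (compS P) m
  br := gradedCommutator (parC P) (compS P)

/-- The Hochschild complex `Hoch(V,V)`: all cochains on `T U`, with the graded commutator bracket
and the differential `[m, -]`. -/
noncomputable def Hoch (P : U →ₗ[k] U) (m : TensorAlgebra k U →ₗ[k] U) :
    DGLieData k (TensorAlgebra k U →ₗ[k] U) where
  carrier := ⊤
  par := parC P
  d := gradedCommutator (parC P) (compT P) m
  br := gradedCommutator (parC P) (compT P)

/-- The part of `L` lying in a subspace `S` of the ambient space, with the same operations. -/
def DGLieData.restrict {E : Type*} [AddCommGroup E] [Module k E] (L : DGLieData k E)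
    (S : Submodule k E) : DGLieData k E :=
  { L with carrier := L.carrier ⊓ S }

/-- The cochains `c` such that `ω(c(x₁, …, xₙ), x_{n+1})` is invariant under cyclic permutations of
`x₁, …, x_{n+1}`, up to the Koszul sign. -/
def cyclic (P : U →ₗ[k] U) (ω : LinearMap.BilinForm k U) :
    Submodule k (TensorAlgebra k U →ₗ[k] U) where
  carrier := {c | ∀ (l i j : ZMod 2) (w : TensorAlgebra k U) (x y : U),
    parT P w = sgn k l • w → P x = sgn k i • x → P y = sgn k j • y →
    ω (c (w * TensorAlgebra.ι k x)) y =
      sgn k ((l + i) * j) * ω (c (TensorAlgebra.ι k y * w)) x}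
  add_mem' ha hb l i j w x y hw hx hy := by
    simp only [LinearMap.add_apply, map_add, mul_add]
    rw [ha l i j w x y hw hx hy, hb l i j w x y hw hx hy]
  zero_mem' l i j w x y _ _ _ := by simp
  smul_mem' r c hc l i j w x y hw hx hy := by
    simp only [LinearMap.smul_apply, map_smul, smul_eq_mul]
    rw [hc l i j w x y hw hx hy]
    ring

/-- A non-degenerate graded symmetric inner product on `V = V₀ ⊕ V₁`, homogeneous of parity `e`. -/
structure IsInnerProduct {V₀ V₁ : Type*} [AddCommGroup V₀] [Module k V₀] [AddCommGroup V₁]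
    [Module k V₁] (e : ZMod 2) (B : LinearMap.BilinForm k (V₀ × V₁)) : Prop where
  parity : ∀ x y, B (parV k V₀ V₁ x) (parV k V₀ V₁ y) = sgn k e * B x y
  symm : ∀ (i j : ZMod 2) x y, parV k V₀ V₁ x = sgn k i • x → parV k V₀ V₁ y = sgn k j • y →
    B x y = sgn k (i * j) * B y x
  nondegenerate : B.Nondegenerate

/-- The form `ω(Πx, Πy) = (-1)^{|x|} ⟨x, y⟩` on `ΠV` corresponding to an inner product on `V`; it is
graded skew-symmetric. -/
def sympl {V₀ V₁ : Type*} [AddCommGroup V₀] [Module k V₀] [AddCommGroup V₁] [Module k V₁]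
    (B : LinearMap.BilinForm k (V₀ × V₁)) : LinearMap.BilinForm k (V₀ × V₁) :=
  B ∘ₗ parV k V₀ V₁

/-! ### `L_∞`-maps, homotopies, homotopy fiber sequences -/

variable {E : Type*} [AddCommGroup E] [Module k E]

/-- `F = (f_r)` is an `L_∞`-map from `(V, m)`, `U = ΠV`, to the dgla `L`: graded symmetric maps
`f_r : U^{⊗ r} → ΠL`, `r ≥ 1`, which are even and compatible with the `L_∞`-structures. Here a dgla
`L` is an `L_∞`-algebra with structure maps `Πx ↦ -Π(dx)` and `Πx ⊗ Πy ↦ (-1)^{|x|} Π[x, y]` on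
`ΠL`, so that the Maurer–Cartan equation in `L` is `dξ + ½[ξ, ξ] = 0`. -/
structure IsLInftyMap (P : U →ₗ[k] U) (m : TensorAlgebra k U →ₗ[k] U) (L : DGLieData k E)
    (F : TensorAlgebra k U →ₗ[k] E) : Prop where
  mem : ∀ w, F w ∈ L.carrier
  even : ∀ w, L.par (F w) = -F (parT P w)
  symm : F ∈ gradedSymm P E
  const_eq_zero : F 1 = 0
  compat : ∀ w, -L.d (F w) +
      (2 : k)⁻¹ • TensorProduct.lift (L.br ∘ₗ L.par) (TensorProduct.map F F (unshuffle P w)) =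
    F (extS P m w)

/-- `F` is an `L_∞`-quasi-isomorphism: an `L_∞`-map whose linear part `f_1` induces an isomorphism
from the homology of `(ΠV, m_1)` to the homology of `L`. -/
structure IsLInftyQuasiIso (P : U →ₗ[k] U) (m : TensorAlgebra k U →ₗ[k] U) (L : DGLieData k E)
    (F : TensorAlgebra k U →ₗ[k] E) : Prop where
  isLInftyMap : IsLInftyMap P m L F
  injective : ∀ u : U, m (TensorAlgebra.ι k u) = 0 →
    (∃ y ∈ L.carrier, L.d y = F (TensorAlgebra.ι k u)) → ∃ v : U, m (TensorAlgebra.ι k v) = u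
  surjective : ∀ y ∈ L.carrier, L.d y = 0 → ∃ u : U, m (TensorAlgebra.ι k u) = 0 ∧
    ∃ y' ∈ L.carrier, L.d y' = y - F (TensorAlgebra.ι k u)

/-- `s` is a homotopy between the maps `F, F' : V → L`. -/
def IsHomotopy (P : U →ₗ[k] U) (m : TensorAlgebra k U →ₗ[k] U) (L : DGLieData k E)
    (F F' : TensorAlgebra k U →ₗ[k] E)
    (s : TensorAlgebra k U →ₗ[k] (E ⊗[k] k[X]) × (E ⊗[k] k[X])) : Prop :=
  IsLInftyMap P m L.poly s ∧ evalZ E 0 ∘ₗ s = F ∧ evalZ E 1 ∘ₗ s = F'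

/-- `V → G → H`, with maps `F` and `g`, is a homotopy fiber sequence of `L_∞`-algebras: `G`, `H` are
dglas, `g` is a dgla map, `F` is an `L_∞`-map, and the sequence is `L_∞`-quasi-isomorphic to the
homotopy fiber sequence `H_g → G → H`, by means of an `L_∞`-quasi-isomorphism `V → H_g` over `G` and
the identity maps of `G` and `H`. -/
structure IsHomotopyFiberSequence {E' : Type*} [AddCommGroup E'] [Module k E'] (P : U →ₗ[k] U)
    (m : TensorAlgebra k U →ₗ[k] U) (G : DGLieData k E) (H : DGLieData k E')
    (F : TensorAlgebra k U →ₗ[k] E) (g : E →ₗ[k] E') : Prop where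
  isLInfty : IsLInfty P m
  isDGLA_mid : IsDGLA G
  isDGLA_right : IsDGLA H
  isLInftyMap : IsLInftyMap P m G F
  isDGLAHom : IsDGLAHom G H g
  exists_quasiIso : ∃ Φ : TensorAlgebra k U →ₗ[k] E × ((E' ⊗[k] k[X]) × (E' ⊗[k] k[X])),
    IsLInftyQuasiIso P m (hofiber G H g) Φ ∧ LinearMap.fst k _ _ ∘ₗ Φ = F

/-! ### The maps -/

/-- The map `f` of an `L_∞`-algebra: for `r, n ≥ 1`,
`f_r(w₁, …, w_r)(x₁, …, xₙ) = m_{r+n}(w₁, …, w_r, x₁, …, xₙ)`, and the remaining components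
(`r = 0` or `n = 0`) vanish. -/
noncomputable def mapS (m : TensorAlgebra k U →ₗ[k] U) :
    TensorAlgebra k U →ₗ[k] (TensorAlgebra k U →ₗ[k] U) :=
  ((LinearMap.mul k (TensorAlgebra k U)).compl₁₂ (redPart k U) (redPart k U)).compr₂ m

/-- `(insertAll P) (w₁ ⋯ w_r) (x₁ ⋯ xₙ)`: the sum, with Koszul signs, of all words that are obtained
by inserting the letters `w₁, …, w_r`, in all possible relative orders, in the word `x₁ ⋯ xₙ`; i.e.
the sum over `σ ∈ S_r` of all shuffles of `σ(w₁ ⊗ ⋯ ⊗ w_r)` with `x₁ ⋯ xₙ`. The insertion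
`x₁ ⋯ xₙ ↦ ∑ (-1)^{|w|(|x₁| + ⋯ + |x_i|)} x₁ ⋯ x_i w x_{i+1} ⋯ xₙ` of one letter is `extT P ŵ`. -/
noncomputable def insertAll (P : U →ₗ[k] U) :
    TensorAlgebra k U →ₗ[k] Module.End k (TensorAlgebra k U) :=
  (TensorAlgebra.lift k (A := Module.End k (TensorAlgebra k U))
    (extT P ∘ₗ const k U)).toLinearMap

/-- The `L_∞`-structure `m̄` of an `A_∞`-algebra: `m̄_n(x₁, …, xₙ) = ∑_{σ ∈ S_n} ± m_n(x_σ)`. -/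
noncomputable def symmetrize (P : U →ₗ[k] U) (m : TensorAlgebra k U →ₗ[k] U) :
    TensorAlgebra k U →ₗ[k] U :=
  m ∘ₗ LinearMap.applyₗ 1 ∘ₗ insertAll P

/-- The map `f` of an `A_∞`-algebra: for `r, n ≥ 1`,
`f_r(w₁, …, w_r)(x₁, …, xₙ) = ∑_{σ ∈ S_r} m_{r+n}(σ(w₁ ⊗ ⋯ ⊗ w_r) | x₁, …, xₙ)`, where
`m(w | x)` is the sum of `± m(z)` over all shuffles `z` of `w` and `x`; the remaining components
(`r = 0` or `n = 0`) vanish. -/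
noncomputable def mapT (P : U →ₗ[k] U) (m : TensorAlgebra k U →ₗ[k] U) :
    TensorAlgebra k U →ₗ[k] (TensorAlgebra k U →ₗ[k] U) :=
  (LinearMap.compl₁₂ (insertAll P) (redPart k U) (redPart k U)).compr₂ m

/-- The map `T U → T U ⊗ k[z]` which is `w ↦ w zʳ` on `U^{⊗ r}`. -/
noncomputable def scaleZ (k U : Type*) [Field k] [AddCommGroup U] [Module k U] :
    TensorAlgebra k U →ₗ[k] TensorAlgebra k U ⊗[k] k[X] :=
  (TensorAlgebra.lift k (A := TensorAlgebra k U ⊗[k] k[X])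
    ((TensorProduct.mk k (TensorAlgebra k U) k[X]).flip Polynomial.X ∘ₗ
      TensorAlgebra.ι k)).toLinearMap

/-- The explicit homotopy: for an `L_∞`-structure `m` and `F = (f_r)`,
`s_r(w₁, …, w_r) = zʳ f_r(w₁, …, w_r) + (zʳ - z) ĉ` with `c = m_r(w₁, …, w_r)` for `r ≥ 2`, and
`s_1(w) = z f_1(w) + (-1)^{|w|} ŵ dz`, where `|w|` is the parity of `w ∈ ΠV`. -/
noncomputable def nullHomotopy (P : U →ₗ[k] U) (m : TensorAlgebra k U →ₗ[k] U)
    (F : TensorAlgebra k U →ₗ[k] (TensorAlgebra k U →ₗ[k] U)) :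
    TensorAlgebra k U →ₗ[k]
      ((TensorAlgebra k U →ₗ[k] U) ⊗[k] k[X]) × ((TensorAlgebra k U →ₗ[k] U) ⊗[k] k[X]) :=
  LinearMap.prod
    (TensorProduct.map (F + const k U ∘ₗ m) LinearMap.id ∘ₗ scaleZ k U -
      (TensorProduct.mk k _ _).flip Polynomial.X ∘ₗ const k U ∘ₗ m)
    ((TensorProduct.mk k _ _).flip 1 ∘ₗ const k U ∘ₗ P ∘ₗ TensorAlgebra.ιInv)

end Cochains

end InftyAlg

open InftyAlg

/-! All four cases are instances of one statement about higher derived brackets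
(`IsDerivedBracket`). Let `L` be a super Lie algebra that is, as a vector space, the sum of an
abelian subalgebra `U` and a subalgebra `ker pr`, and let `m` be an odd element of `ker pr` with
`[m, m] = 0`. For cochains, `U` consists of the constant cochains and `pr` takes the constant term.
The bracket of a cochain with `û` inserts `u` as an argument, so the iterated bracket `F(w₁, …, w_r)
= [⋯[m, w₁], ⋯, w_r]` is `m` with `r` arguments filled in. Hence `pr F` is the given
`L_∞`-structure, and `F - pr F` in degrees `r ≥ 1` is the map `f` of the theorem.

Two facts carry the `L_∞`-identities, stated up to signs. Bracketing with elements of `U` acts by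
derivations, so it propagates `[m, m] = 0` to the vanishing of the total self-bracket of `F`
(`brConv_self`). The bracket of `F(w)` with `u` is `F(w u)`, so mixed brackets between `F` and a
`U`-valued map turn into insertions (`brConv_cross`). Expanding the Maurer–Cartan expression of `tʳ
F - t pr F` with these rules gives `derivedMap_compat`, for every scalar `t`. At `t = 1`, applying
`pr` to it shows that `pr F` squares to zero, and then the identity itself says that `F - pr F` is
an `L_∞`-map to `ker pr`. For varying `t` it is the `dz`-free part of the equation for the homotopy.
The `dz`-part says that the `t`-derivative of `tʳ F(w)` is obtained by bracketing with one letter of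
`w` at a time (`map_insertConv_ιInv`).

The quasi-isomorphism is proved by integration over `z`. In the homotopy fiber, integrating the
`dz`-component from 0 to 1 and applying `pr` recovers, up to parity signs, an element of `U`; modulo
`ker pr` the differential `[m, -]` on `U` is `m₁`. See `injective_aux` and `surjective_aux`.

It remains to exhibit the Lie algebras. Both compositions are graded pre-Lie (`compS_assoc`,
`extT_assoc`), so their commutators are Lie brackets. Cyclic cochains are treated as a subalgebra:
what prevents `f ∘ g` from being cyclic cancels against the same terms in `g ∘ f`
(`sub_mem_cyclic`). -/

namespace InftyAlg

set_option linter.unusedSectionVars false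

/-! ### Signs and homogeneous elements -/

section Signs

variable (k : Type*) [Field k]

@[simp] theorem sgn_zero : sgn k 0 = 1 := rfl

@[simp] theorem sgn_one : sgn k 1 = -1 := rfl

theorem zmod_two_cases (i : ZMod 2) : i = 0 ∨ i = 1 := by
  revert i; decide

theorem sgn_add (i j : ZMod 2) : sgn k (i + j) = sgn k i * sgn k j := by
  rcases zmod_two_cases i with rfl | rfl <;> rcases zmod_two_cases j with rfl | rfl
  · simp
  · simp
  · simp
  · rw [show (1 + 1 : ZMod 2) = 0 from rfl]; simp

theorem neg_eq_sgn_smul {E : Type*} [AddCommGroup E] [Module k E] (x : E) :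
    -x = sgn k 1 • x := by simp

variable {k} {E : Type*} [AddCommGroup E] [Module k E] {P : E →ₗ[k] E}

theorem sgn_smul_sgn_smul (i j : ZMod 2) (x : E) :
    sgn k i • sgn k j • x = sgn k (i + j) • x := by
  rw [smul_smul, sgn_add]

theorem sgn_smul_self (i : ZMod 2) (x : E) : sgn k i • sgn k i • x = x := by
  rw [sgn_smul_sgn_smul, show i + i = 0 by revert i; decide]; simp

theorem pow_val_of_hom {b : ZMod 2} {x : E} (hx : P x = sgn k b • x) (i : ZMod 2) :
    (P ^ i.val) x = sgn k (i * b) • x := by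
  rcases zmod_two_cases i with rfl | rfl
  · simp
  · simpa [show (1 : ZMod 2).val = 1 from rfl] using hx

variable [CharZero k]

theorem homPart_add (P : E →ₗ[k] E) (x : E) : homPart P 0 x + homPart P 1 x = x := by
  have h : (2 : k)⁻¹ + 2⁻¹ = 1 := by norm_num
  simp only [homPart, LinearMap.smul_apply, LinearMap.add_apply, LinearMap.id_apply, sgn_zero,
    sgn_one, smul_add, neg_smul, one_smul, smul_neg]
  rw [LinearMap.neg_apply, LinearMap.smul_apply]
  calc _ = (2 : k)⁻¹ • x + (2 : k)⁻¹ • x := by abel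
    _ = x := by rw [← add_smul, h, one_smul]

theorem apply_homPart (hP : ∀ x, P (P x) = x) (i : ZMod 2) (x : E) :
    P (homPart P i x) = sgn k i • homPart P i x := by
  simp only [homPart, LinearMap.smul_apply, LinearMap.add_apply, LinearMap.id_apply, map_smul,
    map_add, hP]
  rcases zmod_two_cases i with rfl | rfl
  · simp [add_comm]
  · simp only [sgn_one, neg_smul, one_smul, ← smul_neg]
    congr 1; abel

theorem homPart_of_hom {i : ZMod 2} {x : E} (hx : P x = sgn k i • x) (j : ZMod 2) :
    homPart P j x = if j = i then x else 0 := by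
  have h : (2 : k)⁻¹ + 2⁻¹ = 1 := by norm_num
  simp only [homPart, LinearMap.smul_apply, LinearMap.add_apply, LinearMap.id_apply, hx,
    sgn_smul_sgn_smul]
  split_ifs with hij
  · subst hij
    rw [CharTwo.add_self_eq_zero, sgn_zero, one_smul, smul_add, ← add_smul, h, one_smul]
  · rw [show j + i = 1 by clear hx; revert i j; decide]
    simp

/-- As 2 is invertible, every element is the sum of its two homogeneous parts. This reduces
identities without explicit signs to homogeneous elements, where the Koszul signs are scalars that
`decide` can compare. -/
theorem hom_induction (hP : ∀ x, P (P x) = x) {p : E → Prop} (add : ∀ x y, p x → p y → p (x + y))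
    (hom : ∀ i x, P x = sgn k i • x → p x) (x : E) : p x := by
  rw [← homPart_add P x]
  exact add _ _ (hom _ _ (apply_homPart hP _ _)) (hom _ _ (apply_homPart hP _ _))

/-- Linear maps that agree on the homogeneous elements are equal. -/
theorem eq_of_hom {X : Type*} [AddCommGroup X] [Module k X] (hP : ∀ x, P (P x) = x)
    {f g : E →ₗ[k] X} (h : ∀ i x, P x = sgn k i • x → f x = g x) (x : E) : f x = g x :=
  hom_induction hP (p := fun x => f x = g x) (fun x y hx hy => by rw [map_add, map_add, hx, hy])
    h x

theorem sum_homPart_of_hom {X : Type*} [AddCommGroup X] [Module k X] {i : ZMod 2} {x : E}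
    (hx : P x = sgn k i • x) (f : ZMod 2 → E →ₗ[k] X) : ∑ j, f j (homPart P j x) = f i x := by
  rw [Finset.sum_eq_single i]
  · rw [homPart_of_hom hx, if_pos rfl]
  · intro j _ hj
    rw [homPart_of_hom hx, if_neg hj, map_zero]
  · simp

/-- For homogeneous arguments a single term of the defining double sum survives. -/
theorem gradedCommutator_apply (c : E →ₗ[k] E →ₗ[k] E) {i j : ZMod 2} {x y : E}
    (hx : P x = sgn k i • x) (hy : P y = sgn k j • y) :
    gradedCommutator P c x y = c x y - sgn k (i * j) • c y x := by
  simp only [gradedCommutator, LinearMap.sub_apply, LinearMap.sum_apply, LinearMap.smul_apply,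
    LinearMap.compl₁₂_apply, LinearMap.flip_apply]
  congr 1
  have h1 := fun i' : ZMod 2 => sum_homPart_of_hom (P := P) hy
    (fun j' => sgn k (i' * j') • (c.flip (homPart P i' x)))
  simp only [LinearMap.smul_apply, LinearMap.flip_apply] at h1
  simp only [h1]
  exact sum_homPart_of_hom hx (fun i' => sgn k (i' * j) • (c y))

variable {M N : Type*} [AddCommGroup M] [Module k M] [AddCommGroup N] [Module k N]
  {Q : M →ₗ[k] M} {R : N →ₗ[k] N}

theorem tensor_eq_of_hom {X : Type*} [AddCommGroup X] [Module k X] (hQ : ∀ x, Q (Q x) = x)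
    (hR : ∀ x, R (R x) = x) {f g : M ⊗[k] N →ₗ[k] X}
    (h : ∀ i j a b, Q a = sgn k i • a → R b = sgn k j • b → f (a ⊗ₜ b) = g (a ⊗ₜ b)) : f = g := by
  refine TensorProduct.ext' fun a b => ?_
  refine hom_induction hQ (p := fun a => f (a ⊗ₜ b) = g (a ⊗ₜ b)) ?_ ?_ a
  · intro x y hx hy
    rw [TensorProduct.add_tmul, map_add, map_add, hx, hy]
  · intro i x hx
    refine hom_induction hR (p := fun b => f (x ⊗ₜ b) = g (x ⊗ₜ b)) ?_ ?_ b
    · intro y z hy hz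
      rw [TensorProduct.tmul_add, map_add, map_add, hy, hz]
    · intro j y hy
      exact h i j x y hx hy

end Signs

/-! ### The tensor algebra and the unshuffle coproduct -/

section Tensor

variable {k : Type*} [Field k] {U : Type*} [AddCommGroup U] [Module k U] {P : U →ₗ[k] U}

local notation "T" => TensorAlgebra k U
local notation "ιT" => TensorAlgebra.ι k
local notation "εT" => TensorAlgebra.algebraMapInv (R := k) (M := U)

@[simp] theorem parT_one : parT P (1 : T) = 1 := by simp [parT]

@[simp] theorem parT_mul (a b : T) : parT P (a * b) = parT P a * parT P b := by simp [parT]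

@[simp] theorem parT_ι (x : U) : parT P (ιT x) = ιT (P x) := by simp [parT]

theorem parT_ι_of_hom {i : ZMod 2} {x : U} (hx : P x = sgn k i • x) :
    parT P (ιT x) = sgn k i • ιT x := by rw [parT_ι, hx, map_smul]

theorem parT_mul_of_hom {i j : ZMod 2} {a b : T} (ha : parT P a = sgn k i • a)
    (hb : parT P b = sgn k j • b) : parT P (a * b) = sgn k (i + j) • (a * b) := by
  rw [parT_mul, ha, hb, smul_mul_smul_comm, sgn_add]

theorem parT_one_hom : parT P (1 : T) = sgn k 0 • (1 : T) := by simp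

@[simp] theorem parT_pow_one (n : ℕ) : (parT P ^ n) (1 : T) = 1 := by
  induction n with
  | zero => rfl
  | succ n ih => rw [pow_succ, Module.End.mul_apply, parT_one, ih]

theorem parT_pow_mul (n : ℕ) (a b : T) :
    (parT P ^ n) (a * b) = (parT P ^ n) a * (parT P ^ n) b := by
  induction n generalizing a b with
  | zero => rfl
  | succ n ih => simp only [pow_succ, Module.End.mul_apply, parT_mul, ih]

@[simp] theorem mulι_apply (x : U) (a : T) : mulι k U x a = ιT x * a := rfl

theorem algebraMapInv_parT (w : T) : εT (parT P w) = εT w := by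
  have : (TensorAlgebra.algebraMapInv (R := k) (M := U)).comp
      (TensorAlgebra.lift k (TensorAlgebra.ι k ∘ₗ P)) = TensorAlgebra.algebraMapInv := by
    ext x; simp [TensorAlgebra.algebraMapInv]
  exact DFunLike.congr_fun this w

@[simp] theorem algebraMapInv_ι (x : U) : εT (ιT x) = 0 := by simp [TensorAlgebra.algebraMapInv]

/-- `ιInv` is the second component of an algebra map to the trivial square-zero extension, and the
first component of that map is the augmentation; the formula is the product rule there. -/
theorem ιInv_ι_mul (x : U) (w : T) : TensorAlgebra.ιInv (ιT x * w) = εT w • x := by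
  -- The same right action as in the definition of `ιInv`, so that the `change` below is
  -- definitional.
  let _ : Module kᵐᵒᵖ U := Module.compHom _ ((RingHom.id k).fromOpposite mul_comm)
  have _ : IsCentralScalar k U := ⟨fun r m => rfl⟩
  have h : (TrivSqZeroExt.fstHom k k U).comp TensorAlgebra.toTrivSqZeroExt =
      TensorAlgebra.algebraMapInv (R := k) (M := U) := by
    ext x; simp
  have h2 : TrivSqZeroExt.fst (TensorAlgebra.toTrivSqZeroExt w) = εT w := DFunLike.congr_fun h w
  change TrivSqZeroExt.snd (TensorAlgebra.toTrivSqZeroExt (ιT x * w)) = _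
  rw [map_mul, TensorAlgebra.toTrivSqZeroExt_ι, TrivSqZeroExt.snd_mul]
  simp [h2]

@[simp] theorem ιInv_one : TensorAlgebra.ιInv (1 : T) = 0 := by
  let _ : Module kᵐᵒᵖ U := Module.compHom _ ((RingHom.id k).fromOpposite mul_comm)
  have _ : IsCentralScalar k U := ⟨fun r m => rfl⟩
  change TrivSqZeroExt.snd (TensorAlgebra.toTrivSqZeroExt (1 : T)) = _
  rw [map_one, TrivSqZeroExt.snd_one]

@[simp] theorem ιInv_ι (x : U) : TensorAlgebra.ιInv (R := k) (ιT x) = x := by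
  simpa using ιInv_ι_mul x (1 : T)

variable [CharZero k]

/-- Words are built letter by letter from the left, with homogeneous letters. To handle arbitrary
products in the induction principle of the tensor algebra, one proves that `p` is stable under left
multiplication by every element. -/
theorem left_induction (hP : ∀ x, P (P x) = x) {p : T → Prop} (one : p 1)
    (add : ∀ a b, p a → p b → p (a + b)) (smul : ∀ (r : k) a, p a → p (r • a))
    (mul : ∀ i x w, P x = sgn k i • x → p w → p (ιT x * w)) (w : T) : p w := by
  have key : ∀ a : T, ∀ b, p b → p (a * b) := by
    intro a
    induction a using TensorAlgebra.induction with
    | algebraMap r =>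
      intro b hb
      rw [← Algebra.smul_def]
      exact smul r b hb
    | ι x =>
      intro b hb
      refine hom_induction hP (p := fun x => p (ιT x * b)) ?_ ?_ x
      · intro x y hx hy
        rw [map_add, add_mul]
        exact add _ _ hx hy
      · intro i x hx
        exact mul i x b hx hb
    | mul a a' ha ha' =>
      intro b hb
      rw [mul_assoc]
      exact ha _ (ha' _ hb)
    | add a a' ha ha' =>
      intro b hb
      rw [add_mul]
      exact add _ _ (ha _ hb) (ha' _ hb)
  simpa using key w 1 one

theorem right_induction (hP : ∀ x, P (P x) = x) {p : T → Prop} (one : p 1)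
    (add : ∀ a b, p a → p b → p (a + b)) (smul : ∀ (r : k) a, p a → p (r • a))
    (mul : ∀ i x w, P x = sgn k i • x → p w → p (w * ιT x)) (w : T) : p w := by
  have key : ∀ a : T, ∀ b, p b → p (b * a) := by
    intro a
    induction a using TensorAlgebra.induction with
    | algebraMap r =>
      intro b hb
      rw [← Algebra.commutes, ← Algebra.smul_def]
      exact smul r b hb
    | ι x =>
      intro b hb
      refine hom_induction hP (p := fun x => p (b * ιT x)) ?_ ?_ x
      · intro x y hx hy
        rw [map_add, mul_add]
        exact add _ _ hx hy
      · intro i x hx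
        exact mul i x b hx hb
    | mul a a' ha ha' =>
      intro b hb
      rw [← mul_assoc]
      exact ha' _ (ha _ hb)
    | add a a' ha ha' =>
      intro b hb
      rw [mul_add]
      exact add _ _ (ha _ hb) (ha' _ hb)
  simpa using key w 1 one

/-- Two linear maps on `T U` are equal if they agree on `1` and agreement on `w` implies agreement
on `x w`. -/
theorem eq_of_left (hP : ∀ x, P (P x) = x) {X : Type*} [AddCommGroup X] [Module k X]
    {f g : T →ₗ[k] X} (one : f 1 = g 1)
    (mul : ∀ i x w, P x = sgn k i • x → f w = g w → f (ιT x * w) = g (ιT x * w)) (w : T) :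
    f w = g w :=
  left_induction hP (p := fun w => f w = g w) one
    (fun a b ha hb => by rw [map_add, map_add, ha, hb])
    (fun r a ha => by rw [map_smul, map_smul, ha]) mul w

theorem eq_of_right (hP : ∀ x, P (P x) = x) {X : Type*} [AddCommGroup X] [Module k X]
    {f g : T →ₗ[k] X} (one : f 1 = g 1)
    (mul : ∀ i x w, P x = sgn k i • x → f w = g w → f (w * ιT x) = g (w * ιT x)) (w : T) :
    f w = g w :=
  right_induction hP (p := fun w => f w = g w) one
    (fun a b ha hb => by rw [map_add, map_add, ha, hb])
    (fun r a ha => by rw [map_smul, map_smul, ha]) mul w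

theorem parT_parT (hP : ∀ x, P (P x) = x) (w : T) : parT P (parT P w) = w := by
  induction w using TensorAlgebra.induction with
  | algebraMap r => simp [Algebra.algebraMap_eq_smul_one]
  | ι x => simp [hP]
  | mul a b ha hb => simp [ha, hb]
  | add a b ha hb => simp [ha, hb]

theorem unshuffle_one : unshuffle P (1 : T) = 1 ⊗ₜ 1 := by
  simp [unshuffle]

theorem unshuffle_ι_mul {i : ZMod 2} {x : U} (hx : P x = sgn k i • x) (w : T) :
    unshuffle P (ιT x * w) =
      TensorProduct.map (mulι k U x) LinearMap.id (unshuffle P w) +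
      TensorProduct.map (parT P ^ i.val) (mulι k U x) (unshuffle P w) := by
  have h : unshuffle P (ιT x * w) = unshuffleStep P x (unshuffle P w) := by
    simp [unshuffle]
  have h2 : ∑ j : ZMod 2, TensorProduct.map (parT P ^ j.val) (mulι k U (homPart P j x)) =
      TensorProduct.map (parT P ^ i.val) (mulι k U x) := by
    rw [Finset.sum_eq_single i]
    · rw [homPart_of_hom hx, if_pos rfl]
    · intro j _ hj
      rw [homPart_of_hom hx, if_neg hj, map_zero, TensorProduct.map_zero_right]
    · simp
  rw [h, ← h2]
  rfl

end Tensor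

/-! ### Coalgebra identities, rescaling of letters, and graded symmetric maps -/

section Unshuffle

variable {k : Type*} [Field k] {U : Type*} [AddCommGroup U] [Module k U] {P : U →ₗ[k] U}
  {X : Type*} [AddCommGroup X] [Module k X]

local notation "T" => TensorAlgebra k U
local notation "ιT" => TensorAlgebra.ι k
local notation "εT" => TensorAlgebra.algebraMapInv (R := k) (M := U)

theorem algebraMapInv_parT_pow (n : ℕ) (w : T) : εT ((parT P ^ n) w) = εT w := by
  induction n with
  | zero => rfl
  | succ n ih => rw [pow_succ', Module.End.mul_apply, algebraMapInv_parT, ih]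

theorem parT_parT_pow (n : ℕ) (w : T) : parT P ((parT P ^ n) w) = (parT P ^ n) (parT P w) := by
  rw [← Module.End.mul_apply, ← Module.End.mul_apply, ← pow_succ, ← pow_succ']

variable [CharZero k]

/-- The letter `x` is absorbed into the functional `Ψ`. In inductions on words `Ψ` is therefore kept
general, and the induction hypothesis is applied to the two modified functionals. -/
theorem map_unshuffle_ι_mul (Ψ : T ⊗[k] T →ₗ[k] X) {i : ZMod 2} {x : U}
    (hx : P x = sgn k i • x) (w : T) :
    Ψ (unshuffle P (ιT x * w)) =
      (Ψ ∘ₗ TensorProduct.map (mulι k U x) LinearMap.id) (unshuffle P w) +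
      (Ψ ∘ₗ TensorProduct.map (parT P ^ i.val) (mulι k U x)) (unshuffle P w) := by
  rw [unshuffle_ι_mul hx, map_add]; rfl

/-- Graded cocommutativity of the unshuffle coproduct. -/
theorem unshuffle_comm (hP : ∀ x, P (P x) = x) {Ψ Ψ' : T ⊗[k] T →ₗ[k] X}
    (h : ∀ α β a b, parT P a = sgn k α • a → parT P b = sgn k β • b →
      Ψ (a ⊗ₜ b) = sgn k (α * β) • Ψ' (b ⊗ₜ a)) (w : T) :
    Ψ (unshuffle P w) = Ψ' (unshuffle P w) := by
  induction w using left_induction hP generalizing Ψ Ψ' with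
  | one => simpa [unshuffle_one] using h 0 0 1 1 parT_one_hom parT_one_hom
  | add a b ha hb => rw [map_add, map_add, map_add, ha h, hb h]
  | smul r a ha => rw [map_smul, map_smul, map_smul, ha h]
  | mul i x w hx hw =>
    rw [map_unshuffle_ι_mul _ hx, map_unshuffle_ι_mul _ hx, add_comm]
    congr 1
    · refine hw fun α β a b ha hb => ?_
      simp only [LinearMap.comp_apply, TensorProduct.map_tmul, mulι_apply, LinearMap.id_apply]
      rw [pow_val_of_hom ha, ← TensorProduct.smul_tmul', map_smul,
        h α (i + β) a _ ha (parT_mul_of_hom (parT_ι_of_hom hx) hb), sgn_smul_sgn_smul]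
      congr 2
      clear * -
      revert i α β; decide
    · refine hw fun α β a b ha hb => ?_
      simp only [LinearMap.comp_apply, TensorProduct.map_tmul, mulι_apply, LinearMap.id_apply]
      rw [pow_val_of_hom hb, ← TensorProduct.smul_tmul', map_smul,
        h (i + α) β _ b (parT_mul_of_hom (parT_ι_of_hom hx) ha) hb, sgn_smul_sgn_smul]
      congr 2
      clear * -
      revert i α β; decide

/-- Only the term `1 ⊗ w` of the coproduct has a left factor with nonzero augmentation. -/
theorem unshuffle_counit_left (hP : ∀ x, P (P x) = x) {Ψ : T ⊗[k] T →ₗ[k] X} {f : T →ₗ[k] X}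
    (h : ∀ a b, Ψ (a ⊗ₜ b) = εT a • f b) (w : T) : Ψ (unshuffle P w) = f w := by
  induction w using left_induction hP generalizing Ψ f with
  | one => simpa [unshuffle_one] using h 1 1
  | add a b ha hb => rw [map_add, map_add, map_add, ha h, hb h]
  | smul r a ha => rw [map_smul, map_smul, map_smul, ha h]
  | mul i x w hx hw =>
    rw [map_unshuffle_ι_mul _ hx, @hw _ 0 (by simp [h]), @hw _ (f ∘ₗ mulι k U x)]
    · simp
    · simp [h, algebraMapInv_parT_pow]

theorem unshuffle_counit_right (hP : ∀ x, P (P x) = x) {Ψ : T ⊗[k] T →ₗ[k] X} {f : T →ₗ[k] X}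
    (h : ∀ a b, Ψ (a ⊗ₜ b) = εT b • f a) (w : T) : Ψ (unshuffle P w) = f w := by
  induction w using left_induction hP generalizing Ψ f with
  | one => simpa [unshuffle_one] using h 1 1
  | add a b ha hb => rw [map_add, map_add, map_add, ha h, hb h]
  | smul r a ha => rw [map_smul, map_smul, map_smul, ha h]
  | mul i x w hx hw =>
    rw [map_unshuffle_ι_mul _ hx, @hw _ (f ∘ₗ mulι k U x) (by simp [h]), @hw _ 0]
    · simp
    · simp [h]

theorem unshuffle_parT (hP : ∀ x, P (P x) = x) (w : T) :
    unshuffle P (parT P w) = TensorProduct.map (parT P) (parT P) (unshuffle P w) := by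
  refine eq_of_left (f := unshuffle P ∘ₗ parT P)
    (g := TensorProduct.map (parT P) (parT P) ∘ₗ unshuffle P) hP ?_ ?_ w
  · simp [unshuffle_one]
  · intro i x w hx hw
    simp only [LinearMap.comp_apply] at hw ⊢
    have h : P (P x) = sgn k i • P x := by rw [hx, map_smul, hx]
    rw [parT_mul, parT_ι, unshuffle_ι_mul h, unshuffle_ι_mul hx, hw, map_add]
    congr 1
    · refine LinearMap.congr_fun (f := TensorProduct.map (mulι k U (P x)) LinearMap.id ∘ₗ
        TensorProduct.map (parT P) (parT P)) (g := TensorProduct.map (parT P) (parT P) ∘ₗ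
        TensorProduct.map (mulι k U x) LinearMap.id) (TensorProduct.ext' fun a b => ?_) _
      simp
    · refine LinearMap.congr_fun (f := TensorProduct.map (parT P ^ i.val) (mulι k U (P x)) ∘ₗ
        TensorProduct.map (parT P) (parT P)) (g := TensorProduct.map (parT P) (parT P) ∘ₗ
        TensorProduct.map (parT P ^ i.val) (mulι k U x)) (TensorProduct.ext' fun a b => ?_) _
      simp [parT_parT_pow]

theorem unshuffle_parT_pow (hP : ∀ x, P (P x) = x) (n : ℕ) (w : T) :
    unshuffle P ((parT P ^ n) w) =
      TensorProduct.map (parT P ^ n) (parT P ^ n) (unshuffle P w) := by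
  induction n with
  | zero => simp [Module.End.one_eq_id]
  | succ n ih =>
    rw [pow_succ', Module.End.mul_apply, unshuffle_parT hP, ih, ← LinearMap.comp_apply,
      ← TensorProduct.map_comp]
    rfl

/-- Rescaling of the letters by `t`. -/
noncomputable def scaleT (U : Type*) [AddCommGroup U] [Module k U] (t : k) :
    TensorAlgebra k U →ₗ[k] TensorAlgebra k U :=
  (TensorAlgebra.lift k (t • TensorAlgebra.ι k)).toLinearMap

@[simp] theorem scaleT_one (t : k) : scaleT U t 1 = 1 := by simp [scaleT]

@[simp] theorem scaleT_mul (t : k) (a b : T) :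
    scaleT U t (a * b) = scaleT U t a * scaleT U t b := by simp [scaleT]

@[simp] theorem scaleT_ι (t : k) (x : U) : scaleT U t (ιT x) = t • ιT x := by simp [scaleT]

theorem scaleT_one_left (w : T) : scaleT U (1 : k) w = w := by
  induction w using TensorAlgebra.induction with
  | algebraMap r => simp [Algebra.algebraMap_eq_smul_one]
  | ι x => simp
  | mul a b ha hb => simp [ha, hb]
  | add a b ha hb => simp [ha, hb]

theorem parT_scaleT (t : k) (w : T) : parT P (scaleT U t w) = scaleT U t (parT P w) := by
  induction w using TensorAlgebra.induction with
  | algebraMap r => simp [Algebra.algebraMap_eq_smul_one]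
  | ι x => simp
  | mul a b ha hb => simp [ha, hb]
  | add a b ha hb => simp [ha, hb]

theorem algebraMapInv_scaleT (t : k) (w : T) : εT (scaleT U t w) = εT w := by
  induction w using TensorAlgebra.induction with
  | algebraMap r => simp [Algebra.algebraMap_eq_smul_one]
  | ι x => simp
  | mul a b ha hb => simp [ha, hb]
  | add a b ha hb => simp [ha, hb]

theorem parT_pow_scaleT (t : k) (n : ℕ) (w : T) :
    (parT P ^ n) (scaleT U t w) = scaleT U t ((parT P ^ n) w) := by
  induction n with
  | zero => rfl
  | succ n ih => rw [pow_succ', Module.End.mul_apply, ih, parT_scaleT]; rfl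

theorem unshuffle_scaleT (hP : ∀ x, P (P x) = x) (t : k) (w : T) :
    unshuffle P (scaleT U t w) = TensorProduct.map (scaleT U t) (scaleT U t) (unshuffle P w) := by
  refine eq_of_left (f := unshuffle P ∘ₗ scaleT U t)
    (g := TensorProduct.map (scaleT U t) (scaleT U t) ∘ₗ unshuffle P) hP ?_ ?_ w
  · simp [unshuffle_one]
  · intro i x w hx hw
    simp only [LinearMap.comp_apply] at hw ⊢
    rw [scaleT_mul, scaleT_ι, smul_mul_assoc, map_smul, unshuffle_ι_mul hx, unshuffle_ι_mul hx, hw,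
      map_add, smul_add]
    congr 1
    · refine LinearMap.congr_fun (f := t • (TensorProduct.map (mulι k U x) LinearMap.id ∘ₗ
        TensorProduct.map (scaleT U t) (scaleT U t))) (g := TensorProduct.map (scaleT U t)
        (scaleT U t) ∘ₗ TensorProduct.map (mulι k U x) LinearMap.id)
        (TensorProduct.ext' fun a b => ?_) _
      simp [TensorProduct.smul_tmul']
    · refine LinearMap.congr_fun (f := t • (TensorProduct.map (parT P ^ i.val) (mulι k U x) ∘ₗ
        TensorProduct.map (scaleT U t) (scaleT U t))) (g := TensorProduct.map (scaleT U t)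
        (scaleT U t) ∘ₗ TensorProduct.map (parT P ^ i.val) (mulι k U x))
        (TensorProduct.ext' fun a b => ?_) _
      simp [parT_pow_scaleT]

theorem gradedSymm_swap {f : T →ₗ[k] X} (hf : f ∈ gradedSymm P X) {i j : ZMod 2} {x y : U}
    (hx : P x = sgn k i • x) (hy : P y = sgn k j • y) (a b : T) :
    f (a * (ιT x * (ιT y * b))) = sgn k (i * j) • f (a * (ιT y * (ιT x * b))) := by
  simpa only [mul_assoc] using hf i j x y a b hx hy

theorem gradedSymm_move (hP : ∀ x, P (P x) = x) {f : T →ₗ[k] X} (hf : f ∈ gradedSymm P X)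
    {i : ZMod 2} {x : U} (hx : P x = sgn k i • x) (w b : T) :
    f (w * (ιT x * b)) = f (ιT x * ((parT P ^ i.val) w * b)) := by
  -- The prefix `c` collects the letters of `w` that have already been peeled off.
  suffices ∀ c, f (c * (w * (ιT x * b))) = f (c * (ιT x * ((parT P ^ i.val) w * b))) by
    simpa using this 1
  induction w using left_induction hP with
  | one => simp
  | add v w hv hw => intro c; simp only [map_add, add_mul, mul_add, hv, hw]
  | smul r w hw => intro c; simp only [map_smul, smul_mul_assoc, mul_smul_comm, hw]
  | mul j y w hy hw =>
    intro c
    rw [parT_pow_mul, pow_val_of_hom (parT_ι_of_hom hy)]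
    simp only [smul_mul_assoc, mul_smul_comm, map_smul, mul_assoc]
    rw [← mul_assoc c, hw, mul_assoc, gradedSymm_swap hf hy hx, mul_comm j i]

end Unshuffle

/-! ### Higher derived brackets

`L` is a super Lie algebra containing an abelian subalgebra `U`, with a projection `pr : L → U` whose
kernel is a subalgebra, and `m` is an odd element of the kernel with `[m, m] = 0`. -/

section Derived

variable {k : Type*} [Field k] {U : Type*} [AddCommGroup U] [Module k U]
  {E : Type*} [AddCommGroup E] [Module k E]

/-- The iterated brackets `F(w₁, …, w_r) = [⋯[[m, w₁], w₂], ⋯, w_r]` of an odd Maurer–Cartan element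
`m` of the dgla `L` with the elements of an abelian subalgebra `U` complementary to a subalgebra
`ker pr` that contains `m`. -/
structure IsDerivedBracket (P : U →ₗ[k] U) (L : DGLieData k E) (j : U →ₗ[k] E) (pr : E →ₗ[k] U)
    (m : E) (F : TensorAlgebra k U →ₗ[k] E) : Prop where
  isDGLA : IsDGLA L
  involutive : ∀ x, P (P x) = x
  par_par : ∀ x, L.par (L.par x) = x
  j_mem : ∀ u, j u ∈ L.carrier
  par_j : ∀ u, L.par (j u) = j (P u)
  pr_j : ∀ u, pr (j u) = u
  br_j_j : ∀ u v, L.br (j u) (j v) = 0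
  pr_par : ∀ x, pr (L.par x) = P (pr x)
  pr_br : ∀ x ∈ L.carrier, ∀ y ∈ L.carrier, pr x = 0 → pr y = 0 → pr (L.br x y) = 0
  m_mem : m ∈ L.carrier
  par_m : L.par m = -m
  pr_m : pr m = 0
  br_m_m : L.br m m = 0
  d_eq : ∀ x, L.d x = L.br m x
  map_one : F 1 = m
  map_mul : ∀ w u, F (w * TensorAlgebra.ι k u) = L.br (F w) (j u)

/-- The sum of the `[(-1)^{|A w'|} A w', B w'']` over the terms `w' ⊗ w''` of the unshuffle
coproduct. -/
noncomputable def brConv (P : U →ₗ[k] U) (L : DGLieData k E) :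
    (TensorAlgebra k U →ₗ[k] E) →ₗ[k] (TensorAlgebra k U →ₗ[k] E) →ₗ[k] TensorAlgebra k U →ₗ[k] E :=
  LinearMap.mk₂ k (fun A B => TensorProduct.lift (L.br ∘ₗ L.par) ∘ₗ TensorProduct.map A B ∘ₗ
      unshuffle P)
    (fun A A' B => by rw [TensorProduct.map_add_left, LinearMap.add_comp, LinearMap.comp_add])
    (fun r A B => by rw [TensorProduct.map_smul_left, LinearMap.smul_comp, LinearMap.comp_smul])
    (fun A B B' => by rw [TensorProduct.map_add_right, LinearMap.add_comp, LinearMap.comp_add])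
    (fun r A B => by rw [TensorProduct.map_smul_right, LinearMap.smul_comp, LinearMap.comp_smul])

/-- The sum of the `f(G w' ⬝ H w'')` over the terms `w' ⊗ w''` of the unshuffle coproduct. -/
noncomputable def insertConv (P : U →ₗ[k] U) (G : TensorAlgebra k U →ₗ[k] U)
    (H : TensorAlgebra k U →ₗ[k] TensorAlgebra k U) : TensorAlgebra k U →ₗ[k] TensorAlgebra k U :=
  LinearMap.mul' k (TensorAlgebra k U) ∘ₗ
    TensorProduct.map (TensorAlgebra.ι k ∘ₗ G) H ∘ₗ unshuffle P

variable [CharZero k] {P : U →ₗ[k] U} {L : DGLieData k E} {j : U →ₗ[k] E} {pr : E →ₗ[k] U}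
  {m : E} {F : TensorAlgebra k U →ₗ[k] E}

local notation "T" => TensorAlgebra k U
local notation "ιT" => TensorAlgebra.ι k
local notation "εT" => TensorAlgebra.algebraMapInv (R := k) (M := U)

namespace IsDerivedBracket

variable (h : IsDerivedBracket P L j pr m F)

include h

theorem mem (w : T) : F w ∈ L.carrier := by
  induction w using right_induction h.involutive with
  | one => rw [h.map_one]; exact h.m_mem
  | add a b ha hb => rw [map_add]; exact add_mem ha hb
  | smul r a ha => rw [map_smul]; exact Submodule.smul_mem _ _ ha
  | mul i x w hx hw => rw [h.map_mul]; exact h.isDGLA.br_mem _ hw _ (h.j_mem x)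

theorem par_map (w : T) : L.par (F w) = -F (parT P w) := by
  refine eq_of_right (f := L.par ∘ₗ F) (g := -(F ∘ₗ parT P)) h.involutive ?_ ?_ w
  · simp [h.map_one, h.par_m]
  · intro i x w hx hw
    simp only [LinearMap.comp_apply, LinearMap.neg_apply] at hw ⊢
    rw [h.map_mul, h.isDGLA.par_br _ (h.mem w) _ (h.j_mem x), hw, parT_mul, parT_ι, h.map_mul,
      h.par_j, map_neg, LinearMap.neg_apply]

theorem isHom {b : ZMod 2} {w : T} (hw : parT P w = sgn k b • w) : L.IsHom (b + 1) (F w) := by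
  refine ⟨h.mem w, ?_⟩
  rw [h.par_map, hw, map_smul, sgn_add, sgn_one, mul_neg_one, neg_smul]

theorem isHom_j {i : ZMod 2} {x : U} (hx : P x = sgn k i • x) : L.IsHom i (j x) :=
  ⟨h.j_mem x, by rw [h.par_j, hx, map_smul]⟩

/-- By the Jacobi identity and skew-symmetry, bracketing with `j x` on the right is a graded
derivation of the bracket. -/
theorem br_br_j {l i : ZMod 2} {X : E} {x : U} {Y : E} {b : ZMod 2} (hX : L.IsHom l X)
    (hY : L.IsHom b Y) (hx : P x = sgn k i • x) :
    L.br (L.br X Y) (j x) = L.br X (L.br Y (j x)) + sgn k (i * b) • L.br (L.br X (j x)) Y := by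
  have h1 := h.isDGLA.jacobi _ _ _ _ _ _ hX hY (h.isHom_j hx)
  have hXx : L.IsHom (l + i) (L.br X (j x)) := by
    refine ⟨h.isDGLA.br_mem _ hX.1 _ (h.j_mem x), ?_⟩
    rw [h.isDGLA.par_br _ hX.1 _ (h.j_mem x), hX.2, h.par_j, hx, sgn_add]
    simp only [map_smul, LinearMap.smul_apply, smul_smul, mul_comm]
  have h2 := h.isDGLA.skew _ _ _ _ hY hXx
  rw [h1, h2, smul_neg, sgn_smul_sgn_smul, show l * b + b * (l + i) = i * b by
    clear * -; revert l b i; decide]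
  abel

/-- The derivation rule for `j y` applied to `[F a, j x]`, where `[j x, j y] = 0` because `U` is
abelian. -/
theorem swap {i i' : ZMod 2} {x y : U} (hx : P x = sgn k i • x) (hy : P y = sgn k i' • y) (a : T) :
    L.br (L.br (F a) (j x)) (j y) = sgn k (i * i') • L.br (L.br (F a) (j y)) (j x) := by
  refine eq_of_hom (f := L.br.flip (j y) ∘ₗ L.br.flip (j x) ∘ₗ F)
    (g := sgn k (i * i') • (L.br.flip (j x) ∘ₗ L.br.flip (j y) ∘ₗ F)) (parT_parT h.involutive)
    (fun b a ha => ?_) a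
  simp only [LinearMap.comp_apply, LinearMap.flip_apply, LinearMap.smul_apply]
  rw [h.br_br_j (h.isHom ha) (h.isHom_j hx) hy, h.br_j_j, map_zero, zero_add, mul_comm]

theorem symm : F ∈ gradedSymm P E := by
  intro i i' x y a b hx hy
  refine eq_of_right (f := F ∘ₗ LinearMap.mulLeft k (a * ιT x * ιT y))
    (g := sgn k (i * i') • (F ∘ₗ LinearMap.mulLeft k (a * ιT y * ιT x))) h.involutive ?_ ?_ b
  · simp only [LinearMap.comp_apply, LinearMap.mulLeft_apply, mul_one, LinearMap.smul_apply,
      h.map_mul]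
    exact h.swap hx hy a
  · intro l z w hz hw
    simp only [LinearMap.comp_apply, LinearMap.mulLeft_apply, LinearMap.smul_apply] at hw ⊢
    rw [← mul_assoc, h.map_mul, hw, ← mul_assoc, h.map_mul, map_smul, LinearMap.smul_apply]

/-- `F` is defined by appending letters on the right, while the coproduct is computed by adding
letters on the left; graded symmetry translates between the two. -/
theorem ι_mul {i : ZMod 2} {x : U} (hx : P x = sgn k i • x) (w : T) :
    F (ιT x * w) = L.br (F ((parT P ^ i.val) w)) (j x) := by
  rw [← h.map_mul]
  refine eq_of_hom (f := F ∘ₗ mulι k U x) (g := F ∘ₗ LinearMap.mulRight k (ιT x) ∘ₗ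
    (parT P ^ i.val)) (parT_parT h.involutive) (fun b w hw => ?_) w
  have := gradedSymm_move h.involutive h.symm hx w 1
  rw [pow_val_of_hom hw] at this
  simp only [mul_one, mul_smul_comm, map_smul] at this
  simp only [LinearMap.comp_apply, mulι_apply, LinearMap.mulRight_apply, pow_val_of_hom hw,
    map_smul, this, sgn_smul_self]

theorem ι_mul_of_hom {i b : ZMod 2} {x : U} {w : T} (hx : P x = sgn k i • x)
    (hw : parT P w = sgn k b • w) : F (ιT x * w) = sgn k (i * b) • L.br (F w) (j x) := by
  rw [h.ι_mul hx, pow_val_of_hom hw, map_smul, map_smul, LinearMap.smul_apply]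

omit h in
theorem _root_.InftyAlg.brConv_apply (A B : T →ₗ[k] E) (w : T) : brConv P L A B w =
    TensorProduct.lift (L.br ∘ₗ L.par) (TensorProduct.map A B (unshuffle P w)) := rfl

/-- Up to sign this is the result of applying the derivations `[-, j x]`, for the letters `x` of
`w`, to `[m, m] = 0`: by the Leibniz rule each letter goes into one of the two factors, which is
what the unshuffle coproduct records. -/
theorem brConv_self (w : T) : brConv P L F F w = 0 := by
  have h0 : brConv P L F F w = -TensorProduct.lift (L.br.compl₁₂ (F ∘ₗ parT P) F)
      (unshuffle P w) := by
    rw [brConv_apply]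
    refine LinearMap.congr_fun (f := TensorProduct.lift (L.br ∘ₗ L.par) ∘ₗ TensorProduct.map F F)
      (g := -TensorProduct.lift (L.br.compl₁₂ (F ∘ₗ parT P) F)) (TensorProduct.ext' fun a b => ?_) _
    simp [h.par_map]
  rw [h0, neg_eq_zero]
  set Ψ := TensorProduct.lift (L.br.compl₁₂ (F ∘ₗ parT P) F) with hΨ
  refine eq_of_left (f := Ψ ∘ₗ unshuffle P) (g := 0) h.involutive ?_ ?_ w
  · simp [hΨ, unshuffle_one, h.map_one, h.br_m_m]
  · intro i x w hx hw
    rw [LinearMap.comp_apply, map_unshuffle_ι_mul _ hx, ← LinearMap.add_apply]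
    -- The two places for the new letter are the two terms of the Leibniz rule `br_br_j`.
    have key : Ψ ∘ₗ TensorProduct.map (mulι k U x) LinearMap.id +
        Ψ ∘ₗ TensorProduct.map (parT P ^ i.val) (mulι k U x) =
        L.br.flip (j x) ∘ₗ (L.par ^ i.val) ∘ₗ Ψ := by
      refine tensor_eq_of_hom (parT_parT h.involutive) (parT_parT h.involutive)
        fun α β a b ha hb => ?_
      have hab : L.par (Ψ (a ⊗ₜ b)) = sgn k (α + β) • Ψ (a ⊗ₜ b) := by
        simp only [hΨ, TensorProduct.lift.tmul, LinearMap.compl₁₂_apply, LinearMap.comp_apply, ha,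
          map_smul, LinearMap.smul_apply]
        rw [h.isDGLA.par_br _ (h.mem a) _ (h.mem b), (h.isHom ha).2, (h.isHom hb).2]
        simp only [map_smul, LinearMap.smul_apply, sgn_smul_sgn_smul]
        congr 2
        clear * -; revert α β; decide
      simp only [LinearMap.add_apply, LinearMap.comp_apply, pow_val_of_hom hab]
      simp only [hΨ, TensorProduct.map_tmul, TensorProduct.lift.tmul, LinearMap.compl₁₂_apply,
        LinearMap.comp_apply, pow_val_of_hom ha, mulι_apply, LinearMap.id_apply, ha,
        parT_mul_of_hom (parT_ι_of_hom hx) ha, map_smul, LinearMap.smul_apply, h.ι_mul_of_hom hx ha,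
        h.ι_mul_of_hom hx hb, LinearMap.flip_apply, sgn_smul_sgn_smul,
        h.br_br_j (h.isHom ha) (h.isHom hb) hx, smul_add]
      rw [add_comm]
      congr 3 <;> (clear * -; revert i α β; decide)
    rw [key, LinearMap.comp_apply, LinearMap.comp_apply,
      show Ψ (unshuffle P w) = 0 from hw, map_zero, map_zero]
    rfl

theorem skew_j {i l : ZMod 2} {x : U} {X : E} (hx : P x = sgn k i • x) (hX : L.IsHom l X) :
    L.br (j x) X = sgn k (i * l + 1) • L.br X (j x) := by
  rw [h.isDGLA.skew _ _ _ _ (h.isHom_j hx) hX, neg_eq_sgn_smul k, sgn_smul_sgn_smul, add_comm]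

/-- Bracketing `F` with an element of `U` adds a letter, so each of the two convolutions is, up to
sign, `F` evaluated on words beginning with the letter `G w'`. Cocommutativity identifies the two
orders, whence the factor 2. It is used for the odd map `G = pr ∘ F`. -/
theorem brConv_cross {G : T →ₗ[k] U} {H : T →ₗ[k] T} (hG : ∀ a, P (G a) = -G (parT P a))
    (hH : ∀ a, parT P (H a) = H (parT P a)) (w : T) :
    brConv P L (j ∘ₗ G) (F ∘ₗ H) w + brConv P L (F ∘ₗ H) (j ∘ₗ G) w =
      -(2 : k) • F (insertConv P G H w) := by
  set Y : T ⊗[k] T →ₗ[k] E := -(F ∘ₗ LinearMap.mul' k T ∘ₗ TensorProduct.map (ιT ∘ₗ G) H) with hY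
  have hG' : ∀ {α a}, parT P a = sgn k α • a → P (G a) = sgn k (α + 1) • G a := by
    intro α a ha
    rw [hG, ha, map_smul, sgn_add, sgn_one, mul_neg_one, neg_smul]
  have hH' : ∀ {α a}, parT P a = sgn k α • a → parT P (H a) = sgn k α • H a := by
    intro α a ha
    rw [hH, ha, map_smul]
  have h1 : brConv P L (j ∘ₗ G) (F ∘ₗ H) w = Y (unshuffle P w) := by
    rw [brConv_apply, ← LinearMap.comp_apply]
    congr 1
    refine tensor_eq_of_hom (parT_parT h.involutive) (parT_parT h.involutive)
      fun α β a b ha hb => ?_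
    simp only [hY, LinearMap.comp_apply, TensorProduct.map_tmul, TensorProduct.lift.tmul,
      LinearMap.mul'_apply, h.par_j, hG' ha, map_smul, LinearMap.smul_apply,
      h.ι_mul_of_hom (hG' ha) (hH' hb), h.skew_j (hG' ha) (h.isHom (hH' hb)), neg_eq_sgn_smul k,
      sgn_smul_sgn_smul]
    congr 2
    clear * -; revert α β; decide
  have h2 : brConv P L (F ∘ₗ H) (j ∘ₗ G) w = Y (unshuffle P w) := by
    rw [brConv_apply, ← LinearMap.comp_apply]
    refine unshuffle_comm h.involutive (fun α β a b ha hb => ?_) w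
    simp only [hY, LinearMap.comp_apply, TensorProduct.map_tmul, TensorProduct.lift.tmul,
      LinearMap.mul'_apply, (h.isHom (hH' ha)).2, map_smul,
      LinearMap.smul_apply, h.ι_mul_of_hom (hG' hb) (hH' ha), neg_eq_sgn_smul k,
      sgn_smul_sgn_smul]
    congr 2
    clear * -; revert α β; decide
  rw [h1, h2, ← two_smul k, neg_smul, ← smul_neg]
  rfl

/-- The counterpart of `brConv_cross` for an even `G`. It is used for `G = ιInv`, which is the
`dz`-component of the homotopy; the parity operators come from moving `dz` past the other factor. -/
theorem brConv_cross_even {G : T →ₗ[k] U} {H : T →ₗ[k] T} (hG : ∀ a, P (G a) = G (parT P a))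
    (hH : ∀ a, parT P (H a) = H (parT P a)) (w : T) :
    brConv P L (F ∘ₗ H) (j ∘ₗ P ∘ₗ G) w - brConv P L (j ∘ₗ P ∘ₗ G) (L.par ∘ₗ F ∘ₗ H) w =
      (2 : k) • L.par (F (insertConv P G H w)) := by
  set Y : T ⊗[k] T →ₗ[k] E :=
    L.par ∘ₗ F ∘ₗ LinearMap.mul' k T ∘ₗ TensorProduct.map (ιT ∘ₗ G) H with hY
  have hG' : ∀ {α a}, parT P a = sgn k α • a → P (G a) = sgn k α • G a := by
    intro α a ha
    rw [hG, ha, map_smul]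
  have hH' : ∀ {α a}, parT P a = sgn k α • a → parT P (H a) = sgn k α • H a := by
    intro α a ha
    rw [hH, ha, map_smul]
  have h1 : brConv P L (j ∘ₗ P ∘ₗ G) (L.par ∘ₗ F ∘ₗ H) w = -Y (unshuffle P w) := by
    rw [brConv_apply, ← LinearMap.comp_apply, ← LinearMap.neg_apply]
    congr 1
    refine tensor_eq_of_hom (parT_parT h.involutive) (parT_parT h.involutive)
      fun α β a b ha hb => ?_
    have hab := parT_mul_of_hom (parT_ι_of_hom (hG' ha)) (hH' hb)
    simp only [hY, LinearMap.comp_apply, TensorProduct.map_tmul, TensorProduct.lift.tmul,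
      LinearMap.neg_apply, LinearMap.mul'_apply]
    rw [(h.isHom hab).2]
    simp only [h.par_j, hG' ha, map_smul, LinearMap.smul_apply,
      (h.isHom (hH' hb)).2, h.ι_mul_of_hom (hG' ha) (hH' hb),
      h.skew_j (hG' ha) (h.isHom (hH' hb)), neg_eq_sgn_smul k, sgn_smul_sgn_smul]
    congr 2
    clear * -; revert α β; decide
  have h2 : brConv P L (F ∘ₗ H) (j ∘ₗ P ∘ₗ G) w = Y (unshuffle P w) := by
    rw [brConv_apply, ← LinearMap.comp_apply]
    refine unshuffle_comm h.involutive (fun α β a b ha hb => ?_) w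
    have hab := parT_mul_of_hom (parT_ι_of_hom (hG' hb)) (hH' ha)
    simp only [hY, LinearMap.comp_apply, TensorProduct.map_tmul, TensorProduct.lift.tmul,
      LinearMap.mul'_apply]
    rw [(h.isHom hab).2]
    simp only [(h.isHom (hH' ha)).2, hG' hb, map_smul,
      LinearMap.smul_apply, h.ι_mul_of_hom (hG' hb) (hH' ha), sgn_smul_sgn_smul]
    congr 2
    clear * -; revert α β; decide
  rw [h1, h2, sub_neg_eq_add, ← two_smul k]
  rfl

theorem br_par_m {x : E} (hx : x ∈ L.carrier) : L.br (L.par x) m = -L.br m x := by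
  have hm : L.IsHom 1 m := ⟨h.m_mem, by rw [h.par_m]; simp⟩
  have hc : ∀ i, homPart L.par i x ∈ L.carrier := fun i =>
    Submodule.smul_mem _ _ (add_mem hx (Submodule.smul_mem _ _ (h.isDGLA.par_mem x hx)))
  have hi : ∀ i, L.br (L.par (homPart L.par i x)) m = -L.br m (homPart L.par i x) := by
    intro i
    have hh : L.IsHom i (homPart L.par i x) := ⟨hc i, apply_homPart h.par_par i x⟩
    rw [hh.2, map_smul, LinearMap.smul_apply, h.isDGLA.skew _ _ _ _ hh hm, mul_one, smul_neg,
      sgn_smul_self]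
  rw [← homPart_add L.par x, map_add, map_add, LinearMap.add_apply, hi, hi, map_add, neg_add]

/-- A factor concentrated on the empty word picks out one term of the coproduct, by the counit; the
sign is the parity of `m`. -/
theorem brConv_const_left (B : T →ₗ[k] E) (w : T) :
    brConv P L ((εT).toLinearMap.smulRight m) B w = -L.br m (B w) := by
  rw [brConv_apply, ← LinearMap.comp_apply]
  refine unshuffle_counit_left (f := -(L.br m ∘ₗ B)) h.involutive (fun a b => ?_) w
  simp [h.par_m]

theorem brConv_const_right {B : T →ₗ[k] E} (hB : ∀ w, B w ∈ L.carrier) (w : T) :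
    brConv P L B ((εT).toLinearMap.smulRight m) w = -L.br m (B w) := by
  rw [brConv_apply, ← LinearMap.comp_apply]
  refine unshuffle_counit_right (f := -(L.br m ∘ₗ B)) h.involutive (fun a b => ?_) w
  simp [h.br_par_m (hB a)]

theorem brConv_j_j (G G' : T →ₗ[k] U) (w : T) : brConv P L (j ∘ₗ G) (j ∘ₗ G') w = 0 := by
  rw [brConv_apply, ← LinearMap.comp_apply]
  refine LinearMap.congr_fun (g := 0) (TensorProduct.ext' fun a b => ?_) _
  simp [h.par_j, h.br_j_j]

theorem brConv_scaleT (t : k) (w : T) :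
    brConv P L (F ∘ₗ scaleT U t) (F ∘ₗ scaleT U t) w = 0 := by
  rw [← h.brConv_self (scaleT U t w), brConv_apply, brConv_apply, unshuffle_scaleT h.involutive,
    TensorProduct.map_comp]
  rfl

-- However long `w'` is, `G w'` is a single letter and accounts for exactly one factor `t`. This is
-- why the correction in `derivedMap` is `t pr F` and not `tʳ pr F`.
omit h in
theorem _root_.InftyAlg.scaleT_insertConv (G : T →ₗ[k] U) (t : k) (w : T) :
    scaleT U t (insertConv P G LinearMap.id w) = t • insertConv P G (scaleT U t) w := by
  simp only [insertConv, LinearMap.comp_apply]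
  refine LinearMap.congr_fun (f := scaleT U t ∘ₗ LinearMap.mul' k T ∘ₗ
    TensorProduct.map (ιT ∘ₗ G) LinearMap.id) (g := t • (LinearMap.mul' k T ∘ₗ
    TensorProduct.map (ιT ∘ₗ G) (scaleT U t))) (TensorProduct.ext' fun a b => ?_) _
  simp

omit h in
/-- The map `w ↦ tʳ F(w) - t pr F(w)` for `w ∈ U^{⊗ r}`, `r ≥ 1`. -/
noncomputable def _root_.InftyAlg.derivedMap (j : U →ₗ[k] E) (pr : E →ₗ[k] U) (m : E)
    (F : T →ₗ[k] E) (t : k) : T →ₗ[k] E :=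
  F ∘ₗ scaleT U t - (εT).toLinearMap.smulRight m - t • (j ∘ₗ pr ∘ₗ F)

theorem odd_pr (w : T) : P ((pr ∘ₗ F) w) = -(pr ∘ₗ F) (parT P w) := by
  rw [LinearMap.comp_apply, LinearMap.comp_apply, ← h.pr_par, h.par_map, map_neg]

/-- The bracket is expanded in the three summands of `derivedMap`. The self-bracket of the rescaled
`F` vanishes, as do the brackets inside `U` and `[m, m]`. The terms with the constant `m` cancel
`-[m, -]`. Only the mixed terms of `F` and `pr F` remain, and `brConv_cross` evaluates them. -/
theorem derivedMap_compat (t : k) (w : T) :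
    -L.br m (derivedMap j pr m F t w) +
      (2 : k)⁻¹ • brConv P L (derivedMap j pr m F t) (derivedMap j pr m F t) w =
    F (scaleT U t (extS P (pr ∘ₗ F) w)) := by
  have h1 := h.brConv_cross (G := pr ∘ₗ F) (H := scaleT U t) h.odd_pr (parT_scaleT t) w
  have h2 := h.brConv_const_left (F ∘ₗ scaleT U t) w
  have h3 := h.brConv_const_right (B := F ∘ₗ scaleT U t) (fun w => h.mem _) w
  have h4 := h.brConv_const_left (j ∘ₗ pr ∘ₗ F) w
  have h5 := h.brConv_const_right (B := j ∘ₗ pr ∘ₗ F) (fun w => h.j_mem _) w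
  have h6 := h.brConv_const_left ((εT).toLinearMap.smulRight m) w
  have h7 := h.brConv_j_j (pr ∘ₗ F) (pr ∘ₗ F) w
  have h8 := h.brConv_scaleT t w
  have h9 : extS P (pr ∘ₗ F) w = insertConv P (pr ∘ₗ F) LinearMap.id w := rfl
  have h10 : L.br m (((εT).toLinearMap.smulRight m) w) = 0 := by simp [h.br_m_m]
  rw [h10, neg_zero] at h6
  rw [h9, scaleT_insertConv, map_smul]
  have h1' : brConv P L (j ∘ₗ pr ∘ₗ F) (F ∘ₗ scaleT U t) w =
    -(2 : k) • F (insertConv P (pr ∘ₗ F) (scaleT U t) w) -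
      brConv P L (F ∘ₗ scaleT U t) (j ∘ₗ pr ∘ₗ F) w := eq_sub_of_add_eq h1
  simp only [derivedMap, map_sub, map_smul, LinearMap.sub_apply, LinearMap.smul_apply, h2, h3, h4,
    h5, h6, h7, h8, h10, h1']
  match_scalars <;> ring_nf

theorem derivedMap_mem (t : k) (w : T) : derivedMap j pr m F t w ∈ L.carrier :=
  sub_mem (sub_mem (h.mem _) (Submodule.smul_mem _ _ h.m_mem))
    (Submodule.smul_mem _ _ (h.j_mem _))

theorem par_derivedMap (t : k) (w : T) :
    L.par (derivedMap j pr m F t w) = -derivedMap j pr m F t (parT P w) := by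
  simp only [derivedMap, LinearMap.sub_apply, LinearMap.comp_apply, LinearMap.smul_apply,
    map_sub, map_smul, h.par_map, h.par_j, parT_scaleT, LinearMap.smulRight_apply,
    AlgHom.toLinearMap_apply, h.par_m, algebraMapInv_parT]
  have := h.odd_pr w
  simp only [LinearMap.comp_apply] at this
  rw [this]
  simp only [map_neg, smul_neg]
  abel

theorem pr_derivedMap (w : T) : pr (derivedMap j pr m F 1 w) = 0 := by
  simp [derivedMap, h.pr_m, h.pr_j, scaleT_one_left]

theorem derivedMap_symm (t : k) : derivedMap j pr m F t ∈ gradedSymm P E := by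
  intro i i' x y a b hx hy
  have h1 : ∀ a b, F (a * ιT x * ιT y * b) = sgn k (i * i') • F (a * ιT y * ιT x * b) :=
    fun a b => h.symm i i' x y a b hx hy
  have h2 : ∀ x y : U, εT (a * ιT x * ιT y * b) = 0 := by simp
  simp only [derivedMap, LinearMap.sub_apply, LinearMap.comp_apply, LinearMap.smul_apply, h1,
    scaleT_mul, scaleT_ι, smul_mul_assoc, mul_smul_comm, map_smul, LinearMap.smulRight_apply,
    AlgHom.toLinearMap_apply, h2, zero_smul, smul_sub]
  match_scalars <;> ring

theorem derivedMap_one (t : k) : derivedMap j pr m F t 1 = 0 := by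
  simp [derivedMap, h.map_one, h.pr_m]

omit h in
theorem _root_.InftyAlg.brConv_mem {S : Submodule k E} {A B : T →ₗ[k] E}
    (hS : ∀ a b, L.br (L.par (A a)) (B b) ∈ S) (w : T) : brConv P L A B w ∈ S := by
  rw [brConv_apply]
  induction unshuffle P w using TensorProduct.induction_on with
  | zero => simp
  | tmul a b => simpa using hS a b
  | add a b ha hb => rw [map_add, map_add]; exact add_mem ha hb

/-- At `t = 1` the left side of `derivedMap_compat` is made of brackets of elements of the
subalgebra `ker pr`, so `pr` annihilates it; applied to the right side this is the square-zero
equation for `pr ∘ F`. -/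
theorem isLInfty : IsLInfty P (pr ∘ₗ F) where
  odd := by
    ext w
    change P ((pr ∘ₗ F) (parT P w)) = _
    rw [h.odd_pr, parT_parT h.involutive]; rfl
  symm := by
    intro i i' x y a b hx hy
    rw [LinearMap.comp_apply, h.symm i i' x y a b hx hy, map_smul]; rfl
  const_eq_zero := by rw [LinearMap.comp_apply, h.map_one, h.pr_m]
  sq_zero := by
    ext1 w
    have h1 := congrArg pr (h.derivedMap_compat 1 w)
    rw [scaleT_one_left] at h1
    change pr (F (extS P (pr ∘ₗ F) w)) = 0
    rw [← h1, map_add, map_neg, map_smul, h.pr_br _ h.m_mem _ (h.derivedMap_mem 1 w) h.pr_m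
      (h.pr_derivedMap w)]
    have : brConv P L (derivedMap j pr m F 1) (derivedMap j pr m F 1) w ∈ LinearMap.ker pr := by
      refine brConv_mem (fun a b => ?_) w
      refine h.pr_br _ (h.isDGLA.par_mem _ (h.derivedMap_mem 1 a)) _ (h.derivedMap_mem 1 b) ?_
        (h.pr_derivedMap b)
      rw [h.pr_par, h.pr_derivedMap, map_zero]
    rw [LinearMap.mem_ker.1 this]; simp

theorem pr_extS (w : T) : pr (F (extS P (pr ∘ₗ F) w)) = 0 :=
  LinearMap.congr_fun h.isLInfty.sq_zero w

omit h in
theorem _root_.InftyAlg.algebraMapInv_insertConv (G : T →ₗ[k] U) (H : T →ₗ[k] T) (w : T) :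
    εT (insertConv P G H w) = 0 := by
  simp only [insertConv, LinearMap.comp_apply]
  refine LinearMap.congr_fun (f := (εT).toLinearMap ∘ₗ LinearMap.mul' k T ∘ₗ
    TensorProduct.map (ιT ∘ₗ G) H) (g := 0) (TensorProduct.ext' fun a b => ?_) _
  simp

/-- The correction terms vanish on the image of the coderivation: one by the square-zero equation,
the other because that image has no empty word. -/
theorem derivedMap_extS (t : k) (w : T) : derivedMap j pr m F t (extS P (pr ∘ₗ F) w) =
    F (scaleT U t (extS P (pr ∘ₗ F) w)) := by
  have h1 : εT (extS P (pr ∘ₗ F) w) = 0 := algebraMapInv_insertConv (P := P) (pr ∘ₗ F) _ w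
  simp [derivedMap, h.pr_extS, h1]

theorem isLInftyMap :
    IsLInftyMap P (pr ∘ₗ F) (L.restrict (LinearMap.ker pr)) (derivedMap j pr m F 1) where
  mem w := ⟨h.derivedMap_mem 1 w, h.pr_derivedMap w⟩
  even w := h.par_derivedMap 1 w
  symm := h.derivedMap_symm 1
  const_eq_zero := h.derivedMap_one 1
  compat w := by
    rw [h.derivedMap_extS, ← h.derivedMap_compat]
    simp only [DGLieData.restrict, h.d_eq, brConv_apply]

end IsDerivedBracket

end Derived

/-! ### Evaluation and integration in `E ⊗ k[z]` -/

section Eval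

variable {k : Type*} [Field k] {E : Type*} [AddCommGroup E] [Module k E]

/-- The evaluation `E ⊗ k[z] → E` at `z = t`. -/
noncomputable def evalT (E : Type*) [AddCommGroup E] [Module k E] (t : k) : E ⊗[k] k[X] →ₗ[k] E :=
  (TensorProduct.rid k E).toLinearMap ∘ₗ TensorProduct.map LinearMap.id (Polynomial.leval t)

@[simp] theorem evalT_tmul (t : k) (x : E) (p : k[X]) : evalT E t (x ⊗ₜ p) = p.eval t • x := by
  simp [evalT, Polynomial.leval]

theorem evalT_map {E' : Type*} [AddCommGroup E'] [Module k E'] (A : E →ₗ[k] E') (t : k)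
    (p : E ⊗[k] k[X]) :
    evalT E' t (TensorProduct.map A LinearMap.id p) = A (evalT E t p) := by
  induction p using TensorProduct.induction_on with
  | zero => simp
  | tmul x p => simp
  | add p q hp hq => simp only [map_add, hp, hq]

theorem evalT_map₂ (B : E →ₗ[k] E →ₗ[k] E) (t : k) (p q : E ⊗[k] k[X]) :
    evalT E t (TensorProduct.map₂ B (LinearMap.mul k k[X]) p q) =
      B (evalT E t p) (evalT E t q) := by
  induction p using TensorProduct.induction_on with
  | zero => simp
  | tmul x p =>
    induction q using TensorProduct.induction_on with
    | zero => simp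
    | tmul y q => simp [smul_smul, mul_comm]
    | add p q hp hq => simp only [map_add, hp, hq]
  | add p q hp hq => simp only [map_add, LinearMap.add_apply, hp, hq]

/-- The antiderivative of a polynomial that vanishes at `0`. -/
noncomputable def antideriv (k : Type*) [Field k] : k[X] →ₗ[k] k[X] :=
  Polynomial.lsum fun n => ((n : k) + 1)⁻¹ • Polynomial.monomial (n + 1)

theorem antideriv_monomial (n : ℕ) (a : k) : antideriv k (Polynomial.monomial n a) =
    Polynomial.monomial (n + 1) (((n : k) + 1)⁻¹ * a) := by
  simp [antideriv, Polynomial.lsum_apply, Polynomial.sum_monomial_index, Polynomial.smul_monomial]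

variable [CharZero k]

/-- In a basis of `E` the coordinates are polynomials, and a polynomial over an infinite field is
determined by its values. Identities in `L[z,dz]` can thus be checked at each `z = t`, where they
concern `L` alone. -/
theorem evalT_ext {p q : E ⊗[k] k[X]} (h : ∀ t, evalT E t p = evalT E t q) : p = q := by
  let b := Module.Free.chooseBasis k E
  have key : ∀ (i) (r : E ⊗[k] k[X]) (t : k),
      (TensorProduct.equivFinsuppOfBasisLeft b r i).eval t = b.repr (evalT E t r) i := by
    intro i r t
    induction r using TensorProduct.induction_on with
    | zero => simp
    | tmul x p => simp [mul_comm]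
    | add p q hp hq => simp only [map_add, Finsupp.add_apply, Polynomial.eval_add, hp, hq]
  refine (TensorProduct.equivFinsuppOfBasisLeft b).injective (Finsupp.ext fun i => ?_)
  exact Polynomial.funext fun t => by rw [key, key, h]

theorem derivative_antideriv : Polynomial.derivative ∘ₗ antideriv k = LinearMap.id := by
  refine Polynomial.lhom_ext' fun n => LinearMap.ext_ring ?_
  have : (n : k) + 1 ≠ 0 := Nat.cast_add_one_ne_zero n
  simp [antideriv_monomial, this]

theorem eval_zero_antideriv (p : k[X]) : (antideriv k p).eval 0 = 0 := by
  refine LinearMap.congr_fun (f := Polynomial.leval 0 ∘ₗ antideriv k) (g := 0) ?_ p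
  refine Polynomial.lhom_ext' fun n => LinearMap.ext_ring ?_
  simp [antideriv_monomial, Polynomial.leval]

theorem antideriv_derivative (p : k[X]) :
    antideriv k (Polynomial.derivative p) = p - Polynomial.C (p.eval 0) := by
  refine LinearMap.congr_fun (f := antideriv k ∘ₗ Polynomial.derivative)
    (g := LinearMap.id - Polynomial.monomial 0 ∘ₗ Polynomial.leval 0) ?_ p
  refine Polynomial.lhom_ext' fun n => LinearMap.ext_ring ?_
  cases n with
  | zero => simp [Polynomial.leval]
  | succ n =>
    have : (n : k) + 1 ≠ 0 := Nat.cast_add_one_ne_zero n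
    simp [antideriv_monomial, Polynomial.leval]
    rw [← map_add]
    congr 1
    field_simp

/-- The fundamental theorem of calculus, with coefficients in `E`. -/
theorem map_antideriv_derivative (p : E ⊗[k] k[X]) :
    TensorProduct.map LinearMap.id (antideriv k)
      (TensorProduct.map LinearMap.id Polynomial.derivative p) = p - evalT E 0 p ⊗ₜ 1 := by
  induction p using TensorProduct.induction_on with
  | zero => simp
  | tmul x p =>
    simp [antideriv_derivative, TensorProduct.tmul_sub, TensorProduct.smul_tmul,
      Polynomial.smul_eq_C_mul]
  | add p q hp hq => simp only [map_add, hp, hq, TensorProduct.add_tmul]; abel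

theorem evalT_zero_map_antideriv (A : E →ₗ[k] E) (p : E ⊗[k] k[X]) :
    evalT E 0 (TensorProduct.map A (antideriv k) p) = 0 := by
  induction p using TensorProduct.induction_on with
  | zero => simp
  | tmul x p => simp [eval_zero_antideriv]
  | add p q hp hq => simp only [map_add, hp, hq, add_zero]

/-! ### Polynomials with coefficients in a subspace -/

variable {S : Submodule k E}

/-- The elements of `E ⊗ k[z]` with coefficients in `S`. -/
noncomputable abbrev polyCarrier (S : Submodule k E) : Submodule k (E ⊗[k] k[X]) :=
  LinearMap.range (TensorProduct.map S.subtype (LinearMap.id : k[X] →ₗ[k] k[X]))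

theorem tmul_mem_polyCarrier {x : E} (hx : x ∈ S) (p : k[X]) : x ⊗ₜ p ∈ polyCarrier S :=
  ⟨⟨x, hx⟩ ⊗ₜ p, by simp⟩

theorem map_mem_polyCarrier {E' : Type*} [AddCommGroup E'] [Module k E'] {A : E' →ₗ[k] E}
    (hA : ∀ x, A x ∈ S) (f : k[X] →ₗ[k] k[X]) (q : E' ⊗[k] k[X]) :
    TensorProduct.map A f q ∈ polyCarrier S := by
  induction q using TensorProduct.induction_on with
  | zero => simp
  | tmul x p => exact tmul_mem_polyCarrier (hA x) _
  | add p q hp hq => rw [map_add]; exact add_mem hp hq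

theorem map_mem_polyCarrier_of_mem {A : E →ₗ[k] E} (hA : ∀ x ∈ S, A x ∈ S)
    (f : k[X] →ₗ[k] k[X]) {q : E ⊗[k] k[X]} (hq : q ∈ polyCarrier S) :
    TensorProduct.map A f q ∈ polyCarrier S := by
  obtain ⟨q, rfl⟩ := hq
  rw [← LinearMap.comp_apply, ← TensorProduct.map_comp]
  exact map_mem_polyCarrier (E' := S) (fun x => hA _ x.2) _ q

/-- The dgla axioms are only assumed on the carrier, so an identity of operators may be applied
coefficientwise only to polynomials with coefficients there. -/
theorem map_congr_of_mem {E' : Type*} [AddCommGroup E'] [Module k E'] {A B : E →ₗ[k] E'}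
    (hA : ∀ x ∈ S, A x = B x) (f : k[X] →ₗ[k] k[X]) {q : E ⊗[k] k[X]} (hq : q ∈ polyCarrier S) :
    TensorProduct.map A f q = TensorProduct.map B f q := by
  obtain ⟨q, rfl⟩ := hq
  rw [← LinearMap.comp_apply, ← TensorProduct.map_comp, ← LinearMap.comp_apply (TensorProduct.map B f),
    ← TensorProduct.map_comp]
  congr 2
  ext x
  exact hA _ x.2

theorem evalT_mem {q : E ⊗[k] k[X]} (hq : q ∈ polyCarrier S) (t : k) : evalT E t q ∈ S := by
  obtain ⟨q, rfl⟩ := hq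
  rw [evalT_map]
  exact (evalT S t q).2

theorem map_map_poly {E' E'' : Type*} [AddCommGroup E'] [Module k E'] [AddCommGroup E'']
    [Module k E''] (A : E' →ₗ[k] E'') (B : E →ₗ[k] E') (f g : k[X] →ₗ[k] k[X])
    (q : E ⊗[k] k[X]) : TensorProduct.map A f (TensorProduct.map B g q) =
      TensorProduct.map (A ∘ₗ B) (f ∘ₗ g) q := by
  rw [TensorProduct.map_comp]; rfl

end Eval

/-! ### The scaling map and its derivative -/

section Scale

variable {k : Type*} [Field k] {U : Type*} [AddCommGroup U] [Module k U] {P : U →ₗ[k] U}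
  {E : Type*} [AddCommGroup E] [Module k E]

local notation "T" => TensorAlgebra k U
local notation "ιT" => TensorAlgebra.ι k
local notation "εT" => TensorAlgebra.algebraMapInv (R := k) (M := U)

@[simp] theorem scaleZ_one : scaleZ k U 1 = 1 ⊗ₜ 1 := by
  simp [scaleZ, Algebra.TensorProduct.one_def]

theorem scaleZ_ι_mul (x : U) (w : T) :
    scaleZ k U (ιT x * w) = TensorProduct.map (mulι k U x) (LinearMap.mulLeft k Polynomial.X)
      (scaleZ k U w) := by
  have : scaleZ k U (ιT x * w) = (ιT x ⊗ₜ Polynomial.X) * scaleZ k U w := by simp [scaleZ]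
  rw [this]
  induction scaleZ k U w using TensorProduct.induction_on with
  | zero => simp
  | tmul x p => simp
  | add p q hp hq => simp only [mul_add, map_add, hp, hq]

/-- The derivative at `z = t` of `w ↦ w zʳ`, `w ∈ U^{⊗ r}`. -/
noncomputable def derivScaleT (U : Type*) [AddCommGroup U] [Module k U] (t : k) :
    TensorAlgebra k U →ₗ[k] TensorAlgebra k U :=
  evalT _ t ∘ₗ TensorProduct.map LinearMap.id Polynomial.derivative ∘ₗ scaleZ k U

@[simp] theorem derivScaleT_one (t : k) : derivScaleT U t 1 = 0 := by
  simp [derivScaleT]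

variable [CharZero k]

theorem evalT_scaleZ (hP : ∀ x, P (P x) = x) (t : k) (w : T) :
    evalT _ t (scaleZ k U w) = scaleT U t w := by
  refine eq_of_left (f := evalT _ t ∘ₗ scaleZ k U) (g := scaleT U t) hP (by simp)
    (fun i x w hx hw => ?_) w
  simp only [LinearMap.comp_apply] at hw ⊢
  rw [scaleZ_ι_mul, scaleT_mul, scaleT_ι, ← hw]
  induction scaleZ k U w using TensorProduct.induction_on with
  | zero => simp
  | tmul x p => simp [smul_smul, mul_comm]
  | add p q hp hq => simp only [mul_add, map_add, hp, hq]

theorem derivScaleT_ι_mul (hP : ∀ x, P (P x) = x) (t : k) (x : U) (w : T) :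
    derivScaleT U t (ιT x * w) = ιT x * scaleT U t w + t • (ιT x * derivScaleT U t w) := by
  rw [← evalT_scaleZ hP]
  simp only [derivScaleT, LinearMap.comp_apply, scaleZ_ι_mul]
  induction scaleZ k U w using TensorProduct.induction_on with
  | zero => simp
  | tmul x p => simp [smul_smul, add_smul]
  | add p q hp hq => simp only [mul_add, map_add, hp, hq, smul_add]; abel

theorem algebraMapInv_derivScaleT (hP : ∀ x, P (P x) = x) (t : k) (w : T) :
    εT (derivScaleT U t w) = 0 := by
  refine eq_of_left (f := (εT).toLinearMap ∘ₗ derivScaleT U t) (g := 0) hP (by simp)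
    (fun i x w hx hw => ?_) w
  simp [derivScaleT_ι_mul hP]

theorem ιInv_mul (a b : T) : TensorAlgebra.ιInv (a * b) =
    εT a • TensorAlgebra.ιInv b + εT b • TensorAlgebra.ιInv a := by
  let _ : Module kᵐᵒᵖ U := Module.compHom _ ((RingHom.id k).fromOpposite mul_comm)
  have _ : IsCentralScalar k U := ⟨fun r m => rfl⟩
  have h : (TrivSqZeroExt.fstHom k k U).comp TensorAlgebra.toTrivSqZeroExt =
      TensorAlgebra.algebraMapInv (R := k) (M := U) := by
    ext x; simp
  have h2 : ∀ w, TrivSqZeroExt.fst (TensorAlgebra.toTrivSqZeroExt w) = εT w := DFunLike.congr_fun h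
  change TrivSqZeroExt.snd (TensorAlgebra.toTrivSqZeroExt (a * b)) = _
  rw [map_mul, TrivSqZeroExt.snd_mul, h2, h2]
  rfl

theorem ιInv_parT (w : T) : TensorAlgebra.ιInv (parT P w) = P (TensorAlgebra.ιInv w) := by
  induction w using TensorAlgebra.induction with
  | algebraMap r => simp [Algebra.algebraMap_eq_smul_one]
  | ι x => simp
  | mul a b ha hb => simp [ιInv_mul, ha, hb, algebraMapInv_parT]
  | add a b ha hb => simp [ha, hb]

theorem gradedSymm_comp_mulι {f : T →ₗ[k] E} (hf : f ∈ gradedSymm P E) (u : U) :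
    f ∘ₗ mulι k U u ∈ gradedSymm P E := by
  intro i i' x y a b hx hy
  simpa only [LinearMap.comp_apply, mulι_apply, mul_assoc] using
    hf i i' x y (ιT u * a) b hx hy

/-- Removing the letters of a word one by one and putting them in front. -/
theorem map_insertConv_ιInv (hP : ∀ x, P (P x) = x) {f : T →ₗ[k] E} (hf : f ∈ gradedSymm P E)
    (t : k) (w : T) :
    f (insertConv P TensorAlgebra.ιInv (scaleT U t) w) = f (derivScaleT U t w) := by
  induction w using left_induction hP generalizing f with
  | one => simp [insertConv, unshuffle_one]
  | add a b ha hb => simp only [map_add, ha hf, hb hf]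
  | smul r a ha => simp only [map_smul, ha hf]
  | mul i x w hx hw =>
    set Ψ := f ∘ₗ LinearMap.mul' k T ∘ₗ
      TensorProduct.map (ιT ∘ₗ TensorAlgebra.ιInv) (scaleT U t) with hΨ
    have h0 : ∀ w, f (insertConv P TensorAlgebra.ιInv (scaleT U t) w) = Ψ (unshuffle P w) :=
      fun w => rfl
    -- Either `x` itself is the letter removed, which leaves the rescaled `w`, or a letter of `w` is
    -- removed and `x` is moved back to the front by symmetry. These are the two terms of the
    -- product rule `derivScaleT_ι_mul`.
    rw [h0, map_unshuffle_ι_mul _ hx,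
      unshuffle_counit_left (f := f ∘ₗ mulι k U x ∘ₗ scaleT U t) hP, derivScaleT_ι_mul hP, map_add,
      map_smul]
    · congr 1
      have h1 := hw (gradedSymm_comp_mulι hf x)
      simp only [LinearMap.comp_apply, mulι_apply] at h1
      rw [← h1]
      refine LinearMap.congr_fun (g := t • (f ∘ₗ mulι k U x ∘ₗ LinearMap.mul' k T ∘ₗ
        TensorProduct.map (ιT ∘ₗ TensorAlgebra.ιInv) (scaleT U t))) ?_ (unshuffle P w)
      refine tensor_eq_of_hom (parT_parT hP) (parT_parT hP) fun α β a b ha hb => ?_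
      have ha' : P (TensorAlgebra.ιInv a) = sgn k α • TensorAlgebra.ιInv a := by
        rw [← ιInv_parT, ha, map_smul]
      have h2 := gradedSymm_swap hf ha' hx 1 (scaleT U t b)
      rw [one_mul, one_mul] at h2
      simp only [hΨ, LinearMap.comp_apply, TensorProduct.map_tmul, LinearMap.mul'_apply,
        mulι_apply, scaleT_mul, scaleT_ι, pow_val_of_hom ha, map_smul, smul_mul_assoc,
        mul_smul_comm, LinearMap.smul_apply, h2]
      rw [sgn_smul_sgn_smul, show i * α + α * i = 0 by
        clear * -; revert i α; decide, sgn_zero, one_smul]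
    · intro a b
      simp [hΨ, ιInv_mul]

end Scale

/-! ### The null homotopy of a derived bracket -/

section NullHomotopy

variable {k : Type*} [Field k] {U : Type*} [AddCommGroup U] [Module k U]
  {E : Type*} [AddCommGroup E] [Module k E]

local notation "T" => TensorAlgebra k U
local notation "ιT" => TensorAlgebra.ι k
local notation "εT" => TensorAlgebra.algebraMapInv (R := k) (M := U)

theorem poly_br_apply (L : DGLieData k E) (x y : (E ⊗[k] k[X]) × (E ⊗[k] k[X])) :
    L.poly.br x y =
      (TensorProduct.map₂ L.br (LinearMap.mul k k[X]) x.1 y.1,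
        TensorProduct.map₂ L.br (LinearMap.mul k k[X]) x.1 y.2 +
        TensorProduct.map₂ L.br (LinearMap.mul k k[X]) x.2
          (TensorProduct.map L.par LinearMap.id y.1)) := by
  simp [DGLieData.poly]

theorem poly_d_apply (L : DGLieData k E) (x : (E ⊗[k] k[X]) × (E ⊗[k] k[X])) :
    L.poly.d x = (TensorProduct.map L.d LinearMap.id x.1,
      TensorProduct.map L.par Polynomial.derivative x.1 +
        TensorProduct.map L.d LinearMap.id x.2) := rfl

theorem poly_par_apply (L : DGLieData k E) (x : (E ⊗[k] k[X]) × (E ⊗[k] k[X])) :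
    L.poly.par x = (TensorProduct.map L.par LinearMap.id x.1,
      -TensorProduct.map L.par LinearMap.id x.2) := rfl

/-- The homotopy between `0` and `derivedMap`. -/
noncomputable def derivedHomotopy (P : U →ₗ[k] U) (j : U →ₗ[k] E) (pr : E →ₗ[k] U) (m : E)
    (F : TensorAlgebra k U →ₗ[k] E) :
    TensorAlgebra k U →ₗ[k] (E ⊗[k] k[X]) × (E ⊗[k] k[X]) :=
  LinearMap.prod
    (TensorProduct.map (derivedMap j pr m F 1 + j ∘ₗ pr ∘ₗ F) LinearMap.id ∘ₗ scaleZ k U -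
      (TensorProduct.mk k _ _).flip Polynomial.X ∘ₗ j ∘ₗ pr ∘ₗ F)
    ((TensorProduct.mk k _ _).flip 1 ∘ₗ j ∘ₗ P ∘ₗ TensorAlgebra.ιInv)

variable [CharZero k] {P : U →ₗ[k] U} {L : DGLieData k E} {j : U →ₗ[k] E} {pr : E →ₗ[k] U}
  {m : E} {F : TensorAlgebra k U →ₗ[k] E}

theorem derivedMap_add (j : U →ₗ[k] E) (pr : E →ₗ[k] U) (m : E) (F : TensorAlgebra k U →ₗ[k] E) :
    derivedMap j pr m F 1 + j ∘ₗ pr ∘ₗ F = F - (εT).toLinearMap.smulRight m := by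
  ext1 w
  simp [derivedMap, scaleT_one_left]

theorem lift_map_poly (L : DGLieData k E) (s : T →ₗ[k] (E ⊗[k] k[X]) × (E ⊗[k] k[X])) (t : k)
    (w : T) :
    evalT E t (TensorProduct.lift (L.poly.br ∘ₗ L.poly.par)
      (TensorProduct.map s s (unshuffle P w))).1 =
      brConv P L (evalT E t ∘ₗ LinearMap.fst k _ _ ∘ₗ s) (evalT E t ∘ₗ LinearMap.fst k _ _ ∘ₗ s) w ∧
    evalT E t (TensorProduct.lift (L.poly.br ∘ₗ L.poly.par)
      (TensorProduct.map s s (unshuffle P w))).2 =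
      brConv P L (evalT E t ∘ₗ LinearMap.fst k _ _ ∘ₗ s) (evalT E t ∘ₗ LinearMap.snd k _ _ ∘ₗ s) w -
      brConv P L (evalT E t ∘ₗ LinearMap.snd k _ _ ∘ₗ s)
        (L.par ∘ₗ evalT E t ∘ₗ LinearMap.fst k _ _ ∘ₗ s) w := by
  simp only [brConv_apply]
  induction unshuffle P w using TensorProduct.induction_on with
  | zero => simp
  | tmul a b =>
    simp only [TensorProduct.map_tmul, TensorProduct.lift.tmul, LinearMap.comp_apply,
      poly_br_apply, poly_par_apply, map_neg, LinearMap.neg_apply, evalT_map₂, evalT_map, map_add,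
      LinearMap.fst_apply, LinearMap.snd_apply, sub_eq_add_neg, and_self]
  | add a b ha hb =>
    simp only [map_add, Prod.fst_add, Prod.snd_add, ha.1, ha.2, hb.1, hb.2, true_and]
    abel

namespace IsDerivedBracket

variable (h : IsDerivedBracket P L j pr m F)

include h

theorem evalT_fst_derivedHomotopy (t : k) :
    evalT E t ∘ₗ LinearMap.fst k _ _ ∘ₗ derivedHomotopy P j pr m F = derivedMap j pr m F t := by
  ext1 w
  simp [derivedHomotopy, evalT_map, evalT_scaleZ h.involutive, derivedMap, algebraMapInv_scaleT,
    scaleT_one_left]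

theorem evalT_snd_derivedHomotopy (t : k) :
    evalT E t ∘ₗ LinearMap.snd k _ _ ∘ₗ derivedHomotopy P j pr m F =
      j ∘ₗ P ∘ₗ TensorAlgebra.ιInv := by
  ext1 w
  simp [derivedHomotopy]

theorem derivedHomotopy_mem (w : T) : derivedHomotopy P j pr m F w ∈ L.poly.carrier := by
  refine ⟨sub_mem (map_mem_polyCarrier (fun x => ?_) _ _) (tmul_mem_polyCarrier (h.j_mem _) _),
    tmul_mem_polyCarrier (h.j_mem _) _⟩
  rw [derivedMap_add]
  exact sub_mem (h.mem _) (Submodule.smul_mem _ _ h.m_mem)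

theorem par_derivedMap_eq (t : k) : L.par ∘ₗ derivedMap j pr m F t =
    L.par ∘ₗ F ∘ₗ scaleT U t + (εT).toLinearMap.smulRight m - t • (j ∘ₗ P ∘ₗ pr ∘ₗ F) := by
  ext1 w
  simp [derivedMap, h.par_m, h.par_j]

/-- The quadratic part of the `dz`-component. The summand `F` contributes the derivative in `t` by
`brConv_cross_even` and `map_insertConv_ιInv`, the constant `m` contributes `[m, -]`, and the
summand in `U` commutes with the other factor. -/
theorem derivedHomotopy_compat_snd (t : k) (w : T) :
    (2 : k)⁻¹ • (brConv P L (derivedMap j pr m F t) (j ∘ₗ P ∘ₗ TensorAlgebra.ιInv) w -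
      brConv P L (j ∘ₗ P ∘ₗ TensorAlgebra.ιInv) (L.par ∘ₗ derivedMap j pr m F t) w) =
    L.par (F (derivScaleT U t w)) + L.br m (j (P (TensorAlgebra.ιInv w))) := by
  have h1 := h.brConv_cross_even (G := TensorAlgebra.ιInv) (H := scaleT U t)
    (fun a => (ιInv_parT a).symm) (parT_scaleT t) w
  rw [map_insertConv_ιInv h.involutive h.symm] at h1
  have h2 := h.brConv_const_left (j ∘ₗ P ∘ₗ TensorAlgebra.ιInv) w
  have h3 := h.brConv_const_right (B := j ∘ₗ P ∘ₗ TensorAlgebra.ιInv) (fun w => h.j_mem _) w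
  have h4 := h.brConv_j_j (pr ∘ₗ F) (P ∘ₗ TensorAlgebra.ιInv) w
  have h5 := h.brConv_j_j (P ∘ₗ TensorAlgebra.ιInv) (P ∘ₗ pr ∘ₗ F) w
  rw [h.par_derivedMap_eq]
  have h1' := eq_add_of_sub_eq h1
  simp only [LinearMap.comp_apply] at h2 h3
  simp only [derivedMap, map_sub, map_add, map_smul, LinearMap.sub_apply, LinearMap.add_apply,
    LinearMap.smul_apply, h2, h3, h4, h5, h1']
  match_scalars <;> ring_nf

theorem evalT_deriv_derivedHomotopy (t : k) (w : T) :
    evalT E t (TensorProduct.map L.par Polynomial.derivative (derivedHomotopy P j pr m F w).1) =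
      L.par (F (derivScaleT U t w) - j (pr (F w))) := by
  have h1 : (derivedHomotopy P j pr m F w).1 =
      TensorProduct.map (F - (εT).toLinearMap.smulRight m) LinearMap.id (scaleZ k U w) -
        j (pr (F w)) ⊗ₜ Polynomial.X := by
    rw [← derivedMap_add]; rfl
  have h2 := evalT_map (L.par ∘ₗ (F - (εT).toLinearMap.smulRight m)) t
    (TensorProduct.map LinearMap.id Polynomial.derivative (scaleZ k U w))
  rw [map_map_poly, LinearMap.comp_id, LinearMap.id_comp] at h2
  rw [h1, map_sub, map_map_poly, LinearMap.comp_id, map_sub, h2]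
  change L.par (F (derivScaleT U t w) - εT (derivScaleT U t w) • m) - _ = _
  rw [algebraMapInv_derivScaleT h.involutive]
  simp

/-- Every identity is tested at `z = t`. The `dz`-free component of the structure equation is
`derivedMap_compat`. In the `dz`-component the derivative of `tʳ F` cancels and the derivative of
`-t pr F` is left. -/
theorem isLInftyMap_derivedHomotopy :
    IsLInftyMap P (pr ∘ₗ F) L.poly (derivedHomotopy P j pr m F) := by
  have e1 : ∀ t w, evalT E t (derivedHomotopy P j pr m F w).1 = derivedMap j pr m F t w :=
    fun t w => LinearMap.congr_fun (h.evalT_fst_derivedHomotopy t) w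
  have e2 : ∀ t w, evalT E t (derivedHomotopy P j pr m F w).2 = j (P (TensorAlgebra.ιInv w)) :=
    fun t w => LinearMap.congr_fun (h.evalT_snd_derivedHomotopy t) w
  constructor
  · exact h.derivedHomotopy_mem
  · intro w
    refine Prod.ext (evalT_ext fun t => ?_) (evalT_ext fun t => ?_)
    · simp only [poly_par_apply, Prod.fst_neg, map_neg, evalT_map, e1, h.par_derivedMap]
    · simp only [poly_par_apply, Prod.snd_neg, map_neg, evalT_map, e2, h.par_j, ιInv_parT]
  · intro i i' x y a b hx hy
    refine Prod.ext (evalT_ext fun t => ?_) (evalT_ext fun t => ?_)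
    · rw [Prod.smul_fst, map_smul, e1, e1]
      exact h.derivedMap_symm t i i' x y a b hx hy
    · rw [Prod.smul_snd, map_smul, e2, e2]
      simp [ιInv_mul]
  · refine Prod.ext (evalT_ext fun t => ?_) (evalT_ext fun t => ?_)
    · rw [e1, h.derivedMap_one]; simp
    · rw [e2]; simp
  · intro w
    refine Prod.ext (evalT_ext fun t => ?_) (evalT_ext fun t => ?_)
    · rw [Prod.fst_add, Prod.fst_neg, Prod.smul_fst, map_add, map_neg, map_smul,
        (lift_map_poly L _ t w).1, e1, h.derivedMap_extS, ← h.derivedMap_compat,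
        h.evalT_fst_derivedHomotopy, poly_d_apply, evalT_map, e1, h.d_eq]
    -- A word of length one arises only when `pr ∘ F` consumes all of `w`.
    · have h1 : TensorAlgebra.ιInv (extS P (pr ∘ₗ F) w) = pr (F w) := by
        refine unshuffle_counit_right (Ψ := TensorAlgebra.ιInv ∘ₗ LinearMap.mul' k T ∘ₗ
          TensorProduct.map (ιT ∘ₗ pr ∘ₗ F) LinearMap.id) (f := pr ∘ₗ F) h.involutive
          (fun a b => ?_) w
        simp [ιInv_mul]
      rw [Prod.snd_add, Prod.snd_neg, Prod.smul_snd, map_add, map_neg, map_smul,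
        (lift_map_poly L _ t w).2, e2, h1, h.evalT_fst_derivedHomotopy,
        h.evalT_snd_derivedHomotopy, h.derivedHomotopy_compat_snd, poly_d_apply, map_add,
        h.evalT_deriv_derivedHomotopy, evalT_map, e2, h.d_eq, map_sub, h.par_j]
      abel

theorem isHomotopy :
    IsHomotopy P (pr ∘ₗ F) L 0 (derivedMap j pr m F 1) (derivedHomotopy P j pr m F) := by
  refine ⟨h.isLInftyMap_derivedHomotopy, ?_, h.evalT_fst_derivedHomotopy 1⟩
  refine (h.evalT_fst_derivedHomotopy 0).trans (LinearMap.ext fun w => ?_)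
  refine eq_of_left (g := (0 : T →ₗ[k] E)) h.involutive (h.derivedMap_one 0)
    (fun i x w _ _ => ?_) w
  simp [derivedMap]

end IsDerivedBracket

end NullHomotopy

/-! ### The homotopy fiber -/

section HomotopyFiber

variable {k : Type*} [Field k] {U : Type*} [AddCommGroup U] [Module k U]
  {E : Type*} [AddCommGroup E] [Module k E] [CharZero k] {P : U →ₗ[k] U} {L : DGLieData k E}
  {j : U →ₗ[k] E} {pr : E →ₗ[k] U} {m : E} {F : TensorAlgebra k U →ₗ[k] E}

local notation "T" => TensorAlgebra k U
local notation "ιT" => TensorAlgebra.ι k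

theorem IsDGLA.restrict (hL : IsDGLA L) {S : Submodule k E} (par : ∀ x ∈ S, L.par x ∈ S)
    (d : ∀ x ∈ L.carrier, x ∈ S → L.d x ∈ S)
    (br : ∀ x ∈ L.carrier, ∀ y ∈ L.carrier, x ∈ S → y ∈ S → L.br x y ∈ S) :
    IsDGLA (L.restrict S) where
  par_mem x hx := ⟨hL.par_mem x hx.1, par x hx.2⟩
  d_mem x hx := ⟨hL.d_mem x hx.1, d x hx.1 hx.2⟩
  br_mem x hx y hy := ⟨hL.br_mem x hx.1 y hy.1, br x hx.1 y hy.1 hx.2 hy.2⟩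
  par_par x hx := hL.par_par x hx.1
  par_d x hx := hL.par_d x hx.1
  par_br x hx y hy := hL.par_br x hx.1 y hy.1
  d_d x hx := hL.d_d x hx.1
  skew i j x y hx hy := hL.skew i j x y ⟨hx.1.1, hx.2⟩ ⟨hy.1.1, hy.2⟩
  jacobi i j l x y z hx hy hz := hL.jacobi i j l x y z ⟨hx.1.1, hx.2⟩ ⟨hy.1.1, hy.2⟩ ⟨hz.1.1, hz.2⟩
  leibniz i x y hx hy := hL.leibniz i x y ⟨hx.1.1, hx.2⟩ hy.1

omit [CharZero k] in
theorem hofiber_br_apply {E' : Type*} [AddCommGroup E'] [Module k E'] (G : DGLieData k E)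
    (H : DGLieData k E') (g : E →ₗ[k] E') (x y : E × ((E' ⊗[k] k[X]) × (E' ⊗[k] k[X]))) :
    (hofiber G H g).br x y = (G.br x.1 y.1, H.poly.br x.2 y.2) := by
  simp [hofiber]

/-- The operations of the fiber are componentwise, and the values of `s` at `z = 0` and `z = 1` are
the two equations that cut the fiber out. -/
theorem isLInftyMap_hofiber {E' : Type*} [AddCommGroup E'] [Module k E'] {G : DGLieData k E}
    {H : DGLieData k E'} {g : E →ₗ[k] E'} {μ : T →ₗ[k] U} {f : T →ₗ[k] E}
    {s : T →ₗ[k] (E' ⊗[k] k[X]) × (E' ⊗[k] k[X])} (hf : IsLInftyMap P μ G f)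
    (hs : IsHomotopy P μ H 0 (g ∘ₗ f) s) : IsLInftyMap P μ (hofiber G H g) (f.prod s) := by
  obtain ⟨hs, hs0, hs1⟩ := hs
  constructor
  · intro w
    refine ⟨⟨⟨hf.mem w, hs.mem w⟩, LinearMap.congr_fun hs0 w⟩, ?_⟩
    exact sub_eq_zero.2 (LinearMap.congr_fun hs1 w)
  · exact fun w => Prod.ext (hf.even w) (hs.even w)
  · exact fun i i' x y a b hx hy => Prod.ext (hf.symm i i' x y a b hx hy)
      (hs.symm i i' x y a b hx hy)
  · exact Prod.ext hf.const_eq_zero hs.const_eq_zero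
  · intro w
    have h1 : TensorProduct.lift ((hofiber G H g).br ∘ₗ (hofiber G H g).par)
        (TensorProduct.map (f.prod s) (f.prod s) (unshuffle P w)) =
        (TensorProduct.lift (G.br ∘ₗ G.par) (TensorProduct.map f f (unshuffle P w)),
          TensorProduct.lift (H.poly.br ∘ₗ H.poly.par)
            (TensorProduct.map s s (unshuffle P w))) := by
      induction unshuffle P w using TensorProduct.induction_on with
      | zero => simp only [map_zero, Prod.mk_zero_zero]
      | tmul a b =>
        simp only [TensorProduct.map_tmul, TensorProduct.lift.tmul, LinearMap.comp_apply,
          hofiber_br_apply]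
        rfl
      | add a b ha hb => simp only [map_add, ha, hb, Prod.mk_add_mk]
    rw [h1]
    exact Prod.ext (hf.compat w) (hs.compat w)

namespace IsDerivedBracket

variable (h : IsDerivedBracket P L j pr m F)

include h

theorem map_ι (u : U) : F (ιT u) = L.br m (j u) := by
  have := h.map_mul 1 u
  rwa [one_mul, h.map_one] at this

theorem fst_derivedHomotopy_ι (u : U) : (derivedHomotopy P j pr m F (ιT u)).1 =
    (L.br m (j u) - j (pr (F (ιT u)))) ⊗ₜ Polynomial.X := by
  refine evalT_ext fun t => ?_
  have := LinearMap.congr_fun (h.evalT_fst_derivedHomotopy t) (ιT u)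
  simp only [LinearMap.comp_apply, LinearMap.fst_apply] at this
  rw [this]
  simp [derivedMap, h.map_ι, smul_sub]

theorem snd_derivedHomotopy_ι (u : U) :
    (derivedHomotopy P j pr m F (ιT u)).2 = j (P u) ⊗ₜ 1 := by
  simp [derivedHomotopy]

/-- `x` differs from its constant part by an element of the subalgebra `ker pr`, which also contains
`m`. Hence the constant part of `[m, x]` depends only on `pr x`, through the linear term of the
`L_∞`-structure. -/
theorem pr_br_m {x : E} (hx : x ∈ L.carrier) : pr (L.br m x) = pr (F (ιT (pr x))) := by
  have h1 := h.pr_br m h.m_mem (x - j (pr x)) (sub_mem hx (h.j_mem _)) h.pr_m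
    (by rw [map_sub, h.pr_j, sub_self])
  rw [map_sub, map_sub, sub_eq_zero] at h1
  rw [h1, h.map_ι]

theorem pr_ι_P (u : U) : pr (F (ιT (P u))) = -P (pr (F (ιT u))) := by
  have := h.odd_pr (ιT u)
  rw [LinearMap.comp_apply, LinearMap.comp_apply, parT_ι] at this
  rw [this, neg_neg]

/-- If the linear part of the homotopy at `u` is exact, the `dz`-component of a primitive,
integrated over the unit interval and projected to `U`, gives a primitive of `u` up to parity. -/
theorem injective_aux {u : U} {x : E} {y : (E ⊗[k] k[X]) × (E ⊗[k] k[X])}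
    (hy : y ∈ L.poly.carrier) (hx : pr x = 0) (h0 : evalT E 0 y.1 = 0) (h1 : evalT E 1 y.1 = x)
    (hd : L.poly.d y = derivedHomotopy P j pr m F (ιT u)) : ∃ v, pr (F (ιT v)) = u := by
  have h2 := congrArg Prod.snd hd
  rw [h.snd_derivedHomotopy_ι, poly_d_apply] at h2
  -- Integration of the `dz`-component from 0 to 1. The derivative term integrates to `L.par x`, by
  -- the endpoint values of `y`.
  have h3 := congrArg (evalT E 1 ∘ₗ TensorProduct.map LinearMap.id (antideriv k)) h2
  have h4 : TensorProduct.map L.par Polynomial.derivative y.1 =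
      TensorProduct.map LinearMap.id Polynomial.derivative
        (TensorProduct.map L.par LinearMap.id y.1) := by
    rw [map_map_poly, LinearMap.id_comp, LinearMap.comp_id]
  have h5 : TensorProduct.map LinearMap.id (antideriv k) (TensorProduct.map L.d LinearMap.id y.2) =
      TensorProduct.map L.d LinearMap.id
        (TensorProduct.map LinearMap.id (antideriv k) y.2) := by
    rw [map_map_poly, map_map_poly]; rfl
  set c := evalT E 1 (TensorProduct.map LinearMap.id (antideriv k) y.2) with hc
  have hcm : c ∈ L.carrier :=
    evalT_mem (map_mem_polyCarrier_of_mem (fun x hx => hx) _ hy.2) 1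
  have h6 : antideriv k 1 = Polynomial.X := by
    have := antideriv_monomial (k := k) 0 1
    simpa [Polynomial.X] using this
  simp only [LinearMap.comp_apply, map_add, h4, map_antideriv_derivative, h5, evalT_map, h0, ← hc,
    map_zero, TensorProduct.zero_tmul, sub_zero, h1, TensorProduct.map_tmul, h6, evalT_tmul,
    Polynomial.eval_X, one_smul, LinearMap.id_apply] at h3
  have h7 := congrArg pr h3
  rw [map_add, h.pr_par, hx, map_zero, zero_add, h.d_eq, h.pr_br_m hcm, h.pr_j] at h7
  -- `h7` reads `m₁(pr c) = P u`. As `m₁` is odd, applying `P` costs a sign, which the minus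
  -- compensates.
  refine ⟨-P (pr c), ?_⟩
  rw [map_neg, map_neg, map_neg, h.pr_ι_P, h7, h.involutive, neg_neg]

/-- Subtracting an exact element makes the `dz`-component of a cycle a constant element of `U`.
Closedness then forces the remaining polynomial to be linear in `z`, and what is left is the linear
part of the homotopy at that element. -/
theorem surjective_aux {x : E} {y : (E ⊗[k] k[X]) × (E ⊗[k] k[X])} (hy : y ∈ L.poly.carrier)
    (hpx : pr x = 0) (h0 : evalT E 0 y.1 = 0) (h1 : evalT E 1 y.1 = x)
    (hd : L.poly.d y = 0) : ∃ u, pr (F (ιT u)) = 0 ∧ ∃ x' ∈ L.carrier, pr x' = 0 ∧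
      ∃ y' ∈ L.poly.carrier, evalT E 0 y'.1 = 0 ∧ evalT E 1 y'.1 = x' ∧
        L.d x' = x - derivedMap j pr m F 1 (ιT u) ∧
        L.poly.d y' = y - derivedHomotopy P j pr m F (ιT u) := by
  obtain ⟨p, q⟩ := y
  have hp : p ∈ polyCarrier L.carrier := hy.1
  have hq : q ∈ polyCarrier L.carrier := hy.2
  simp only at h0 h1
  rw [poly_d_apply] at hd
  have hd2 : TensorProduct.map L.par Polynomial.derivative p +
    TensorProduct.map L.d LinearMap.id q = 0 := congrArg Prod.snd hd
  set Q := TensorProduct.map L.par (antideriv k) q with hQ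
  have hQm : Q ∈ polyCarrier L.carrier := map_mem_polyCarrier_of_mem h.isDGLA.par_mem _ hq
  -- A primitive in the fiber must be 0 at `z = 0` and lie in `ker pr` at `z = 1`. The integral `Q`
  -- may violate the second condition by `a`; subtracting `z j a` repairs this and leaves `j (P a)
  -- dz` in the `dz`-component.
  set a := pr (evalT E 1 Q) with ha
  set Q' := Q - j a ⊗ₜ[k] Polynomial.X with hQ'
  have hQ'm : Q' ∈ polyCarrier L.carrier := sub_mem hQm (tmul_mem_polyCarrier (h.j_mem _) _)
  have hQ'd : TensorProduct.map L.par Polynomial.derivative Q' = q - j (P a) ⊗ₜ 1 := by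
    have e1 : L.par ∘ₗ L.par = LinearMap.id := LinearMap.ext h.par_par
    rw [hQ', map_sub, hQ, map_map_poly, derivative_antideriv, e1, TensorProduct.map_id]
    simp [h.par_j]
  have hQ'0 : evalT E 0 Q' = 0 := by
    have e1 : evalT E 0 Q = 0 := by
      rw [hQ, evalT_zero_map_antideriv]
    rw [hQ', map_sub, e1]; simp
  set p' := p - TensorProduct.map L.d LinearMap.id Q' with hp'
  have hp'd : TensorProduct.map L.par Polynomial.derivative p' = -(L.br m (j (P a)) ⊗ₜ 1) := by
    have e1 : TensorProduct.map L.par Polynomial.derivative (TensorProduct.map L.d LinearMap.id Q') =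
        -TensorProduct.map L.d LinearMap.id
          (TensorProduct.map L.par Polynomial.derivative Q') := by
      rw [map_map_poly, map_map_poly, LinearMap.comp_id, LinearMap.id_comp,
        map_congr_of_mem (B := (-1 : k) • (L.d ∘ₗ L.par))
          (fun x hx => (h.isDGLA.par_d x hx).trans (neg_one_smul k _).symm) _ hQ'm,
        TensorProduct.map_smul_left, LinearMap.smul_apply, neg_one_smul]
    rw [hp', map_sub, e1, hQ'd, map_sub, eq_neg_of_add_eq_zero_left hd2]
    rw [TensorProduct.map_tmul, h.d_eq, LinearMap.id_apply]
    abel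
  have hp'0 : evalT E 0 p' = 0 := by rw [hp', map_sub, h0, evalT_map, hQ'0]; simp
  -- `p'` vanishes at 0 and has a constant derivative, hence is linear in `z`.
  have hp'eq : p' = L.br m (j a) ⊗ₜ Polynomial.X := by
    have e1 := congrArg (TensorProduct.map L.par (antideriv k)) hp'd
    have e2 : L.par ∘ₗ L.par = LinearMap.id := LinearMap.ext h.par_par
    have e3 := map_antideriv_derivative p'
    have h6 : antideriv k 1 = Polynomial.X := by
      have := antideriv_monomial (k := k) 0 1
      simpa [Polynomial.X] using this
    rw [map_map_poly, LinearMap.id_comp, hp'0, TensorProduct.zero_tmul, sub_zero] at e3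
    rw [map_map_poly, e2, e3, map_neg, TensorProduct.map_tmul, h6,
      h.isDGLA.par_br _ h.m_mem _ (h.j_mem _), h.par_m, h.par_j, h.involutive] at e1
    rw [e1, map_neg, LinearMap.neg_apply, TensorProduct.neg_tmul, neg_neg]
  set x' := evalT E 1 Q' with hx'
  have hx'p : pr x' = 0 := by rw [hx', hQ', map_sub, map_sub, ← ha]; simp [h.pr_j]
  have hx'm : x' ∈ L.carrier := evalT_mem hQ'm 1
  have hxx : L.br m (j a) = x - L.d x' := by
    have e1 := congrArg (evalT E 1) hp'eq
    rw [hp', map_sub, h1, evalT_map, ← hx'] at e1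
    rw [e1]; simp
  -- `[m, j a]` is the value of `p'` at 1, a difference of two elements of `ker pr`; so `a` is a
  -- cycle for `m₁`.
  have hma : pr (F (ιT a)) = 0 := by
    rw [h.map_ι, hxx, map_sub, hpx, h.d_eq, h.pr_br _ h.m_mem _ hx'm h.pr_m hx'p, sub_zero]
  refine ⟨a, hma, x', hx'm, hx'p, (Q', 0), ⟨hQ'm, zero_mem _⟩, hQ'0, rfl, ?_, ?_⟩
  · have : derivedMap j pr m F 1 (ιT a) = L.br m (j a) := by
      have hma' : pr (L.br m (j a)) = 0 := by rw [← h.map_ι, hma]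
      simp [derivedMap, hma', h.map_ι]
    rw [this, hxx, sub_sub_cancel]
  · refine Prod.ext ?_ ?_
    · rw [Prod.fst_sub, h.fst_derivedHomotopy_ι, hma, map_zero, sub_zero, ← hp'eq, hp',
        sub_sub_cancel]
      rfl
    · rw [Prod.snd_sub, h.snd_derivedHomotopy_ι, poly_d_apply, map_zero, add_zero, hQ'd]

theorem isLInftyQuasiIso : IsLInftyQuasiIso P (pr ∘ₗ F)
    (hofiber (L.restrict (LinearMap.ker pr)) L LinearMap.id)
    ((derivedMap j pr m F 1).prod (derivedHomotopy P j pr m F)) where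
  isLInftyMap := isLInftyMap_hofiber h.isLInftyMap h.isHomotopy
  injective := by
    rintro u hu ⟨⟨x, y⟩, ⟨⟨⟨hx, hy⟩, h0⟩, h1⟩, hd⟩
    exact h.injective_aux hy hx.2 h0 (sub_eq_zero.1 h1) (congrArg Prod.snd hd)
  surjective := by
    rintro ⟨x, y⟩ ⟨⟨⟨hx, hy⟩, h0⟩, h1⟩ hd
    obtain ⟨u, hu, x', hx', hpx', y', hy', hy'0, hy'1, hdx', hdy'⟩ :=
      h.surjective_aux hy hx.2 h0 (sub_eq_zero.1 h1) (congrArg Prod.snd hd)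
    exact ⟨u, hu, (x', y'), ⟨⟨⟨⟨hx', hpx'⟩, hy'⟩, hy'0⟩, sub_eq_zero.2 hy'1⟩,
      Prod.ext hdx' hdy'⟩

/-- The sequence `U → ker pr → L` is a homotopy fiber sequence. -/
theorem isHomotopyFiberSequence :
    IsHomotopyFiberSequence P (pr ∘ₗ F) (L.restrict (LinearMap.ker pr)) L
      (derivedMap j pr m F 1) LinearMap.id where
  isLInfty := h.isLInfty
  isDGLA_mid := by
    refine h.isDGLA.restrict (fun x hx => ?_) (fun x hx hx' => ?_) (fun x hx y hy hx' hy' => ?_)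
    · rw [LinearMap.mem_ker] at hx ⊢
      rw [h.pr_par, hx, map_zero]
    · rw [h.d_eq]
      exact h.pr_br _ h.m_mem _ hx h.pr_m hx'
    · exact h.pr_br _ hx _ hy hx' hy'
  isDGLA_right := h.isDGLA
  isLInftyMap := h.isLInftyMap
  isDGLAHom := ⟨fun x hx => hx.1, fun _ _ => rfl, fun _ _ => rfl, fun _ _ _ _ => rfl⟩
  exists_quasiIso := ⟨_, h.isLInftyQuasiIso, LinearMap.fst_prod _ _⟩

end IsDerivedBracket

end HomotopyFiber

/-! ### Graded pre-Lie algebras -/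

section PreLie

variable {k : Type*} [Field k] {E : Type*} [AddCommGroup E] [Module k E]

/-- A graded right pre-Lie operation `c` on the subspace `S`. -/
structure IsPreLie (Q : E →ₗ[k] E) (c : E →ₗ[k] E →ₗ[k] E) (S : Submodule k E) : Prop where
  involutive : ∀ x, Q (Q x) = x
  map_par : ∀ x y, Q (c x y) = c (Q x) (Q y)
  par_mem : ∀ x ∈ S, Q x ∈ S
  mem : ∀ x ∈ S, ∀ y ∈ S, c x y ∈ S
  assoc : ∀ i j, ∀ x ∈ S, ∀ y ∈ S, ∀ z ∈ S, Q y = sgn k i • y → Q z = sgn k j • z →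
    c (c x y) z - c x (c y z) = sgn k (i * j) • (c (c x z) y - c x (c z y))

variable [CharZero k]

theorem par_gradedCommutator {Q : E →ₗ[k] E} {c : E →ₗ[k] E →ₗ[k] E} (hQ : ∀ x, Q (Q x) = x)
    (hc : ∀ x y, Q (c x y) = c (Q x) (Q y)) (x y : E) :
    Q (gradedCommutator Q c x y) = gradedCommutator Q c (Q x) (Q y) := by
  refine eq_of_hom (f := Q ∘ₗ (gradedCommutator Q c).flip y)
    (g := (gradedCommutator Q c).flip (Q y) ∘ₗ Q) hQ (fun i x hx => ?_) x
  refine eq_of_hom (f := Q ∘ₗ gradedCommutator Q c x)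
    (g := gradedCommutator Q c (Q x) ∘ₗ Q) hQ (fun j y hy => ?_) y
  simp only [LinearMap.comp_apply]
  rw [gradedCommutator_apply c hx hy, map_sub, map_smul, hc, hc, hx, hy]
  simp only [map_smul, LinearMap.smul_apply, gradedCommutator_apply c hx hy, smul_sub, smul_smul]
  module

theorem gradedCommutator_mem {Q : E →ₗ[k] E} {c : E →ₗ[k] E →ₗ[k] E} {S : Submodule k E}
    (hQ : ∀ x ∈ S, Q x ∈ S) (hc : ∀ x ∈ S, ∀ y ∈ S, c x y ∈ S) {x y : E} (hx : x ∈ S)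
    (hy : y ∈ S) : gradedCommutator Q c x y ∈ S := by
  have hp : ∀ x ∈ S, ∀ i, homPart Q i x ∈ S := fun x hx i =>
    Submodule.smul_mem _ _ (add_mem hx (Submodule.smul_mem _ _ (hQ x hx)))
  simp only [gradedCommutator, LinearMap.sub_apply, LinearMap.sum_apply, LinearMap.smul_apply,
    LinearMap.compl₁₂_apply, LinearMap.flip_apply]
  exact sub_mem (hc _ hx _ hy) (sum_mem fun i _ => sum_mem fun j _ =>
    Submodule.smul_mem _ _ (hc _ (hp _ hy _) _ (hp _ hx _)))

/-- Applied to constant cochains, which give zero when composed on the left; their commutator with a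
cochain is then plain insertion. -/
theorem gradedCommutator_eq {Q : E →ₗ[k] E} {c : E →ₗ[k] E →ₗ[k] E} {y : E}
    (h : ∀ j z, c (homPart Q j y) z = 0) (x : E) : gradedCommutator Q c x y = c x y := by
  simp [gradedCommutator, h]

namespace IsPreLie

variable {Q : E →ₗ[k] E} {c : E →ₗ[k] E →ₗ[k] E} {S : Submodule k E} (h : IsPreLie Q c S)

include h

theorem par_mul {i j : ZMod 2} {x y : E} (hx : Q x = sgn k i • x) (hy : Q y = sgn k j • y) :
    Q (c x y) = sgn k (i + j) • c x y := by
  rw [h.map_par, hx, hy, sgn_add]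
  simp only [map_smul, LinearMap.smul_apply, smul_smul, mul_comm]

/-- The Jacobi identity is a signed sum of three instances of the symmetry of the associator, with
`x`, `y` and `z` in turn in the first place. The coefficients depend on the three signs, which
accounts for the eight cases. -/
theorem jacobi {i j l : ZMod 2} {x y z : E} (hx : x ∈ S) (hy : y ∈ S) (hz : z ∈ S)
    (hx' : Q x = sgn k i • x) (hy' : Q y = sgn k j • y) (hz' : Q z = sgn k l • z) :
    gradedCommutator Q c x (gradedCommutator Q c y z) =
      gradedCommutator Q c (gradedCommutator Q c x y) z +
        sgn k (i * j) • gradedCommutator Q c y (gradedCommutator Q c x z) := by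
  have R1 := h.assoc _ _ x hx y hy z hz hy' hz'
  have R2 := h.assoc _ _ y hy x hx z hz hx' hz'
  have R3 := h.assoc _ _ z hz x hx y hy hx' hy'
  rw [gradedCommutator_apply c hy' hz', gradedCommutator_apply c hx' hy',
    gradedCommutator_apply c hx' hz']
  simp only [map_sub, map_smul, LinearMap.sub_apply, LinearMap.smul_apply,
    gradedCommutator_apply c hx' (h.par_mul hy' hz'),
    gradedCommutator_apply c hx' (h.par_mul hz' hy'),
    gradedCommutator_apply c hy' (h.par_mul hx' hz'),
    gradedCommutator_apply c hy' (h.par_mul hz' hx'),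
    gradedCommutator_apply c (h.par_mul hx' hy') hz',
    gradedCommutator_apply c (h.par_mul hy' hx') hz', mul_add, add_mul, sgn_add, mul_comm j i]
  have s : ∀ i : ZMod 2, sgn k i = 1 ∨ sgn k i = -1 := fun i => by
    rcases zmod_two_cases i with rfl | rfl <;> simp
  rcases s (i * j) with ha | ha <;> rcases s (i * l) with hb | hb <;>
    rcases s (j * l) with hd | hd <;> rw [ha] at R3 ⊢ <;> rw [hb] at R2 ⊢ <;> rw [hd] at R1 ⊢
  · linear_combination (norm := module) -R1 + R2 - R3
  · linear_combination (norm := module) -R1 + R2 + R3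
  · linear_combination (norm := module) -R1 + R2 + R3
  · linear_combination (norm := module) -R1 + R2 - R3
  · linear_combination (norm := module) -R1 - R2 - R3
  · linear_combination (norm := module) -R1 - R2 + R3
  · linear_combination (norm := module) -R1 - R2 + R3
  · linear_combination (norm := module) -R1 - R2 - R3

theorem mem_induction {p : E → Prop} (add : ∀ x y, p x → p y → p (x + y))
    (hom : ∀ i, ∀ x ∈ S, Q x = sgn k i • x → p x) {x : E} (hx : x ∈ S) : p x := by
  rw [← homPart_add Q x]
  have hc : ∀ i, homPart Q i x ∈ S := fun i =>
    Submodule.smul_mem _ _ (add_mem hx (Submodule.smul_mem _ _ (h.par_mem x hx)))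
  exact add _ _ (hom _ _ (hc 0) (apply_homPart h.involutive 0 x))
    (hom _ _ (hc 1) (apply_homPart h.involutive 1 x))

/-- A pre-Lie algebra with an odd element of square zero is a dgla with the graded commutator
bracket. -/
theorem isDGLA {m : E} (hm : m ∈ S) (hodd : Q m = -m) (hsq : c m m = 0) :
    IsDGLA { carrier := S, par := Q, d := gradedCommutator Q c m, br := gradedCommutator Q c } := by
  have hm' : Q m = sgn k 1 • m := by rw [hodd]; simp
  have hmm : gradedCommutator Q c m m = 0 := by
    rw [gradedCommutator_apply c hm' hm', hsq]; simp
  constructor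
  · exact h.par_mem
  · exact fun x hx => gradedCommutator_mem h.par_mem h.mem hm hx
  · exact fun x hx y hy => gradedCommutator_mem h.par_mem h.mem hx hy
  · exact fun x _ => h.involutive x
  · intro x _
    change Q (gradedCommutator Q c m x) = -gradedCommutator Q c m (Q x)
    rw [par_gradedCommutator h.involutive h.map_par, hodd, map_neg, LinearMap.neg_apply]
  · exact fun x _ y _ => par_gradedCommutator h.involutive h.map_par x y
  · intro x hx
    change gradedCommutator Q c m (gradedCommutator Q c m x) = 0
    refine h.mem_induction
      (p := fun x => gradedCommutator Q c m (gradedCommutator Q c m x) = 0) ?_ ?_ hx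
    · intro a b ha hb
      rw [map_add, map_add, ha, hb, add_zero]
    · intro i x hx hx'
      -- For odd `m` with `[m, m] = 0` the Jacobi identity says that `[m, [m, x]]` equals its own
      -- negative.
      have := h.jacobi hm hm hx hm' hm' hx'
      rw [hmm, mul_one, sgn_one, neg_one_smul, map_zero, LinearMap.zero_apply, zero_add,
        eq_neg_iff_add_eq_zero, ← two_smul k, smul_eq_zero] at this
      exact this.resolve_left two_ne_zero
  · intro i j x y hx hy
    change gradedCommutator Q c x y = -(sgn k (i * j) • gradedCommutator Q c y x)
    rw [gradedCommutator_apply c hx.2 hy.2, gradedCommutator_apply c hy.2 hx.2, smul_sub,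
      mul_comm j i, sgn_smul_self]
    abel
  · exact fun i j l x y z hx hy hz => h.jacobi hx.1 hy.1 hz.1 hx.2 hy.2 hz.2
  · intro i x y hx hy
    refine h.mem_induction
      (p := fun y => gradedCommutator Q c m (gradedCommutator Q c x y) =
        gradedCommutator Q c (gradedCommutator Q c m x) y +
          sgn k i • gradedCommutator Q c x (gradedCommutator Q c m y)) ?_ ?_ hy
    · intro a b ha hb
      simp only [map_add, ha, hb, smul_add]
      abel
    · intro j y hy hy'
      have := h.jacobi hm hx.1 hy hm' hx.2 hy'
      rwa [one_mul] at this

end IsPreLie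

end PreLie

/-! ### Cochains -/

section Cochain

variable {k : Type*} [Field k] {U : Type*} [AddCommGroup U] [Module k U] {P : U →ₗ[k] U}
  {X : Type*} [AddCommGroup X] [Module k X]

local notation "T" => TensorAlgebra k U
local notation "ιT" => TensorAlgebra.ι k
local notation "εT" => TensorAlgebra.algebraMapInv (R := k) (M := U)

theorem parC_apply (c : T →ₗ[k] U) (w : T) : parC P c w = P (c (parT P w)) := rfl

theorem parC_parC [CharZero k] (hP : ∀ x, P (P x) = x) (c : T →ₗ[k] U) : parC P (parC P c) = c := by
  ext1 w
  simp [parC_apply, hP, parT_parT hP]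

theorem const_apply (u : U) (w : T) : const k U u w = εT w • u := rfl

theorem parC_const (u : U) : parC P (const k U u) = const k U (P u) := by
  ext1 w
  simp [parC_apply, const_apply, algebraMapInv_parT]

theorem homPart_const (i : ZMod 2) (u : U) :
    homPart (parC P) i (const k U u) = const k U (homPart P i u) := by
  simp [homPart, parC_const]

/-- The constant term of a cochain. -/
def constTerm (k U : Type*) [Field k] [AddCommGroup U] [Module k U] :
    (TensorAlgebra k U →ₗ[k] U) →ₗ[k] U := LinearMap.applyₗ 1

@[simp] theorem constTerm_apply (c : T →ₗ[k] U) : constTerm k U c = c 1 := rfl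

theorem hom_apply {g : T →ₗ[k] U} {γ α : ZMod 2} {w : T}
    (hg : parC P g = sgn k γ • g) (hw : parT P w = sgn k α • w) :
    P (g w) = sgn k (γ + α) • g w := by
  have h1 := LinearMap.congr_fun hg w
  rw [parC_apply, hw, map_smul, map_smul, LinearMap.smul_apply] at h1
  rw [add_comm, sgn_add, mul_smul, ← h1, sgn_smul_self]

theorem hom_comp_mulι {g : T →ₗ[k] U} {γ i : ZMod 2} {x : U} (hg : parC P g = sgn k γ • g)
    (hx : P x = sgn k i • x) :
    parC P (g ∘ₗ mulι k U x) = sgn k (γ + i) • (g ∘ₗ mulι k U x) := by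
  ext1 w
  have h1 := LinearMap.congr_fun hg (ιT x * w)
  rw [parC_apply, parT_mul, parT_ι_of_hom hx, smul_mul_assoc, map_smul, map_smul,
    LinearMap.smul_apply] at h1
  rw [parC_apply, LinearMap.smul_apply, LinearMap.comp_apply, LinearMap.comp_apply, mulι_apply,
    mulι_apply, add_comm, sgn_add, mul_smul, ← h1, sgn_smul_self]

/-- The situation passes to any subalgebra that is stable under parity and contains `m` and the
constants. This is how the cyclic cases follow from the others. -/
theorem IsDerivedBracket.restrict {E : Type*} [AddCommGroup E] [Module k E] {L : DGLieData k E}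
    {j : U →ₗ[k] E} {pr : E →ₗ[k] U} {m : E} {F : T →ₗ[k] E} [CharZero k]
    (h : IsDerivedBracket P L j pr m F) {S : Submodule k E} (par : ∀ x ∈ S, L.par x ∈ S)
    (br : ∀ x ∈ L.carrier, ∀ y ∈ L.carrier, x ∈ S → y ∈ S → L.br x y ∈ S) (hm : m ∈ S)
    (hj : ∀ u, j u ∈ S) : IsDerivedBracket P (L.restrict S) j pr m F :=
  { h with
    isDGLA := h.isDGLA.restrict par
      (fun x hx hx' => by rw [h.d_eq]; exact br m h.m_mem x hx hm hx') br
    j_mem := fun u => ⟨h.j_mem u, hj u⟩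
    pr_br := fun x hx y hy => h.pr_br x hx.1 y hy.1
    m_mem := ⟨h.m_mem, hm⟩ }

variable [CharZero k]

/-! ### The composition of graded symmetric cochains -/

theorem extS_apply (g : T →ₗ[k] U) (w : T) : extS P g w =
    LinearMap.mul' k T (TensorProduct.map (ιT ∘ₗ g) LinearMap.id (unshuffle P w)) := rfl

theorem compS_apply (f g : T →ₗ[k] U) : compS P f g = f ∘ₗ extS P g := rfl

@[simp] theorem extS_one (g : T →ₗ[k] U) : extS P g 1 = ιT (g 1) := by
  simp [extS_apply, unshuffle_one]

/-- A constant cochain takes no argument, so only the term of the coproduct with empty left factor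
contributes. -/
theorem extS_const (hP : ∀ x, P (P x) = x) (u : U) : extS P (const k U u) = mulι k U u := by
  ext1 w
  rw [extS_apply, ← LinearMap.comp_apply]
  exact unshuffle_counit_left hP (fun a b => by simp [const_apply]) w

theorem algebraMapInv_extS (g : T →ₗ[k] U) (w : T) : εT (extS P g w) = 0 :=
  algebraMapInv_insertConv g LinearMap.id w

theorem parT_extS (hP : ∀ x, P (P x) = x) (g : T →ₗ[k] U) (w : T) :
    parT P (extS P g (parT P w)) = extS P (parC P g) w := by
  rw [extS_apply, extS_apply, unshuffle_parT hP]
  induction unshuffle P w using TensorProduct.induction_on with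
  | zero => simp
  | tmul a b => simp [parC_apply, parT_parT hP]
  | add a b ha hb => simp only [map_add, ha, hb]

theorem parC_compS (hP : ∀ x, P (P x) = x) (f g : T →ₗ[k] U) :
    parC P (compS P f g) = compS P (parC P f) (parC P g) := by
  ext1 w
  rw [compS_apply, compS_apply, LinearMap.comp_apply, parC_apply, parC_apply, ← parT_extS hP,
    parT_parT hP]
  rfl

theorem parC_mem_gradedSymm {f : T →ₗ[k] U} (hf : f ∈ gradedSymm P U) :
    parC P f ∈ gradedSymm P U := by
  intro i j x y a b hx hy
  simp only [parC_apply, parT_mul, parT_ι]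
  rw [hf i j (P x) (P y) _ _ (by rw [hx, map_smul, hx]) (by rw [hy, map_smul, hy]), map_smul]

/-- The first letter is either an argument of `g` or remains outside; in the second case the
symmetry of `f` moves it to the front. This recursion drives the inductions on graded symmetric
composition. -/
theorem map_extS_ι_mul (hP : ∀ x, P (P x) = x) {f : T →ₗ[k] X} (hf : f ∈ gradedSymm P X)
    {g : T →ₗ[k] U} {γ i : ZMod 2} {x : U} (hg : parC P g = sgn k γ • g) (hx : P x = sgn k i • x)
    (w : T) : f (extS P g (ιT x * w)) =
      f (extS P (g ∘ₗ mulι k U x) w) + sgn k (i * γ) • f (ιT x * extS P g w) := by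
  set Ψ := f ∘ₗ LinearMap.mul' k T ∘ₗ TensorProduct.map (ιT ∘ₗ g) LinearMap.id with hΨ
  have h0 : f (extS P g (ιT x * w)) = Ψ (unshuffle P (ιT x * w)) := rfl
  rw [h0, map_unshuffle_ι_mul _ hx]
  congr 1
  · refine LinearMap.congr_fun (g := f ∘ₗ LinearMap.mul' k T ∘ₗ
      TensorProduct.map (ιT ∘ₗ g ∘ₗ mulι k U x) LinearMap.id) ?_ (unshuffle P w)
    ext a b
    rfl
  · refine LinearMap.congr_fun (g := sgn k (i * γ) • (f ∘ₗ mulι k U x ∘ₗ LinearMap.mul' k T ∘ₗ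
      TensorProduct.map (ιT ∘ₗ g) LinearMap.id)) ?_ (unshuffle P w)
    refine tensor_eq_of_hom (parT_parT hP) (parT_parT hP) fun α β a b ha hb => ?_
    have h1 := gradedSymm_swap hf (hom_apply hg ha) hx 1 b
    rw [one_mul, one_mul] at h1
    simp only [hΨ, LinearMap.comp_apply, TensorProduct.map_tmul, LinearMap.mul'_apply,
      LinearMap.id_apply, mulι_apply, LinearMap.smul_apply, pow_val_of_hom ha, map_smul,
      smul_mul_assoc, h1, sgn_smul_sgn_smul]
    congr 2
    clear * -; revert i α γ; decide

theorem gradedSymm_comp_mulι_mulι {g : T →ₗ[k] X} (hg : g ∈ gradedSymm P X) {i j : ZMod 2}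
    {x y : U} (hx : P x = sgn k i • x) (hy : P y = sgn k j • y) :
    g ∘ₗ mulι k U x ∘ₗ mulι k U y = sgn k (i * j) • (g ∘ₗ mulι k U y ∘ₗ mulι k U x) := by
  ext1 w
  have := gradedSymm_swap hg hx hy 1 w
  rwa [one_mul, one_mul] at this

/-- Peeling off the prefix reduces to exchanging the first two letters. If both go into `g`, or both
stay outside, the symmetry of `g` or of `f` applies; the two mixed terms are interchanged. -/
theorem comp_extS_mem_of_hom (hP : ∀ x, P (P x) = x) {f : T →ₗ[k] X} (hf : f ∈ gradedSymm P X)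
    {g : T →ₗ[k] U} (hg : g ∈ gradedSymm P U) {γ : ZMod 2} (hg' : parC P g = sgn k γ • g) :
    f ∘ₗ extS P g ∈ gradedSymm P X := by
  intro i j x y a b hx hy
  simp only [mul_assoc, LinearMap.comp_apply]
  induction a using left_induction hP generalizing f g γ with
  | one =>
    simp only [one_mul]
    have hfx := gradedSymm_comp_mulι hf x
    have hfy := gradedSymm_comp_mulι hf y
    have hgx := gradedSymm_comp_mulι hg x
    have hgy := gradedSymm_comp_mulι hg y
    have hgx' := hom_comp_mulι hg' hx
    have hgy' := hom_comp_mulι hg' hy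
    have e1 := map_extS_ι_mul hP hfx hg' hy b
    have e2 := map_extS_ι_mul hP hfy hg' hx b
    have e3 := gradedSymm_swap hf hx hy 1 (extS P g b)
    simp only [LinearMap.comp_apply, mulι_apply, one_mul] at e1 e2 e3
    rw [map_extS_ι_mul hP hf hg' hx, map_extS_ι_mul hP hf hgx' hy, e1,
      map_extS_ι_mul hP hf hg' hy, map_extS_ι_mul hP hf hgy' hx, e2, LinearMap.comp_assoc,
      gradedSymm_comp_mulι_mulι hg hx hy, e3, LinearMap.comp_assoc]
    simp only [map_smul, LinearMap.smul_apply, smul_add, sgn_smul_sgn_smul]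
    rw [show i * j + j * γ = j * (γ + i) by ring,
      show i * j + (i * (γ + j)) = i * γ by clear * -; revert i j γ; decide,
      show i * j + (j * γ + i * γ) = i * γ + (j * γ + i * j) by ring]
    abel
  | add a b ha hb =>
    simp only [add_mul, map_add, ha hf hg hg', hb hf hg hg', smul_add]
  | smul r a ha =>
    simp only [smul_mul_assoc, map_smul, ha hf hg hg']
    rw [smul_comm]
  | mul l z w hz hw =>
    have h1 := hw (gradedSymm_comp_mulι hf z) hg hg'
    have h2 := hw hf (gradedSymm_comp_mulι hg z) (hom_comp_mulι hg' hz)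
    simp only [LinearMap.comp_apply, mulι_apply] at h1
    rw [mul_assoc, mul_assoc, map_extS_ι_mul hP hf hg' hz, map_extS_ι_mul hP hf hg' hz, h1, h2,
      smul_add, smul_comm]

theorem comp_extS_mem (hP : ∀ x, P (P x) = x) {f : T →ₗ[k] X} (hf : f ∈ gradedSymm P X)
    {g : T →ₗ[k] U} (hg : g ∈ gradedSymm P U) : f ∘ₗ extS P g ∈ gradedSymm P X := by
  rw [← homPart_add (parC P) g, map_add, LinearMap.comp_add]
  have hc : ∀ i, homPart (parC P) i g ∈ gradedSymm P U := fun i =>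
    Submodule.smul_mem _ _ (add_mem hg (Submodule.smul_mem _ _ (parC_mem_gradedSymm hg)))
  exact add_mem (comp_extS_mem_of_hom hP hf (hc 0) (apply_homPart (parC_parC hP) 0 g))
    (comp_extS_mem_of_hom hP hf (hc 1) (apply_homPart (parC_parC hP) 1 g))

theorem comp_extS_comp_mulι (hP : ∀ x, P (P x) = x) {f : T →ₗ[k] X} (hf : f ∈ gradedSymm P X)
    {g : T →ₗ[k] U} {γ i : ZMod 2} {x : U} (hg : parC P g = sgn k γ • g)
    (hx : P x = sgn k i • x) : (f ∘ₗ extS P g) ∘ₗ mulι k U x =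
      f ∘ₗ extS P (g ∘ₗ mulι k U x) + sgn k (i * γ) • ((f ∘ₗ mulι k U x) ∘ₗ extS P g) :=
  LinearMap.ext fun w => map_extS_ι_mul hP hf hg hx w

theorem hom_comp_extS (hP : ∀ x, P (P x) = x) {g h : T →ₗ[k] U} {γ η : ZMod 2}
    (hg : parC P g = sgn k γ • g) (hh : parC P h = sgn k η • h) :
    parC P (g ∘ₗ extS P h) = sgn k (γ + η) • (g ∘ₗ extS P h) := by
  have := parC_compS hP g h
  rw [hg, hh, map_smul, map_smul, LinearMap.smul_apply, smul_smul, mul_comm, ← sgn_add] at this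
  exact this

theorem sgn_eq_or (i : ZMod 2) : sgn k i = 1 ∨ sgn k i = -1 := by
  rcases zmod_two_cases i with rfl | rfl <;> simp

/-- The associator consists of the terms in which `g` and `h` are inserted independently into `f`,
so it is symmetric in them up to sign. In the induction a letter is absorbed into one of the three
cochains, which are therefore kept general. -/
theorem compS_assoc (hP : ∀ x, P (P x) = x) {f : T →ₗ[k] X} (hf : f ∈ gradedSymm P X)
    {g h : T →ₗ[k] U} (hg : g ∈ gradedSymm P U) (hh : h ∈ gradedSymm P U) {γ η : ZMod 2}
    (hg' : parC P g = sgn k γ • g) (hh' : parC P h = sgn k η • h) (w : T) :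
    f (extS P g (extS P h w)) - f (extS P (g ∘ₗ extS P h) w) =
      sgn k (γ * η) • (f (extS P h (extS P g w)) - f (extS P (h ∘ₗ extS P g) w)) := by
  induction w using left_induction hP generalizing f g h γ η with
  | one =>
    have hh1 : P (h 1) = sgn k η • h 1 := by simpa using hom_apply hh' parT_one_hom
    have hg1 : P (g 1) = sgn k γ • g 1 := by simpa using hom_apply hg' parT_one_hom
    have e1 := map_extS_ι_mul hP hf hg' hh1 1
    have e2 := map_extS_ι_mul hP hf hh' hg1 1
    have e3 := gradedSymm_swap hf hh1 hg1 1 1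
    simp only [mul_one, one_mul, extS_one, LinearMap.comp_apply, mulι_apply] at e1 e2 e3
    simp only [extS_one, LinearMap.comp_apply, e1, e2, e3, add_sub_cancel_left, sgn_smul_sgn_smul]
    congr 2
    clear * -; revert γ η; decide
  | add a b ha hb =>
    have h1 := ha hf hg hh hg' hh'
    have h2 := hb hf hg hh hg' hh'
    simp only [map_add]
    linear_combination (norm := module) h1 + h2
  | smul r a ha =>
    have h1 := ha hf hg hh hg' hh'
    simp only [map_smul]
    linear_combination (norm := module) r • h1
  | mul i x w hx hw =>
    have hfx := gradedSymm_comp_mulι hf x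
    have hgx := gradedSymm_comp_mulι hg x
    have hhx := gradedSymm_comp_mulι hh x
    have hgx' := hom_comp_mulι hg' hx
    have hhx' := hom_comp_mulι hh' hx
    -- The associator on `x w`, split according to whether `x` is an argument of `h`, `g` or `f`.
    have e : ∀ {g h : T →ₗ[k] U} (hg : g ∈ gradedSymm P U) (hh : h ∈ gradedSymm P U)
        {γ η : ZMod 2} (hg' : parC P g = sgn k γ • g) (hh' : parC P h = sgn k η • h),
        f (extS P g (extS P h (ιT x * w))) - f (extS P (g ∘ₗ extS P h) (ιT x * w)) =
        (f (extS P g (extS P (h ∘ₗ mulι k U x) w)) -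
          f (extS P (g ∘ₗ extS P (h ∘ₗ mulι k U x)) w)) +
        sgn k (i * η) • (f (extS P (g ∘ₗ mulι k U x) (extS P h w)) -
          f (extS P ((g ∘ₗ mulι k U x) ∘ₗ extS P h) w)) +
        sgn k (i * (γ + η)) • (f (ιT x * extS P g (extS P h w)) -
          f (ιT x * extS P (g ∘ₗ extS P h) w)) := by
      intro g h hg hh γ η hg' hh'
      have e1 := map_extS_ι_mul hP (comp_extS_mem hP hf hg) hh' hx w
      have e2 := map_extS_ι_mul hP hf hg' hx (extS P h w)
      have e3 := map_extS_ι_mul hP hf (hom_comp_extS hP hg' hh') hx w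
      rw [comp_extS_comp_mulι hP hg hh' hx] at e3
      simp only [LinearMap.comp_apply] at e1
      simp only [map_add, map_smul, LinearMap.add_apply, LinearMap.smul_apply] at e3
      rw [e1, e2, e3, smul_add, sgn_smul_sgn_smul, mul_add, add_comm (i * γ)]
      module
    have h1 := hw hf hg hhx hg' hhx'
    have h2 := hw hf hgx hh hgx' hh'
    have h3 := hw hfx hg hh hg' hh'
    simp only [LinearMap.comp_apply, mulι_apply] at h3
    rw [e hg hh hg' hh', e hh hg hh' hg']
    simp only [mul_add, add_mul, sgn_add, mul_comm γ i] at h1 h2 h3 ⊢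
    rcases sgn_eq_or (k := k) (γ * η) with ha | ha <;>
    rcases sgn_eq_or (k := k) (i * γ) with hb | hb <;>
    rcases sgn_eq_or (k := k) (i * η) with hc | hc <;> rw [ha] at h1 h2 h3 ⊢ <;>
      rw [hb] at h1 ⊢ <;> rw [hc] at h2 ⊢
    · linear_combination (norm := module) h1 + h2 + h3
    · linear_combination (norm := module) h1 - h2 - h3
    · linear_combination (norm := module) h1 + h2 - h3
    · linear_combination (norm := module) h1 - h2 + h3
    · linear_combination (norm := module) h1 + h2 + h3
    · linear_combination (norm := module) h1 - h2 - h3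
    · linear_combination (norm := module) h1 + h2 - h3
    · linear_combination (norm := module) h1 - h2 + h3

theorem isPreLie_compS (hP : ∀ x, P (P x) = x) :
    IsPreLie (parC P) (compS P) (gradedSymm P U) where
  involutive := parC_parC hP
  map_par := parC_compS hP
  par_mem _ hx := parC_mem_gradedSymm hx
  mem _ hx _ hy := comp_extS_mem hP hx hy
  assoc _ _ _ hx _ hy _ hz hy' hz' := LinearMap.ext fun w =>
    compS_assoc hP hx hy hz hy' hz' w

theorem const_mem_gradedSymm (u : U) : const k U u ∈ gradedSymm P U := by
  intro i j x y a b _ _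
  simp [const_apply]

/-- The maps `F_r(w₁, …, w_r)(x₁, …, xₙ) = m_{r+n}(w₁, …, w_r, x₁, …, xₙ)`. -/
noncomputable def fullMapS (m : T →ₗ[k] U) : T →ₗ[k] (T →ₗ[k] U) := (LinearMap.mul k T).compr₂ m

/-- Composing a constant with anything on its right gives zero, since the extended cochain never
produces the empty word. So constants commute with each other, and `[c, û]` is `c` with `u` inserted
as the first argument. -/
theorem isDerivedBracket_CE (hP : ∀ x, P (P x) = x) {m : T →ₗ[k] U} (hm : IsLInfty P m) :
    IsDerivedBracket P (CE P m) (const k U) (constTerm k U) m (fullMapS m) where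
  isDGLA := (isPreLie_compS hP).isDGLA hm.symm hm.odd hm.sq_zero
  involutive := hP
  par_par := parC_parC hP
  j_mem := const_mem_gradedSymm
  par_j := parC_const
  pr_j u := by simp [const_apply]
  br_j_j u v := by
    change gradedCommutator (parC P) (compS P) _ _ = 0
    rw [gradedCommutator_eq fun j z => ?_]
    all_goals ext1 w; simp [homPart_const, compS_apply, const_apply, algebraMapInv_extS]
  pr_par x := by simp [CE, parC_apply]
  pr_br x hx y hy hx' hy' := by
    refine LinearMap.mem_ker.1 (gradedCommutator_mem (S := LinearMap.ker (constTerm k U))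
      (fun x hx => ?_) (fun x hx y hy => ?_) (LinearMap.mem_ker.2 hx') (LinearMap.mem_ker.2 hy'))
    · simp only [LinearMap.mem_ker, constTerm_apply, parC_apply, parT_one] at hx ⊢
      rw [hx, map_zero]
    · simp only [LinearMap.mem_ker, constTerm_apply, compS_apply, LinearMap.comp_apply,
        extS_one] at hx hy ⊢
      rw [hy, map_zero, map_zero]
  m_mem := hm.symm
  par_m := hm.odd
  pr_m := hm.const_eq_zero
  br_m_m := by
    have hodd : parC P m = sgn k 1 • m := by rw [hm.odd]; simp
    change gradedCommutator (parC P) (compS P) _ _ = 0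
    rw [gradedCommutator_apply _ hodd hodd, hm.sq_zero, smul_zero, sub_zero]
  d_eq _ := rfl
  map_one := by ext1 w; simp [fullMapS]
  map_mul w u := by
    change _ = gradedCommutator (parC P) (compS P) _ _
    rw [gradedCommutator_eq fun j z => ?_]
    · ext1 v; simp [compS_apply, extS_const hP, fullMapS, mul_assoc]
    · ext1 w; simp [homPart_const, compS_apply, const_apply, algebraMapInv_extS]

end Cochain

/-! ### The composition of cochains on the tensor algebra -/

section TensorCochain

variable {k : Type*} [Field k] [CharZero k] {U : Type*} [AddCommGroup U] [Module k U]
  {P : U →ₗ[k] U}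

local notation "T" => TensorAlgebra k U
local notation "ιT" => TensorAlgebra.ι k
local notation "εT" => TensorAlgebra.algebraMapInv (R := k) (M := U)

@[simp] theorem deconcat_one : deconcat k U 1 = 1 ⊗ₜ 1 := by
  simp [deconcat]

theorem deconcat_ι_mul (x : U) (w : T) : deconcat k U (ιT x * w) =
    1 ⊗ₜ (ιT x * w) + TensorProduct.map (mulι k U x) LinearMap.id (deconcat k U w) := by
  -- A copy of the step inside `deconcat`, so that `h0` holds by definition.
  let step : U →ₗ[k] Module.End k (T × (T ⊗[k] T)) :=
    { toFun := fun x => LinearMap.prod (mulι k U x ∘ₗ LinearMap.fst k _ _)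
        (TensorProduct.mk k _ _ 1 ∘ₗ mulι k U x ∘ₗ LinearMap.fst k _ _ +
          TensorProduct.map (mulι k U x) LinearMap.id ∘ₗ LinearMap.snd k _ _)
      map_add' := fun x y => by
        refine LinearMap.ext fun ⟨a, b⟩ => Prod.ext ?_ ?_
        · simp
        · simp [TensorProduct.map_add_left, TensorProduct.tmul_add]
          abel
      map_smul' := fun r x => by
        refine LinearMap.ext fun ⟨a, b⟩ => Prod.ext ?_ ?_
        · simp
        · simp [TensorProduct.map_smul_left] }
  have h0 : ∀ w, deconcat k U w = (TensorAlgebra.lift k step w (1, 1 ⊗ₜ[k] 1)).2 := fun _ => rfl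
  have h1 : ∀ x w (v : T × (T ⊗[k] T)), TensorAlgebra.lift k step (ιT x * w) v =
      step x (TensorAlgebra.lift k step w v) := by
    intro x w v
    rw [map_mul, TensorAlgebra.lift_ι_apply]; rfl
  have h2 : (TensorAlgebra.lift k step w (1, 1 ⊗ₜ[k] 1)).1 = w := by
    -- Parity plays no role here, so the induction is run with the identity as parity operator.
    refine eq_of_left (P := LinearMap.id) (f := LinearMap.fst k _ _ ∘ₗ
      LinearMap.applyₗ (1, 1 ⊗ₜ[k] 1) ∘ₗ (TensorAlgebra.lift k step).toLinearMap)
      (g := LinearMap.id) (fun _ => rfl) (by simp) (fun i x w _ hw => ?_) w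
    change (TensorAlgebra.lift k step w (1, 1 ⊗ₜ[k] 1)).1 = w at hw
    change (TensorAlgebra.lift k step (ιT x * w) (1, 1 ⊗ₜ[k] 1)).1 = ιT x * w
    rw [h1]
    change ιT x * (TensorAlgebra.lift k step w (1, 1 ⊗ₜ[k] 1)).1 = ιT x * w
    rw [hw]
  rw [h0, h1, h0]
  change 1 ⊗ₜ (ιT x * (TensorAlgebra.lift k step w (1, 1 ⊗ₜ[k] 1)).1) + _ = _
  rw [h2]
  rfl

theorem deconcat_parT (w : T) :
    deconcat k U (parT P w) = TensorProduct.map (parT P) (parT P) (deconcat k U w) := by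
  refine eq_of_left (P := LinearMap.id) (f := deconcat k U ∘ₗ parT P)
    (g := TensorProduct.map (parT P) (parT P) ∘ₗ deconcat k U) (fun _ => rfl) (by simp)
    (fun i x w _ hw => ?_) w
  simp only [LinearMap.comp_apply] at hw ⊢
  rw [parT_mul, parT_ι, deconcat_ι_mul, deconcat_ι_mul, hw, map_add, TensorProduct.map_tmul,
    parT_one, parT_mul, parT_ι]
  congr 1
  refine LinearMap.congr_fun (f := TensorProduct.map (mulι k U (P x)) LinearMap.id ∘ₗ
    TensorProduct.map (parT P) (parT P)) (g := TensorProduct.map (parT P) (parT P) ∘ₗ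
    TensorProduct.map (mulι k U x) LinearMap.id) (TensorProduct.ext' fun a b => ?_) _
  simp

/-- The recursion at the last letter; the definition recurses at the first. Rotating a word in the
cyclic case involves both ends. -/
theorem deconcat_mul_ι (w : T) (x : U) : deconcat k U (w * ιT x) =
    (w * ιT x) ⊗ₜ 1 + TensorProduct.map LinearMap.id (LinearMap.mulRight k (ιT x))
      (deconcat k U w) := by
  refine eq_of_left (P := LinearMap.id) (f := deconcat k U ∘ₗ LinearMap.mulRight k (ιT x))
    (g := (TensorProduct.mk k T T).flip 1 ∘ₗ LinearMap.mulRight k (ιT x) +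
      TensorProduct.map LinearMap.id (LinearMap.mulRight k (ιT x)) ∘ₗ deconcat k U)
    (fun _ => rfl) ?_ (fun i y w _ hw => ?_) w
  · have := deconcat_ι_mul x (1 : T)
    rw [mul_one] at this
    simp [this, add_comm]
  · simp only [LinearMap.comp_apply, LinearMap.add_apply, LinearMap.mulRight_apply,
      LinearMap.flip_apply, TensorProduct.mk_apply] at hw ⊢
    rw [mul_assoc, deconcat_ι_mul, hw, deconcat_ι_mul, map_add, map_add, TensorProduct.map_tmul,
      TensorProduct.map_tmul, LinearMap.mulRight_apply, mulι_apply, TensorProduct.map_map,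
      TensorProduct.map_map]
    simp only [LinearMap.id_apply, mul_assoc]
    abel

/-- `w ↦ ∑ g(w') w''`, the sum over the terms `w' ⊗ w''` of the deconcatenation coproduct. -/
noncomputable def prefixT (k U : Type*) [Field k] [AddCommGroup U] [Module k U] :
    (TensorAlgebra k U →ₗ[k] U) →ₗ[k] (TensorAlgebra k U →ₗ[k] TensorAlgebra k U) where
  toFun g := LinearMap.mul' k (TensorAlgebra k U) ∘ₗ
    TensorProduct.map (TensorAlgebra.ι k ∘ₗ g) LinearMap.id ∘ₗ deconcat k U
  map_add' f g := by
    simp only [LinearMap.comp_add, TensorProduct.map_add_left, LinearMap.add_comp]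
  map_smul' r f := by
    simp only [LinearMap.comp_smul, TensorProduct.map_smul_left, LinearMap.smul_comp,
      RingHom.id_apply]

theorem prefixT_apply (g : T →ₗ[k] U) (w : T) : prefixT k U g w =
    LinearMap.mul' k T (TensorProduct.map (ιT ∘ₗ g) LinearMap.id (deconcat k U w)) := rfl

@[simp] theorem prefixT_one (g : T →ₗ[k] U) : prefixT k U g 1 = ιT (g 1) := by
  simp [prefixT_apply]

theorem prefixT_ι_mul (g : T →ₗ[k] U) (x : U) (w : T) : prefixT k U g (ιT x * w) =
    ιT (g 1) * (ιT x * w) + prefixT k U (g ∘ₗ mulι k U x) w := by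
  rw [prefixT_apply, deconcat_ι_mul, map_add, map_add, TensorProduct.map_tmul,
    TensorProduct.map_map]
  rfl

theorem algebraMapInv_prefixT (g : T →ₗ[k] U) (w : T) : εT (prefixT k U g w) = 0 := by
  refine LinearMap.congr_fun (f := (εT).toLinearMap ∘ₗ LinearMap.mul' k T ∘ₗ
    TensorProduct.map (ιT ∘ₗ g) LinearMap.id) (g := 0) (TensorProduct.ext' fun a b => ?_)
    (deconcat k U w)
  simp

theorem parT_prefixT (hP : ∀ x, P (P x) = x) (g : T →ₗ[k] U) (w : T) :
    parT P (prefixT k U g (parT P w)) = prefixT k U (parC P g) w := by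
  rw [prefixT_apply, prefixT_apply, deconcat_parT]
  induction deconcat k U w using TensorProduct.induction_on with
  | zero => simp
  | tmul a b => simp [parC_apply, parT_parT hP]
  | add a b ha hb => simp only [map_add, ha, hb]

/-- After `h` has replaced a prefix by one letter, `g` takes either the empty prefix or a prefix
that contains this letter. -/
theorem prefixT_prefixT (g h : T →ₗ[k] U) (w : T) :
    prefixT k U g (prefixT k U h w) =
      ιT (g 1) * prefixT k U h w + prefixT k U (g ∘ₗ prefixT k U h) w := by
  have h1 : ∀ u : U, prefixT k U g (ιT u) = ιT (g 1) * ιT u + ιT (g (ιT u)) := by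
    intro u
    have := prefixT_ι_mul g u 1
    simpa using this
  have hid : ∀ x : U, (LinearMap.id : U →ₗ[k] U) ((LinearMap.id : U →ₗ[k] U) x) = x := fun _ => rfl
  induction w using left_induction hid generalizing h with
  | one => simp [h1]
  | add a b ha hb =>
    simp only [map_add, ha, hb, mul_add]
    abel
  | smul r a ha => simp only [map_smul, ha, smul_add, mul_smul_comm]
  | mul i x w _ hw =>
    have h2 : (g ∘ₗ prefixT k U h) ∘ₗ mulι k U x =
        (g ∘ₗ mulι k U (h 1)) ∘ₗ mulι k U x + g ∘ₗ prefixT k U (h ∘ₗ mulι k U x) := by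
      ext1 w
      simp only [LinearMap.comp_apply, LinearMap.add_apply, mulι_apply, prefixT_ι_mul, map_add]
    have h3 : (g ∘ₗ prefixT k U h) 1 = (g ∘ₗ mulι k U (h 1)) 1 := by simp
    rw [prefixT_ι_mul h, map_add, hw, prefixT_ι_mul, prefixT_ι_mul, prefixT_ι_mul _ x, h2, map_add,
      LinearMap.add_apply, h3, mul_add]
    abel

theorem extT_apply (g : T →ₗ[k] U) (w : T) : extT P g w = ∑ i : ZMod 2, LinearMap.mul' k T
    (TensorProduct.map (parT P ^ i.val) (prefixT k U (homPart (parC P) i g)) (deconcat k U w)) := by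
  simp only [extT, LinearMap.coe_mk, AddHom.coe_mk, LinearMap.sum_apply]
  rfl

theorem compT_apply (f g : T →ₗ[k] U) : compT P f g = f ∘ₗ extT P g := rfl

@[simp] theorem extT_one (g : T →ₗ[k] U) : extT P g 1 = ιT (g 1) := by
  have h1 : ∑ i : ZMod 2, homPart (parC P) i g = g :=
    (Fin.sum_univ_two _).trans (homPart_add (parC P) g)
  simp only [extT_apply, deconcat_one, TensorProduct.map_tmul, parT_pow_one, prefixT_one,
    LinearMap.mul'_apply, one_mul]
  rw [← map_sum, ← LinearMap.sum_apply, h1]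

theorem algebraMapInv_extT (g : T →ₗ[k] U) (w : T) : εT (extT P g w) = 0 := by
  rw [extT_apply, map_sum]
  refine Finset.sum_eq_zero fun i _ => ?_
  refine LinearMap.congr_fun (f := (εT).toLinearMap ∘ₗ LinearMap.mul' k T ∘ₗ
    TensorProduct.map (parT P ^ i.val) (prefixT k U (homPart (parC P) i g))) (g := 0)
    (TensorProduct.ext' fun a b => ?_) (deconcat k U w)
  simp [algebraMapInv_prefixT]

theorem parT_extT (hP : ∀ x, P (P x) = x) (g : T →ₗ[k] U) (w : T) :
    parT P (extT P g (parT P w)) = extT P (parC P g) w := by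
  rw [extT_apply, extT_apply, map_sum]
  refine Finset.sum_congr rfl fun i _ => ?_
  have h1 : homPart (parC P) i (parC P g) = parC P (homPart (parC P) i g) := by
    simp [homPart]
  rw [deconcat_parT, h1]
  induction deconcat k U w using TensorProduct.induction_on with
  | zero => simp
  | tmul a b =>
    simp only [TensorProduct.map_tmul, LinearMap.mul'_apply, parT_mul, parT_prefixT hP,
      parT_parT_pow, parT_parT hP]
  | add a b ha hb => simp only [map_add, ha, hb]

theorem parC_compT (hP : ∀ x, P (P x) = x) (f g : T →ₗ[k] U) :
    parC P (compT P f g) = compT P (parC P f) (parC P g) := by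
  ext1 w
  rw [compT_apply, compT_apply, LinearMap.comp_apply, parC_apply, parC_apply, ← parT_extT hP,
    parT_parT hP]
  rfl

theorem extT_of_hom {g : T →ₗ[k] U} {γ : ZMod 2} (hg : parC P g = sgn k γ • g) (w : T) :
    extT P g w = LinearMap.mul' k T
      (TensorProduct.map (parT P ^ γ.val) (prefixT k U g) (deconcat k U w)) := by
  rw [extT_apply, Finset.sum_eq_single γ]
  · rw [homPart_of_hom hg, if_pos rfl]
  · intro j _ hj
    rw [homPart_of_hom hg, if_neg hj, map_zero, TensorProduct.map_zero_right]
    simp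
  · simp

/-- The block on which `g` acts either begins at the start of the word or lies after `x`; in the
latter case `g` has passed `x`. -/
theorem extT_ι_mul {g : T →ₗ[k] U} {γ i : ZMod 2} {x : U} (hg : parC P g = sgn k γ • g)
    (hx : P x = sgn k i • x) (w : T) :
    extT P g (ιT x * w) = prefixT k U g (ιT x * w) + sgn k (i * γ) • (ιT x * extT P g w) := by
  rw [extT_of_hom hg, extT_of_hom hg, deconcat_ι_mul, map_add, map_add, TensorProduct.map_tmul,
    parT_pow_one, LinearMap.mul'_apply, one_mul]
  congr 1
  refine LinearMap.congr_fun (f := LinearMap.mul' k T ∘ₗ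
    TensorProduct.map (parT P ^ γ.val) (prefixT k U g) ∘ₗ
    TensorProduct.map (mulι k U x) LinearMap.id) (g := sgn k (i * γ) • (mulι k U x ∘ₗ
    LinearMap.mul' k T ∘ₗ TensorProduct.map (parT P ^ γ.val) (prefixT k U g)))
    (TensorProduct.ext' fun a b => ?_) (deconcat k U w)
  simp only [LinearMap.comp_apply, TensorProduct.map_tmul, LinearMap.mul'_apply, mulι_apply,
    LinearMap.id_apply, LinearMap.smul_apply, parT_pow_mul, pow_val_of_hom (parT_ι_of_hom hx),
    smul_mul_assoc, mul_assoc, mul_comm γ i]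

/-- The sum of the `± g(w') D_h(w'')` over the deconcatenations of `w`. -/
noncomputable def prefixPair (P : U →ₗ[k] U) (η : ZMod 2) (g h : T →ₗ[k] U) : T →ₗ[k] T :=
  LinearMap.mul' k T ∘ₗ TensorProduct.map (ιT ∘ₗ g ∘ₗ (parT P ^ η.val)) (extT P h) ∘ₗ deconcat k U

theorem prefixPair_ι_mul (η : ZMod 2) (g h : T →ₗ[k] U) {i : ZMod 2} {x : U}
    (hx : P x = sgn k i • x) (w : T) : prefixPair P η g h (ιT x * w) =
    ιT (g 1) * extT P h (ιT x * w) + sgn k (i * η) • prefixPair P η (g ∘ₗ mulι k U x) h w := by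
  simp only [prefixPair, LinearMap.comp_apply]
  rw [deconcat_ι_mul, map_add, map_add, TensorProduct.map_tmul, LinearMap.mul'_apply,
    LinearMap.comp_apply, LinearMap.comp_apply, parT_pow_one]
  congr 1
  refine LinearMap.congr_fun (f := LinearMap.mul' k T ∘ₗ
    TensorProduct.map (ιT ∘ₗ g ∘ₗ (parT P ^ η.val)) (extT P h) ∘ₗ
    TensorProduct.map (mulι k U x) LinearMap.id) (g := sgn k (i * η) • (LinearMap.mul' k T ∘ₗ
    TensorProduct.map (ιT ∘ₗ (g ∘ₗ mulι k U x) ∘ₗ (parT P ^ η.val)) (extT P h)))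
    (TensorProduct.ext' fun a b => ?_) (deconcat k U w)
  simp only [LinearMap.comp_apply, TensorProduct.map_tmul, LinearMap.mul'_apply, mulι_apply,
    LinearMap.id_apply, LinearMap.smul_apply, parT_pow_mul, pow_val_of_hom (parT_ι_of_hom hx),
    smul_mul_assoc, map_smul, mul_comm η i]

/-- The block of `g` either begins at the start of the word or lies to the right of the letter
produced by `h`. -/
theorem extT_prefixT (hP : ∀ x, P (P x) = x) {g h : T →ₗ[k] U} {γ η : ZMod 2}
    (hg : parC P g = sgn k γ • g) (hh : parC P h = sgn k η • h) (w : T) :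
    extT P g (prefixT k U h w) =
      prefixT k U g (prefixT k U h w) + sgn k (γ * η) • prefixPair P γ h g w := by
  refine LinearMap.congr_fun (f := extT P g ∘ₗ LinearMap.mul' k T ∘ₗ
    TensorProduct.map (ιT ∘ₗ h) LinearMap.id) (g := prefixT k U g ∘ₗ LinearMap.mul' k T ∘ₗ
    TensorProduct.map (ιT ∘ₗ h) LinearMap.id + sgn k (γ * η) • (LinearMap.mul' k T ∘ₗ
    TensorProduct.map (ιT ∘ₗ h ∘ₗ (parT P ^ γ.val)) (extT P g))) ?_ (deconcat k U w)
  refine tensor_eq_of_hom (parT_parT hP) (parT_parT hP) fun α β a b ha hb => ?_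
  simp only [LinearMap.comp_apply, TensorProduct.map_tmul, LinearMap.mul'_apply,
    LinearMap.add_apply, LinearMap.smul_apply, LinearMap.id_apply,
    extT_ι_mul hg (hom_apply hh ha), pow_val_of_hom ha, map_smul, smul_mul_assoc,
    sgn_smul_sgn_smul]
  rw [show (η + α) * γ = γ * η + γ * α by ring]

/-- The block of `h` lies either inside the prefix taken by `g` or to its right. -/
theorem prefixT_extT {h : T →ₗ[k] U} {η : ZMod 2} (hP : ∀ x, P (P x) = x)
    (hh : parC P h = sgn k η • h) (g : T →ₗ[k] U) (w : T) :
    prefixT k U g (extT P h w) = prefixT k U (g ∘ₗ extT P h) w + prefixPair P η g h w := by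
  induction w using left_induction hP generalizing g with
  | one =>
    have := prefixT_ι_mul g (h 1) 1
    simp only [mul_one, prefixT_one] at this
    simp [this, prefixPair, add_comm]
  | add a b ha hb =>
    simp only [map_add, ha, hb]
    abel
  | smul r a ha => simp only [map_smul, ha, smul_add]
  | mul i x w hx hw =>
    have h2 : (g ∘ₗ extT P h) ∘ₗ mulι k U x = (g ∘ₗ prefixT k U h) ∘ₗ mulι k U x +
        sgn k (i * η) • ((g ∘ₗ mulι k U x) ∘ₗ extT P h) := by
      ext1 w
      simp only [LinearMap.comp_apply, LinearMap.add_apply, mulι_apply, extT_ι_mul hh hx, map_add,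
        map_smul, LinearMap.smul_apply]
    have h3 : (g ∘ₗ extT P h) 1 = (g ∘ₗ prefixT k U h) 1 := by simp
    rw [extT_ι_mul hh hx, map_add, map_smul, prefixT_prefixT, prefixT_ι_mul (g ∘ₗ prefixT k U h),
      prefixT_ι_mul g, prefixT_ι_mul (g ∘ₗ extT P h), h2, h3, hw, prefixPair_ι_mul _ _ _ hx, extT_ι_mul hh hx, map_add, map_smul,
      LinearMap.add_apply, LinearMap.smul_apply, prefixT_ι_mul h x]
    simp only [mul_add, smul_add, mul_smul_comm]
    abel

theorem hom_comp_extT (hP : ∀ x, P (P x) = x) {g h : T →ₗ[k] U} {γ η : ZMod 2}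
    (hg : parC P g = sgn k γ • g) (hh : parC P h = sgn k η • h) :
    parC P (g ∘ₗ extT P h) = sgn k (γ + η) • (g ∘ₗ extT P h) := by
  have := parC_compT hP g h
  rw [hg, hh, map_smul, map_smul, LinearMap.smul_apply, smul_smul, mul_comm, ← sgn_add] at this
  exact this

/-- What remains after subtracting the nested terms is the insertion of `g` and `h` into disjoint
blocks, which is symmetric in them up to sign. The identity already holds for the operators on `T
U`, before `f` is applied. -/
theorem extT_assoc (hP : ∀ x, P (P x) = x) {g h : T →ₗ[k] U} {γ η : ZMod 2}
    (hg : parC P g = sgn k γ • g) (hh : parC P h = sgn k η • h) (w : T) :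
    extT P g (extT P h w) - extT P (g ∘ₗ extT P h) w =
      sgn k (γ * η) • (extT P h (extT P g w) - extT P (h ∘ₗ extT P g) w) := by
  induction w using left_induction hP with
  | one =>
    have e : ∀ {g h : T →ₗ[k] U} {γ η : ZMod 2} (hg : parC P g = sgn k γ • g)
        (hh : parC P h = sgn k η • h), extT P g (ιT (h 1)) =
        ιT (g 1) * ιT (h 1) + ιT (g (ιT (h 1))) + sgn k (γ * η) • (ιT (h 1) * ιT (g 1)) := by
      intro g h γ η hg hh
      have hh1 : P (h 1) = sgn k η • h 1 := by simpa using hom_apply hh parT_one_hom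
      have := extT_ι_mul hg hh1 1
      rw [prefixT_ι_mul, mul_one, extT_one, prefixT_one, mul_comm η γ] at this
      simpa using this
    simp only [extT_one, e hg hh, e hh hg, LinearMap.comp_apply, smul_sub, smul_add,
      mul_comm η γ, sgn_smul_self]
    abel
  | add a b ha hb =>
    simp only [map_add]
    linear_combination (norm := module) ha + hb
  | smul r a ha =>
    simp only [map_smul]
    linear_combination (norm := module) r • ha
  | mul i x w hx hw =>
    -- The two `prefixPair` terms have one of the blocks at the start of the word, and exchanging
    -- `g` and `h` interchanges them. In the last term both blocks lie after `x`, where the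
    -- induction hypothesis applies.
    have e : ∀ {g h : T →ₗ[k] U} {γ η : ZMod 2} (hg : parC P g = sgn k γ • g)
        (hh : parC P h = sgn k η • h), extT P g (extT P h (ιT x * w)) -
          extT P (g ∘ₗ extT P h) (ιT x * w) =
        prefixPair P η g h (ιT x * w) + sgn k (γ * η) • prefixPair P γ h g (ιT x * w) +
        sgn k (i * (γ + η)) • (ιT x * (extT P g (extT P h w) - extT P (g ∘ₗ extT P h) w)) := by
      intro g h γ η hg hh
      have e1 := prefixT_extT hP hh g (ιT x * w)
      rw [extT_ι_mul hh hx, map_add, map_smul] at e1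
      rw [extT_ι_mul (hom_comp_extT hP hg hh) hx, extT_ι_mul hh hx, map_add, map_smul,
        extT_prefixT hP hg hh, extT_ι_mul hg hx, mul_sub, mul_add, sgn_add]
      linear_combination (norm := module) e1
    rw [e hg hh, e hh hg, hw, smul_add, smul_add, mul_comm η γ, sgn_smul_self, mul_smul_comm,
      smul_comm (sgn k (i * (γ + η))), add_comm η γ]
    abel

theorem isPreLie_compT (hP : ∀ x, P (P x) = x) :
    IsPreLie (parC P) (compT P) (⊤ : Submodule k (T →ₗ[k] U)) where
  involutive := parC_parC hP
  map_par := parC_compT hP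
  par_mem _ _ := trivial
  mem _ _ _ _ := trivial
  assoc i j x _ y _ z _ hy hz := by
    ext1 w
    have := congrArg x (extT_assoc hP hy hz w)
    rwa [map_sub, map_smul, map_sub] at this

/-- The maps `F_r(w₁, …, w_r)(x₁, …, xₙ) = ∑_σ m_{r+n}(σ(w₁ ⊗ ⋯ ⊗ w_r) | x₁, …, xₙ)`. -/
noncomputable def fullMapT (P : U →ₗ[k] U) (m : T →ₗ[k] U) : T →ₗ[k] (T →ₗ[k] U) :=
  LinearMap.compr₂ (insertAll P) m

/-- `insertAll` is an algebra map to the endomorphisms of `T U`, so appending a letter `u` composes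
with the insertion of `u`, and this is the bracket with `û`. Constants again give zero when composed
on the left. -/
theorem isDerivedBracket_Hoch (hP : ∀ x, P (P x) = x) {m : T →ₗ[k] U} (hm : IsAInfty P m) :
    IsDerivedBracket P (Hoch P m) (const k U) (constTerm k U) m (fullMapT P m) where
  isDGLA := (isPreLie_compT hP).isDGLA trivial hm.odd hm.sq_zero
  involutive := hP
  par_par := parC_parC hP
  j_mem _ := trivial
  par_j := parC_const
  pr_j u := by simp [const_apply]
  br_j_j u v := by
    change gradedCommutator (parC P) (compT P) _ _ = 0
    rw [gradedCommutator_eq fun j z => ?_]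
    all_goals ext1 w; simp [homPart_const, compT_apply, const_apply, algebraMapInv_extT]
  pr_par x := by simp [Hoch, parC_apply]
  pr_br x hx y hy hx' hy' := by
    refine LinearMap.mem_ker.1 (gradedCommutator_mem (S := LinearMap.ker (constTerm k U))
      (fun x hx => ?_) (fun x hx y hy => ?_) (LinearMap.mem_ker.2 hx') (LinearMap.mem_ker.2 hy'))
    · simp only [LinearMap.mem_ker, constTerm_apply, parC_apply, parT_one] at hx ⊢
      rw [hx, map_zero]
    · simp only [LinearMap.mem_ker, constTerm_apply, compT_apply, LinearMap.comp_apply,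
        extT_one] at hx hy ⊢
      rw [hy, map_zero, map_zero]
  m_mem := trivial
  par_m := hm.odd
  pr_m := hm.const_eq_zero
  br_m_m := by
    have hodd : parC P m = sgn k 1 • m := by rw [hm.odd]; simp
    change gradedCommutator (parC P) (compT P) _ _ = 0
    rw [gradedCommutator_apply _ hodd hodd, hm.sq_zero, smul_zero, sub_zero]
  d_eq _ := rfl
  map_one := by ext1 w; simp [fullMapT, insertAll]
  map_mul w u := by
    change _ = gradedCommutator (parC P) (compT P) _ _
    rw [gradedCommutator_eq fun j z => ?_]
    · ext1 v; simp [compT_apply, fullMapT, insertAll]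
    · ext1 w; simp [homPart_const, compT_apply, const_apply, algebraMapInv_extT]

end TensorCochain

/-! ### Cyclic cochains -/

section Cyclic

variable {k : Type*} [Field k] [CharZero k] {U : Type*} [AddCommGroup U] [Module k U]
  {P : U →ₗ[k] U} {ω : LinearMap.BilinForm k U}

local notation "T" => TensorAlgebra k U
local notation "ιT" => TensorAlgebra.ι k
local notation "εT" => TensorAlgebra.algebraMapInv (R := k) (M := U)

/-- The form `ω` is homogeneous and graded skew-symmetric. -/
structure IsGradedSkew (P : U →ₗ[k] U) (ω : LinearMap.BilinForm k U) : Prop where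
  homogeneous : ∃ e : ZMod 2, ∀ x y, ω (P x) (P y) = sgn k e • ω x y
  skew : ∀ (i j : ZMod 2) (x y : U), P x = sgn k i • x → P y = sgn k j • y →
    ω x y = sgn k (i * j + 1) • ω y x

theorem cyclic_left {f : T →ₗ[k] U} (hf : f ∈ cyclic P ω) {l i j : ZMod 2} {w : T} {x y : U}
    (hw : parT P w = sgn k l • w) (hx : P x = sgn k i • x) (hy : P y = sgn k j • y) :
    ω (f (ιT y * w)) x = sgn k ((l + i) * j) • ω (f (w * ιT x)) y := by
  rw [hf l i j w x y hw hx hy]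
  exact (sgn_smul_self _ _).symm

theorem parC_mem_cyclic (hP : ∀ x, P (P x) = x) (hω : IsGradedSkew P ω) {f : T →ₗ[k] U}
    (hf : f ∈ cyclic P ω) : parC P f ∈ cyclic P ω := by
  obtain ⟨e, he⟩ := hω.homogeneous
  -- On homogeneous arguments, conjugation by parity multiplies the pairing by a sign that depends
  -- only on the total parity of all arguments, hence is unchanged by rotation.
  have key : ∀ (l j : ZMod 2) (v : T) (y : U), parT P v = sgn k l • v → P y = sgn k j • y →
      ω (parC P f v) y = sgn k (e + l + j) • ω (f v) y := by
    intro l j v y hv hy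
    rw [parC_apply, ← hP y, he, hv, hP, hy]
    simp only [map_smul, LinearMap.smul_apply, sgn_smul_sgn_smul, add_assoc, add_comm j l]
  intro l i j w x y hw hx hy
  rw [key _ _ _ _ (parT_mul_of_hom hw (parT_ι_of_hom hx)) hy,
    key _ _ _ _ (parT_mul_of_hom (parT_ι_of_hom hy) hw) hx, hf l i j w x y hw hx hy,
    show e + (l + i) + j = e + (j + l) + i by ring]
  simp only [smul_eq_mul]
  ring

/-- The cyclicity condition involves only the components `c_n` with `n ≥ 1`. -/
theorem const_mem_cyclic (u : U) : const k U u ∈ cyclic P ω := by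
  intro l i j w x y _ _ _
  simp [const_apply]

/-- Unlike `gradedCommutator_mem`, this does not require `S` to be closed under the composition `c`,
which fails for cyclic cochains. -/
theorem gradedCommutator_mem_of_hom {E : Type*} [AddCommGroup E] [Module k E] {Q : E →ₗ[k] E}
    {c : E →ₗ[k] E →ₗ[k] E} {S : Submodule k E} (hQ : ∀ x, Q (Q x) = x) (hS : ∀ x ∈ S, Q x ∈ S)
    (h : ∀ i j, ∀ x ∈ S, ∀ y ∈ S, Q x = sgn k i • x → Q y = sgn k j • y →
      c x y - sgn k (i * j) • c y x ∈ S) {x y : E} (hx : x ∈ S) (hy : y ∈ S) :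
    gradedCommutator Q c x y ∈ S := by
  have hp : ∀ x ∈ S, ∀ i, homPart Q i x ∈ S := fun x hx i =>
    Submodule.smul_mem _ _ (add_mem hx (Submodule.smul_mem _ _ (hS x hx)))
  have h' : ∀ i j, gradedCommutator Q c (homPart Q i x) (homPart Q j y) ∈ S := by
    intro i j
    have h1 := apply_homPart hQ i x
    have h2 := apply_homPart hQ j y
    rw [gradedCommutator_apply c h1 h2]
    exact h i j _ (hp x hx i) _ (hp y hy j) h1 h2
  rw [← homPart_add Q x, ← homPart_add Q y]
  simp only [map_add, LinearMap.add_apply]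
  exact add_mem (add_mem (h' _ _) (h' _ _)) (add_mem (h' _ _) (h' _ _))

/-- The formal part of the proof that the commutator of two cyclic cochains is cyclic. -/
theorem sub_mem_cyclic {φ γ : ZMod 2} {F G : T →ₗ[k] U} {C C' : T → U → U → k}
    (hF : ∀ (l i j : ZMod 2) (w : T) (x y : U), parT P w = sgn k l • w → P x = sgn k i • x →
      P y = sgn k j • y → ω (F (w * ιT x)) y =
        sgn k ((l + i) * j) * (ω (F (ιT y * w)) x - C w x y - sgn k (φ * γ) * C' w x y))
    (hG : ∀ (l i j : ZMod 2) (w : T) (x y : U), parT P w = sgn k l • w → P x = sgn k i • x →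
      P y = sgn k j • y → ω (G (w * ιT x)) y =
        sgn k ((l + i) * j) * (ω (G (ιT y * w)) x - C' w x y - sgn k (φ * γ) * C w x y)) :
    F - sgn k (φ * γ) • G ∈ cyclic P ω := by
  intro l i j w x y hw hx hy
  simp only [LinearMap.sub_apply, LinearMap.smul_apply, map_sub, map_smul, smul_eq_mul,
    hF l i j w x y hw hx hy, hG l i j w x y hw hx hy]
  rcases sgn_eq_or (k := k) (φ * γ) with h | h <;> rw [h] <;> ring

/-! #### Cochains on the tensor algebra -/

theorem prefixT_mul_ι (g : T →ₗ[k] U) (w : T) (x : U) :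
    prefixT k U g (w * ιT x) = prefixT k U g w * ιT x + ιT (g (w * ιT x)) := by
  rw [prefixT_apply, prefixT_apply, deconcat_mul_ι, map_add, map_add, TensorProduct.map_tmul]
  simp only [LinearMap.comp_apply, LinearMap.id_apply, LinearMap.mul'_apply, mul_one]
  rw [add_comm]
  congr 1
  refine LinearMap.congr_fun (f := LinearMap.mul' k T ∘ₗ TensorProduct.map (ιT ∘ₗ g) LinearMap.id ∘ₗ
    TensorProduct.map LinearMap.id (LinearMap.mulRight k (ιT x)))
    (g := LinearMap.mulRight k (ιT x) ∘ₗ LinearMap.mul' k T ∘ₗ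
      TensorProduct.map (ιT ∘ₗ g) LinearMap.id) (TensorProduct.ext' fun a b => ?_) (deconcat k U w)
  simp [mul_assoc]

/-- The sum of the `± w' g(w'' x)` over the deconcatenations of `w`. -/
noncomputable def suffixT (P : U →ₗ[k] U) (γ : ZMod 2) (g : T →ₗ[k] U) (x : U) : T →ₗ[k] T :=
  LinearMap.mul' k T ∘ₗ TensorProduct.map (parT P ^ γ.val)
    (ιT ∘ₗ g ∘ₗ LinearMap.mulRight k (ιT x)) ∘ₗ deconcat k U

/-- The block of `g` avoids `x` and precedes it, or ends with `x`, or is the empty block behind `x`.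
-/
theorem extT_mul_ι {g : T →ₗ[k] U} {γ : ZMod 2} (hg : parC P g = sgn k γ • g) (w : T) (x : U) :
    extT P g (w * ιT x) = extT P g w * ιT x + suffixT P γ g x w +
      (parT P ^ γ.val) (w * ιT x) * ιT (g 1) := by
  rw [extT_of_hom hg, extT_of_hom hg, deconcat_mul_ι, map_add, map_add, TensorProduct.map_tmul,
    prefixT_one, LinearMap.mul'_apply, add_comm]
  congr 1
  refine LinearMap.congr_fun (f := LinearMap.mul' k T ∘ₗ
    TensorProduct.map (parT P ^ γ.val) (prefixT k U g) ∘ₗ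
    TensorProduct.map LinearMap.id (LinearMap.mulRight k (ιT x)))
    (g := LinearMap.mulRight k (ιT x) ∘ₗ LinearMap.mul' k T ∘ₗ
      TensorProduct.map (parT P ^ γ.val) (prefixT k U g) + LinearMap.mul' k T ∘ₗ
      TensorProduct.map (parT P ^ γ.val) (ιT ∘ₗ g ∘ₗ LinearMap.mulRight k (ιT x)))
    (TensorProduct.ext' fun a b => ?_) (deconcat k U w)
  simp [prefixT_mul_ι, mul_add, mul_assoc]

theorem parT_extT_of_hom (hP : ∀ x, P (P x) = x) {g : T →ₗ[k] U} {γ l : ZMod 2} {w : T}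
    (hg : parC P g = sgn k γ • g) (hw : parT P w = sgn k l • w) :
    parT P (extT P g w) = sgn k (l + γ) • extT P g w := by
  have := parT_extT hP g w
  rw [hw, hg, map_smul, map_smul, map_smul, LinearMap.smul_apply] at this
  rw [sgn_add, mul_smul, ← this, sgn_smul_self]

/-- Splitting `w` into `a b`, both sides pair `g(y a)` with `f(b x)` under `ω`: cyclicity of `f`
brings the left side to this form, skew-symmetry exchanges the two entries, and cyclicity of `g`
gives the right side. -/
theorem cyclic_prefixT (hP : ∀ x, P (P x) = x) (hω : IsGradedSkew P ω) {f g : T →ₗ[k] U}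
    (hf : f ∈ cyclic P ω) (hg : g ∈ cyclic P ω) {φ γ l i j : ZMod 2}
    (hf' : parC P f = sgn k φ • f) (hg' : parC P g = sgn k γ • g) {w : T} {x y : U}
    (hw : parT P w = sgn k l • w) (hx : P x = sgn k i • x) (hy : P y = sgn k j • y) :
    ω (f (prefixT k U (g ∘ₗ mulι k U y) w)) x =
      sgn k ((l + i) * j + φ * γ + 1) • ω (g (suffixT P φ f x w)) y := by
  have key : ω (f (prefixT k U (g ∘ₗ mulι k U y) w)) x =
      sgn k (i * j + φ * γ + 1) • ω (g (suffixT P φ f x ((parT P ^ j.val) w))) y := by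
    have h1 : ∀ n : ℕ, deconcat k U ((parT P ^ n) w) =
        TensorProduct.map (parT P ^ n) (parT P ^ n) (deconcat k U w) := by
      intro n
      induction n with
      | zero => simp [Module.End.one_eq_id]
      | succ n ih =>
        rw [pow_succ', Module.End.mul_apply, deconcat_parT, ih, TensorProduct.map_map]
        rfl
    simp only [suffixT, LinearMap.comp_apply, h1]
    refine LinearMap.congr_fun (f := LinearMap.flip ω x ∘ₗ f ∘ₗ LinearMap.mul' k T ∘ₗ
      TensorProduct.map (ιT ∘ₗ g ∘ₗ mulι k U y) LinearMap.id)
      (g := sgn k (i * j + φ * γ + 1) • (LinearMap.flip ω y ∘ₗ g ∘ₗ LinearMap.mul' k T ∘ₗ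
        TensorProduct.map (parT P ^ φ.val) (ιT ∘ₗ f ∘ₗ LinearMap.mulRight k (ιT x)) ∘ₗ
        TensorProduct.map (parT P ^ j.val) (parT P ^ j.val))) ?_ (deconcat k U w)
    refine tensor_eq_of_hom (parT_parT hP) (parT_parT hP) fun α β a b ha hb => ?_
    have hu := hom_apply hg' (parT_mul_of_hom (parT_ι_of_hom hy) ha)
    have hv := hom_apply hf' (parT_mul_of_hom hb (parT_ι_of_hom hx))
    simp only [LinearMap.comp_apply, TensorProduct.map_tmul, LinearMap.mul'_apply, mulι_apply,
      LinearMap.id_apply, LinearMap.smul_apply, LinearMap.flip_apply, LinearMap.mulRight_apply,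
      pow_val_of_hom ha, pow_val_of_hom hb, map_smul, smul_mul_assoc, mul_smul_comm]
    rw [cyclic_left hf hb hx hu, hω.skew _ _ _ _ hv hu, cyclic_left hg ha hv hy]
    simp only [sgn_smul_sgn_smul]
    congr 2
    clear * -; revert φ γ i j α β; decide
  rw [key, pow_val_of_hom hw, map_smul, map_smul, map_smul, LinearMap.smul_apply,
    sgn_smul_sgn_smul]
  congr 2
  ring

/-- Rotation treats the value of `g` as one letter of `f`. It fails when the block of `g` contains
the moved letter `y` or ends with `x`. The former terms must be subtracted; the latter are rewritten
by `cyclic_prefixT` as the same defect with `f` and `g` exchanged. -/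
theorem cyclic_compT_rotate (hP : ∀ x, P (P x) = x) (hω : IsGradedSkew P ω) {f g : T →ₗ[k] U}
    (hf : f ∈ cyclic P ω) (hg : g ∈ cyclic P ω) {φ γ l i j : ZMod 2}
    (hf' : parC P f = sgn k φ • f) (hg' : parC P g = sgn k γ • g) {w : T} {x y : U}
    (hw : parT P w = sgn k l • w) (hx : P x = sgn k i • x) (hy : P y = sgn k j • y) :
    ω (compT P f g (w * ιT x)) y = sgn k ((l + i) * j) * (ω (compT P f g (ιT y * w)) x -
      ω (f (prefixT k U (g ∘ₗ mulι k U y) w)) x -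
      sgn k (φ * γ) * ω (g (prefixT k U (f ∘ₗ mulι k U y) w)) x) := by
  have hg1 : P (g 1) = sgn k γ • g 1 := by simpa using hom_apply hg' parT_one_hom
  have hwx := parT_mul_of_hom hw (parT_ι_of_hom hx)
  have hyw := parT_mul_of_hom (parT_ι_of_hom hy) hw
  have e1 := hf _ i j _ x y (parT_extT_of_hom hP hg' hw) hx hy
  -- Two rotations carry the empty block behind `x` to the empty block in front of `y`.
  have e2 := hf _ γ j _ (g 1) y hwx hg1 hy
  have e3 := hf _ i γ _ x (g 1) hyw hx hg1
  have e4 := cyclic_prefixT hP hω hg hf hg' hf' hw hx hy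
  simp only [compT_apply, LinearMap.comp_apply]
  rw [extT_mul_ι hg', extT_ι_mul hg' hy, prefixT_ι_mul, pow_val_of_hom hwx]
  simp only [map_add, map_smul, LinearMap.add_apply, LinearMap.smul_apply, smul_mul_assoc]
  rw [e1, e2, ← mul_assoc, e3, e4]
  simp only [smul_eq_mul, sgn_add, add_mul, mul_add, mul_comm γ φ, mul_comm γ j, mul_comm γ l,
    mul_comm γ i, sgn_one]
  rcases sgn_eq_or (k := k) (φ * γ) with h1 | h1 <;> rcases sgn_eq_or (k := k) (l * j) with h2 | h2 <;>
    rcases sgn_eq_or (k := k) (i * j) with h3 | h3 <;>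
    rcases sgn_eq_or (k := k) (j * γ) with h4 | h4 <;>
    rcases sgn_eq_or (k := k) (l * γ) with h5 | h5 <;>
    rcases sgn_eq_or (k := k) (i * γ) with h6 | h6 <;>
    simp only [h1, h2, h3, h4, h5, h6] <;> ring

theorem gradedCommutator_compT_mem_cyclic (hP : ∀ x, P (P x) = x) (hω : IsGradedSkew P ω)
    {f g : T →ₗ[k] U} (hf : f ∈ cyclic P ω) (hg : g ∈ cyclic P ω) :
    gradedCommutator (parC P) (compT P) f g ∈ cyclic P ω := by
  refine gradedCommutator_mem_of_hom (parC_parC hP) (fun f hf => parC_mem_cyclic hP hω hf)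
    (fun φ γ f hf g hg hf' hg' => ?_) hf hg
  refine sub_mem_cyclic
    (C := fun w x y => ω (f (prefixT k U (g ∘ₗ mulι k U y) w)) x)
    (C' := fun w x y => ω (g (prefixT k U (f ∘ₗ mulι k U y) w)) x)
    (fun l i j w x y hw hx hy => cyclic_compT_rotate hP hω hf hg hf' hg' hw hx hy)
    (fun l i j w x y hw hx hy => ?_)
  rw [mul_comm φ γ]
  exact cyclic_compT_rotate hP hω hg hf hg' hf' hw hx hy

/-! #### Graded symmetric cochains -/

theorem gradedSymm_mul_ι (hP : ∀ x, P (P x) = x) {f : T →ₗ[k] U} (hf : f ∈ gradedSymm P U)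
    {l i : ZMod 2} {w : T} {x : U} (hw : parT P w = sgn k l • w) (hx : P x = sgn k i • x) :
    f (w * ιT x) = sgn k (i * l) • f (ιT x * w) := by
  have := gradedSymm_move hP hf hx w 1
  rwa [mul_one, mul_one, pow_val_of_hom hw, mul_smul_comm, map_smul] at this

theorem parT_extS_of_hom (hP : ∀ x, P (P x) = x) {g : T →ₗ[k] U} {γ l : ZMod 2} {w : T}
    (hg : parC P g = sgn k γ • g) (hw : parT P w = sgn k l • w) :
    parT P (extS P g w) = sgn k (l + γ) • extS P g w := by
  have := parT_extS hP g w
  rw [hw, hg, map_smul, map_smul, map_smul, LinearMap.smul_apply] at this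
  rw [sgn_add, mul_smul, ← this, sgn_smul_self]

/-- The same comparison as in `cyclic_prefixT`, with subsets in place of prefixes: both sides are
pairings of `g(x, a)` with `f(y, b)`. The two halves of `w` trade places, so cocommutativity is
needed. -/
theorem cyclic_extS (hP : ∀ x, P (P x) = x) (hω : IsGradedSkew P ω) {f g : T →ₗ[k] U}
    (hfs : f ∈ gradedSymm P U) (hgs : g ∈ gradedSymm P U)
    (hf : f ∈ cyclic P ω) (hg : g ∈ cyclic P ω) {φ γ l i j : ZMod 2}
    (hf' : parC P f = sgn k φ • f) (hg' : parC P g = sgn k γ • g) {w : T} {x y : U}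
    (hw : parT P w = sgn k l • w) (hx : P x = sgn k i • x) (hy : P y = sgn k j • y) :
    ω (f (extS P (g ∘ₗ mulι k U x) w)) y =
      sgn k (i * l + (l + i) * j + φ * γ + 1) • ω (g (extS P (f ∘ₗ mulι k U y) w)) x := by
  have key : ω (f (extS P (g ∘ₗ mulι k U x) w)) y = sgn k (i * j + φ * γ + 1) •
      ω (g (extS P (f ∘ₗ mulι k U y) ((parT P ^ (i + j).val) w))) x := by
    simp only [extS_apply, unshuffle_parT_pow hP]
    refine unshuffle_comm (Ψ := LinearMap.flip ω y ∘ₗ f ∘ₗ LinearMap.mul' k T ∘ₗ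
      TensorProduct.map (ιT ∘ₗ g ∘ₗ mulι k U x) LinearMap.id)
      (Ψ' := sgn k (i * j + φ * γ + 1) • (LinearMap.flip ω x ∘ₗ g ∘ₗ LinearMap.mul' k T ∘ₗ
        TensorProduct.map (ιT ∘ₗ f ∘ₗ mulι k U y) LinearMap.id ∘ₗ
        TensorProduct.map (parT P ^ (i + j).val) (parT P ^ (i + j).val))) hP
      (fun α β a b ha hb => ?_) w
    have hu := hom_apply hg' (parT_mul_of_hom (parT_ι_of_hom hx) ha)
    have hv := hom_apply hf' (parT_mul_of_hom (parT_ι_of_hom hy) hb)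
    simp only [LinearMap.comp_apply, TensorProduct.map_tmul, LinearMap.mul'_apply, mulι_apply,
      LinearMap.id_apply, LinearMap.smul_apply, LinearMap.flip_apply,
      pow_val_of_hom ha, pow_val_of_hom hb, map_smul, smul_mul_assoc, mul_smul_comm]
    have e1 := cyclic_left hg ha hx hv
    rw [gradedSymm_mul_ι hP hgs ha hx, map_smul, LinearMap.smul_apply] at e1
    rw [cyclic_left hf hb hy hu, gradedSymm_mul_ι hP hfs hb hy, map_smul, LinearMap.smul_apply,
      hω.skew _ _ _ _ hv hu, e1]
    simp only [sgn_smul_sgn_smul]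
    congr 2
    clear * -; revert φ γ i j α β; decide
  rw [key, pow_val_of_hom hw, map_smul, map_smul, map_smul, LinearMap.smul_apply,
    sgn_smul_sgn_smul]
  congr 2
  ring

theorem cyclic_compS_rotate (hP : ∀ x, P (P x) = x) (hω : IsGradedSkew P ω) {f g : T →ₗ[k] U}
    (hfs : f ∈ gradedSymm P U) (hgs : g ∈ gradedSymm P U)
    (hf : f ∈ cyclic P ω) (hg : g ∈ cyclic P ω) {φ γ l i j : ZMod 2}
    (hf' : parC P f = sgn k φ • f) (hg' : parC P g = sgn k γ • g) {w : T} {x y : U}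
    (hw : parT P w = sgn k l • w) (hx : P x = sgn k i • x) (hy : P y = sgn k j • y) :
    ω (compS P f g (w * ιT x)) y = sgn k ((l + i) * j) * (ω (compS P f g (ιT y * w)) x -
      ω (f (extS P (g ∘ₗ mulι k U y) w)) x -
      sgn k (φ * γ) * ω (g (extS P (f ∘ₗ mulι k U y) w)) x) := by
  have hE := parT_extS_of_hom hP hg' hw
  have e1 := hf _ i j _ x y hE hx hy
  rw [gradedSymm_mul_ι hP hfs hE hx, map_smul, LinearMap.smul_apply, smul_eq_mul] at e1
  have e2 := cyclic_extS hP hω hfs hgs hf hg hf' hg' hw hx hy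
  rw [compS_apply, gradedSymm_mul_ι hP (comp_extS_mem hP hfs hgs) hw hx]
  simp only [LinearMap.comp_apply]
  rw [map_extS_ι_mul hP hfs hg' hx, map_extS_ι_mul hP hfs hg' hy]
  simp only [map_add, map_smul, LinearMap.add_apply, LinearMap.smul_apply, smul_eq_mul]
  rw [e2]
  simp only [smul_eq_mul, sgn_add, add_mul, mul_add, mul_comm γ j, sgn_one] at e1 ⊢
  rcases sgn_eq_or (k := k) (φ * γ) with h1 | h1 <;> rcases sgn_eq_or (k := k) (l * j) with h2 | h2 <;>
    rcases sgn_eq_or (k := k) (i * j) with h3 | h3 <;>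
    rcases sgn_eq_or (k := k) (j * γ) with h4 | h4 <;>
    rcases sgn_eq_or (k := k) (i * l) with h5 | h5 <;>
    rcases sgn_eq_or (k := k) (i * γ) with h6 | h6 <;>
    simp only [h1, h2, h3, h4, h5, h6] at e1 ⊢ <;> linear_combination e1

theorem gradedCommutator_compS_mem_cyclic (hP : ∀ x, P (P x) = x) (hω : IsGradedSkew P ω)
    {f g : T →ₗ[k] U} (hf : f ∈ gradedSymm P U) (hg : g ∈ gradedSymm P U)
    (hf' : f ∈ cyclic P ω) (hg' : g ∈ cyclic P ω) :
    gradedCommutator (parC P) (compS P) f g ∈ cyclic P ω := by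
  -- The rotation formula also uses graded symmetry, so both conditions are propagated together.
  refine (gradedCommutator_mem_of_hom (S := gradedSymm P U ⊓ cyclic P ω) (parC_parC hP)
    (fun f hf => ⟨parC_mem_gradedSymm hf.1, parC_mem_cyclic hP hω hf.2⟩)
    (fun φ γ f hf g hg hf' hg' => ⟨?_, ?_⟩) (⟨hf, hf'⟩ : f ∈ gradedSymm P U ⊓ cyclic P ω)
    ⟨hg, hg'⟩).2
  · exact sub_mem (comp_extS_mem hP hf.1 hg.1)
      (Submodule.smul_mem _ _ (comp_extS_mem hP hg.1 hf.1))
  refine sub_mem_cyclic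
    (C := fun w x y => ω (f (extS P (g ∘ₗ mulι k U y) w)) x)
    (C' := fun w x y => ω (g (extS P (f ∘ₗ mulι k U y) w)) x)
    (fun l i j w x y hw hx hy => cyclic_compS_rotate hP hω hf.1 hg.1 hf.2 hg.2 hf' hg' hw hx hy)
    (fun l i j w x y hw hx hy => ?_)
  rw [mul_comm φ γ]
  exact cyclic_compS_rotate hP hω hg.1 hf.1 hg.2 hf.2 hg' hf' hw hx hy

end Cyclic

/-! ### From inner products on `V` to graded skew forms on `ΠV` -/

section InnerProduct

variable {k : Type*} [Field k] {V₀ V₁ : Type*} [AddCommGroup V₀] [Module k V₀]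
  [AddCommGroup V₁] [Module k V₁]

theorem parPi_parPi (x : V₀ × V₁) : parPi k V₀ V₁ (parPi k V₀ V₁ x) = x := by
  simp [parPi]

theorem parPi_eq_neg (x : V₀ × V₁) : parPi k V₀ V₁ x = -parV k V₀ V₁ x := by
  simp [parPi, parV]

/-- Parities in `V` and `ΠV` differ by one. The signs `i + 1` and `j + 1` from the definition of
`ω`, together with `(i + 1)(j + 1)` from symmetry, add up to `i j + 1` modulo 2. -/
theorem IsInnerProduct.isGradedSkew {e : ZMod 2} {B : LinearMap.BilinForm k (V₀ × V₁)}
    (hB : IsInnerProduct e B) : IsGradedSkew (parPi k V₀ V₁) (sympl B) where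
  homogeneous := by
    refine ⟨e, fun x y => ?_⟩
    simp only [sympl, LinearMap.comp_apply, parPi_eq_neg, map_neg, LinearMap.neg_apply, neg_neg]
    exact hB.parity _ _
  skew i j x y hx hy := by
    have h : ∀ {i x}, parPi k V₀ V₁ x = sgn k i • x → parV k V₀ V₁ x = sgn k (i + 1) • x := by
      intro i x hx
      rw [parPi_eq_neg, neg_eq_iff_eq_neg] at hx
      rw [hx, sgn_add, sgn_one, mul_neg_one, neg_smul]
    simp only [sympl, LinearMap.comp_apply]
    rw [h hx, h hy, map_smul, map_smul, LinearMap.smul_apply, LinearMap.smul_apply,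
      hB.symm _ _ x y (h hx) (h hy), ← smul_eq_mul, sgn_smul_sgn_smul, sgn_smul_sgn_smul]
    congr 2
    clear * -; revert i j; decide

end InnerProduct

/-! ### The homotopy fiber sequences -/

section Main

variable {k : Type*} [Field k] [CharZero k] {U : Type*} [AddCommGroup U] [Module k U]
  {P : U →ₗ[k] U}

local notation "T" => TensorAlgebra k U

theorem constTerm_comp_fullMapS (m : T →ₗ[k] U) : constTerm k U ∘ₗ fullMapS m = m := by
  ext1 w
  simp [fullMapS]

theorem constTerm_comp_fullMapT (m : T →ₗ[k] U) :
    constTerm k U ∘ₗ fullMapT P m = symmetrize P m := rfl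

theorem redPart_apply (w : T) :
    redPart k U w = w - TensorAlgebra.algebraMapInv (R := k) (M := U) w • 1 := by
  simp [redPart, Algebra.algebraMap_eq_smul_one]

/-- Expanding the product of the two reduced parts, removing the empty word in `w` subtracts the
constant `m`, and removing it in `x` subtracts the constant term `m(w)`; the last term is a multiple
of `m 1 = 0`. -/
theorem mapS_eq_derivedMap {m : T →ₗ[k] U} (hm : m 1 = 0) :
    mapS m = derivedMap (const k U) (constTerm k U) m (fullMapS m) 1 := by
  ext1 w
  ext1 x
  simp [mapS, derivedMap, fullMapS, redPart_apply, const_apply, scaleT_one_left, mul_sub, hm]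
  abel

theorem mapT_eq_derivedMap {m : T →ₗ[k] U} (hm : m 1 = 0) :
    mapT P m = derivedMap (const k U) (constTerm k U) m (fullMapT P m) 1 := by
  have h1 : insertAll P 1 = 1 := by simp [insertAll]
  ext1 w
  ext1 x
  simp [mapT, derivedMap, fullMapT, redPart_apply, const_apply, scaleT_one_left, h1, hm]
  abel

theorem IsDerivedBracket.isHomotopyFiberSequence_nullHomotopy
    {L : DGLieData k (T →ₗ[k] U)} {m μ : T →ₗ[k] U} {f F : T →ₗ[k] T →ₗ[k] U}
    (h : IsDerivedBracket P L (const k U) (constTerm k U) m F) (hμ : constTerm k U ∘ₗ F = μ)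
    (hf : f = derivedMap (const k U) (constTerm k U) m F 1) :
    IsHomotopyFiberSequence P μ (L.restrict (noConst k U)) L f LinearMap.id ∧
      IsHomotopy P μ L 0 f (nullHomotopy P μ f) ∧
      IsLInftyQuasiIso P μ (hofiber (L.restrict (noConst k U)) L LinearMap.id)
        (f.prod (nullHomotopy P μ f)) := by
  subst hμ hf
  -- `noConst` is the kernel of `constTerm`, and `nullHomotopy` is `derivedHomotopy` for constant
  -- cochains, both by unfolding definitions.
  exact ⟨h.isHomotopyFiberSequence, h.isHomotopy, h.isLInftyQuasiIso⟩

end Main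

end InftyAlg

theorem mainTheorem2 {k : Type*} [Field k] [CharZero k] {V₀ V₁ : Type*} [AddCommGroup V₀]
    [Module k V₀] [AddCommGroup V₁] [Module k V₁] :
    -- `L_∞`-algebras
    (∀ m : TensorAlgebra k (V₀ × V₁) →ₗ[k] V₀ × V₁, IsLInfty (parPi k V₀ V₁) m →
      IsHomotopyFiberSequence (parPi k V₀ V₁) m
        ((CE (parPi k V₀ V₁) m).restrict (noConst k (V₀ × V₁))) (CE (parPi k V₀ V₁) m)
        (mapS m) LinearMap.id ∧
      IsHomotopy (parPi k V₀ V₁) m (CE (parPi k V₀ V₁) m) 0 (mapS m)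
        (nullHomotopy (parPi k V₀ V₁) m (mapS m)) ∧
      IsLInftyQuasiIso (parPi k V₀ V₁) m
        (hofiber ((CE (parPi k V₀ V₁) m).restrict (noConst k (V₀ × V₁)))
          (CE (parPi k V₀ V₁) m) LinearMap.id)
        ((mapS m).prod (nullHomotopy (parPi k V₀ V₁) m (mapS m)))) ∧
    -- cyclic `L_∞`-algebras
    (∀ (e : ZMod 2) (B : LinearMap.BilinForm k (V₀ × V₁)), IsInnerProduct e B →
      ∀ m : TensorAlgebra k (V₀ × V₁) →ₗ[k] V₀ × V₁, IsLInfty (parPi k V₀ V₁) m →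
      m ∈ cyclic (parPi k V₀ V₁) (sympl B) →
      IsHomotopyFiberSequence (parPi k V₀ V₁) m
        (((CE (parPi k V₀ V₁) m).restrict (cyclic (parPi k V₀ V₁) (sympl B))).restrict
          (noConst k (V₀ × V₁)))
        ((CE (parPi k V₀ V₁) m).restrict (cyclic (parPi k V₀ V₁) (sympl B)))
        (mapS m) LinearMap.id ∧
      IsHomotopy (parPi k V₀ V₁) m
        ((CE (parPi k V₀ V₁) m).restrict (cyclic (parPi k V₀ V₁) (sympl B))) 0 (mapS m)
        (nullHomotopy (parPi k V₀ V₁) m (mapS m)) ∧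
      IsLInftyQuasiIso (parPi k V₀ V₁) m
        (hofiber
          (((CE (parPi k V₀ V₁) m).restrict (cyclic (parPi k V₀ V₁) (sympl B))).restrict
            (noConst k (V₀ × V₁)))
          ((CE (parPi k V₀ V₁) m).restrict (cyclic (parPi k V₀ V₁) (sympl B))) LinearMap.id)
        ((mapS m).prod (nullHomotopy (parPi k V₀ V₁) m (mapS m)))) ∧
    -- `A_∞`-algebras
    (∀ m : TensorAlgebra k (V₀ × V₁) →ₗ[k] V₀ × V₁, IsAInfty (parPi k V₀ V₁) m →
      IsHomotopyFiberSequence (parPi k V₀ V₁) (symmetrize (parPi k V₀ V₁) m)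
        ((Hoch (parPi k V₀ V₁) m).restrict (noConst k (V₀ × V₁))) (Hoch (parPi k V₀ V₁) m)
        (mapT (parPi k V₀ V₁) m) LinearMap.id ∧
      IsHomotopy (parPi k V₀ V₁) (symmetrize (parPi k V₀ V₁) m) (Hoch (parPi k V₀ V₁) m) 0
        (mapT (parPi k V₀ V₁) m)
        (nullHomotopy (parPi k V₀ V₁) (symmetrize (parPi k V₀ V₁) m)
          (mapT (parPi k V₀ V₁) m)) ∧
      IsLInftyQuasiIso (parPi k V₀ V₁) (symmetrize (parPi k V₀ V₁) m)
        (hofiber ((Hoch (parPi k V₀ V₁) m).restrict (noConst k (V₀ × V₁)))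
          (Hoch (parPi k V₀ V₁) m) LinearMap.id)
        ((mapT (parPi k V₀ V₁) m).prod
          (nullHomotopy (parPi k V₀ V₁) (symmetrize (parPi k V₀ V₁) m)
            (mapT (parPi k V₀ V₁) m)))) ∧
    -- cyclic `A_∞`-algebras
    (∀ (e : ZMod 2) (B : LinearMap.BilinForm k (V₀ × V₁)), IsInnerProduct e B →
      ∀ m : TensorAlgebra k (V₀ × V₁) →ₗ[k] V₀ × V₁, IsAInfty (parPi k V₀ V₁) m →
      m ∈ cyclic (parPi k V₀ V₁) (sympl B) →
      IsHomotopyFiberSequence (parPi k V₀ V₁) (symmetrize (parPi k V₀ V₁) m)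
        (((Hoch (parPi k V₀ V₁) m).restrict (cyclic (parPi k V₀ V₁) (sympl B))).restrict
          (noConst k (V₀ × V₁)))
        ((Hoch (parPi k V₀ V₁) m).restrict (cyclic (parPi k V₀ V₁) (sympl B)))
        (mapT (parPi k V₀ V₁) m) LinearMap.id ∧
      IsHomotopy (parPi k V₀ V₁) (symmetrize (parPi k V₀ V₁) m)
        ((Hoch (parPi k V₀ V₁) m).restrict (cyclic (parPi k V₀ V₁) (sympl B))) 0
        (mapT (parPi k V₀ V₁) m)
        (nullHomotopy (parPi k V₀ V₁) (symmetrize (parPi k V₀ V₁) m)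
          (mapT (parPi k V₀ V₁) m)) ∧
      IsLInftyQuasiIso (parPi k V₀ V₁) (symmetrize (parPi k V₀ V₁) m)
        (hofiber
          (((Hoch (parPi k V₀ V₁) m).restrict (cyclic (parPi k V₀ V₁) (sympl B))).restrict
            (noConst k (V₀ × V₁)))
          ((Hoch (parPi k V₀ V₁) m).restrict (cyclic (parPi k V₀ V₁) (sympl B)))
          LinearMap.id)
        ((mapT (parPi k V₀ V₁) m).prod
          (nullHomotopy (parPi k V₀ V₁) (symmetrize (parPi k V₀ V₁) m)
            (mapT (parPi k V₀ V₁) m)))) := by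
  refine ⟨fun m hm => ?_, fun e B hB m hm hc => ?_, fun m hm => ?_, fun e B hB m hm hc => ?_⟩
  · exact (isDerivedBracket_CE parPi_parPi hm).isHomotopyFiberSequence_nullHomotopy
      (constTerm_comp_fullMapS m) (mapS_eq_derivedMap hm.const_eq_zero)
  · have hω := hB.isGradedSkew
    exact ((isDerivedBracket_CE parPi_parPi hm).restrict
      (fun f hf => parC_mem_cyclic parPi_parPi hω hf)
      (fun f hf g hg hf' hg' => gradedCommutator_compS_mem_cyclic parPi_parPi hω hf hg hf' hg')
      hc const_mem_cyclic).isHomotopyFiberSequence_nullHomotopy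
      (constTerm_comp_fullMapS m) (mapS_eq_derivedMap hm.const_eq_zero)
  · exact (isDerivedBracket_Hoch parPi_parPi hm).isHomotopyFiberSequence_nullHomotopy
      (constTerm_comp_fullMapT m) (mapT_eq_derivedMap hm.const_eq_zero)
  · have hω := hB.isGradedSkew
    exact ((isDerivedBracket_Hoch parPi_parPi hm).restrict
      (fun f hf => parC_mem_cyclic parPi_parPi hω hf)
      (fun f _ g _ hf hg => gradedCommutator_compT_mem_cyclic parPi_parPi hω hf hg)
      hc const_mem_cyclic).isHomotopyFiberSequence_nullHomotopy
      (constTerm_comp_fullMapT m) (mapT_eq_derivedMap hm.const_eq_zero)
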